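/- Let $J_\nu$ denote the Bessel function of the first kind of order $\nu$. For $\alpha>-1/2$, $\beta>0$ and $t,x,z>0$ with $t>|x-z|$ and $t\neq x+z$, put $$K_t^{\alpha,\beta}(x,z)=2^{\alpha+\beta}\,\Gamma(\alpha+\beta+1)\int_0^\infty \frac{J_{\alpha+\beta}(ty)}{(ty)^{\alpha+\beta}}\,\frac{J_\alpha(xy)}{(xy)^\alpha}\,\frac{J_\alpha(zy)}{(zy)^\alpha}\,y^{2\alpha+1}\,dy,$$ where the integral is understood in the improper Riemann sense, as $\lim_{R\to\infty}\int_0^R$. **Theorem.** Let $\alpha>-1/2$ and $\beta>0$ be fixed. For all $t,x,z>0$ with $t>|x-z|$ and $t\ne x+z$ the improper integral converges, so that $K_t^{\alpha,\beta}(x,z)$ is well defined. Moreover, writing $X\simeq Y$ when $cY\le X\le CY$ with constants $c,C>0$ depending only on $\alpha$ and $\beta$, one has $$K_t^{\alpha,\beta}(x,z)\simeq \frac{(xz)^{-\alpha-1/2}}{t^{2\alpha+2\beta}}\big[t^2-(x-z)^2\big]^{\alpha+\beta-1/2}\begin{cases}\left(\frac{(x+z)^2-t^2}{xz}\right)^{\alpha+\beta-1/2},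 & \alpha+\beta<1/2,\\[4pt] 1+\log\left(\frac{4xz}{(x+z)^2-t^2}\right), & \alpha+\beta=1/2,\\[4pt] 1, & \alpha+\beta>1/2,\end{cases}$$ uniformly in $t,x,z>0$ with $|x-z|<t<x+z$, and $$K_t^{\alpha,\beta}(x,z)\simeq \frac{1}{t^{2\alpha+2\beta}}\big[t^2-(x-z)^2\big]^{\beta-1}\begin{cases}\left(\frac{t^2-(x+z)^2}{t^2-(x-z)^2}\right)^{\alpha+\beta-1/2}, & \alpha+\beta<1/2,\\[4pt] 1+\log\left(\frac{t^2-(x-z)^2}{t^2-(x+z)^2}\right), & \alpha+\beta=1/2,\\[4pt] 1, & \alpha+\beta>1/2,\end{cases}$$ uniformly in $t,x,z>0$ with $t>x+z$. -/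

import Mathlib

open Filter Topology

namespace SphericalMeans

noncomputable section

/-- Bessel function of the first kind of real order `ν` at a positive argument `u`:
`J_ν(u) = ∑ₖ (-1)ᵏ / (k! Γ(k + ν + 1)) (u / 2)^(2k + ν)`. -/
def besselJ (ν u : ℝ) : ℝ :=
  ∑' k : ℕ, (-1 : ℝ) ^ k / ((k.factorial : ℝ) * Real.Gamma ((k : ℝ) + ν + 1)) *
    (u / 2) ^ (2 * (k : ℝ) + ν)

/-- The integrand of the kernel with respect to Lebesgue measure `dy` on `(0, ∞)`; the last factor
is the density of `dμ_α(y) = y^(2α+1) dy`. -/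
def kernelIntegrand (α β t x z y : ℝ) : ℝ :=
  besselJ (α + β) (t * y) / (t * y) ^ (α + β) *
    (besselJ α (x * y) / (x * y) ^ α) *
    (besselJ α (z * y) / (z * y) ^ α) * y ^ (2 * α + 1)

/-- The normalised integral over `(0, R)`. -/
def kernelTruncation (α β t x z R : ℝ) : ℝ :=
  2 ^ (α + β) * Real.Gamma (α + β + 1) * ∫ y in (0 : ℝ)..R, kernelIntegrand α β t x z y

/-- The kernel `K_t^{α,β}(x, z)`. The integral over `(0, ∞)` is an improper Riemann integral
(it need not converge absolutely), that is, the limit of the integrals over `(0, R)` as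
`R → ∞`. -/
def kernel (α β t x z : ℝ) : ℝ :=
  limUnder atTop (kernelTruncation α β t x z)

/-- The comparison function in the region `|x - z| < t < x + z`. -/
def innerBound (α β t x z : ℝ) : ℝ :=
  (x * z) ^ (-α - 1 / 2) / t ^ (2 * α + 2 * β) * (t ^ 2 - (x - z) ^ 2) ^ (α + β - 1 / 2) *
    (if α + β < 1 / 2 then (((x + z) ^ 2 - t ^ 2) / (x * z)) ^ (α + β - 1 / 2)
     else if α + β = 1 / 2 then 1 + Real.log (4 * (x * z) / ((x + z) ^ 2 - t ^ 2))
     else 1)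

/-- The comparison function in the region `t > x + z`. -/
def outerBound (α β t x z : ℝ) : ℝ :=
  1 / t ^ (2 * α + 2 * β) * (t ^ 2 - (x - z) ^ 2) ^ (β - 1) *
    (if α + β < 1 / 2 then
      ((t ^ 2 - (x + z) ^ 2) / (t ^ 2 - (x - z) ^ 2)) ^ (α + β - 1 / 2)
     else if α + β = 1 / 2 then
      1 + Real.log ((t ^ 2 - (x - z) ^ 2) / (t ^ 2 - (x + z) ^ 2))
     else 1)

end

end SphericalMeans

/-!
Write `J_ν(u) / u^ν = 2^(-ν) · clifford ν (u² / 4)` with the entire Bessel–Clifford function, and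
pass to the variables `τ = t²` and `η = y² / 4`. The kernel is then an explicit integral: up to a
positive constant it is `t^(-2(α + β))` times the generalised translate

  `translate α β x z τ = ∫₀¹ (τ - w²)₊^(β - 1) (u (1 - u))^(α - 1/2) du`,
  `w² = (x - z)² + 4 x z u`.

Formally this is Gegenbauer's product formula for `J_α(xy) J_α(zy)` followed by Sonine's
discontinuous integral in `y`, but the interchange of integrals is not justified by absolute
convergence. The proof given here reaches the formula (`tendsto_truncIntegral`) in two steps.

For `β > 1` the integral over `y` converges absolutely and both sides are continuous in `τ`. Their
Laplace transforms in `τ` agree: on one side Weber's two exponential integrals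
(`integral_rpow_mul_clifford_mul_exp`, `integral_clifford_mul_clifford_mul_exp`), on the other
Poisson's integral (`integral_exp_mul_betaWeight`) produce the same modified Bessel function.
Uniqueness of Laplace transforms (`eq_of_laplace_eq`, from Weierstrass' theorem) concludes
(`fullIntegral_eq_translate`).

For `0 < β ≤ 1` the parameter is lowered from `β + 1`. The truncated integrals for `β` are the
`τ`-derivatives of those for `β + 1` (`hasDerivAt_truncIntegral`), and they converge locally
uniformly off the surfaces `t = |x ± z|`: each `√u J_ν(u)` equals a pure oscillation up to an
error `O(1/u)` (`exists_oscillation_of_ode`), and the product of the three oscillations has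
the frequencies `t ± x ± z`, which do not vanish there, so that it can be integrated by parts
(`exists_abs_integral_reducedIntegrand_le`). The translate for `β` is likewise `1/β` times the
derivative of the one for `β + 1` (`hasDerivAt_translate_add_one`).

In both regions the translate is a product of powers and Euler's integral
`∫₀¹ u^(a-1) (1-u)^(b-1) (1-ρu)^(c-1) du`. Outside, `ρ = 4xz / (t² - (x - z)²)`,
`(b, c) = (α + 1/2, β)`; inside, `ρ` is the reciprocal and `b`, `c` are interchanged. Since `1 - ρu`
is comparable to `max (1 - ρ) (1 - u)` for `u ≥ 1/2`, Euler's integral is comparable to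
`(1 - ρ)^p + ∫_{1-ρ}^1 w^(p-1) dw`, where `p = b + c - 1 = α + β - 1/2` in both cases. This is a
negative power of `1 - ρ`, a logarithm or bounded according to the sign of `p`
(`exists_eulerIntegral_bounds`), which is the case distinction of the theorem.
-/

namespace SphericalMeans

/-! ### The Bessel–Clifford function -/

/-- The Bessel–Clifford function `∑ₖ (-r)ᵏ / (k! Γ(k + ν + 1))`. It is entire in `r`, and
`J_ν(u) / u^ν = 2^(-ν) · clifford ν (u² / 4)`. At negative arguments it is the modified Bessel
function in the same normalisation. -/
noncomputable def clifford (ν r : ℝ) : ℝ :=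
  ∑' k : ℕ, (-r) ^ k / ((k.factorial : ℝ) * Real.Gamma ((k : ℝ) + ν + 1))

lemma Gamma_shift_pos {ν : ℝ} (hν : -1 < ν) (k : ℕ) : 0 < Real.Gamma ((k : ℝ) + ν + 1) :=
  Real.Gamma_pos_of_pos (by have := k.cast_nonneg (α := ℝ); linarith)

lemma Gamma_shift_succ {ν : ℝ} (hν : -1 < ν) (k : ℕ) :
    Real.Gamma (((k + 1 : ℕ) : ℝ) + ν + 1) = (k + ν + 1) * Real.Gamma ((k : ℝ) + ν + 1) := by
  have := k.cast_nonneg (α := ℝ)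
  rw [← Real.Gamma_add_one (by linarith)]
  push_cast
  ring_nf

/-- A positive lower bound for the Gamma factors of the series, uniform in `k`. `Γ` decreases near
`0`, but `Γ(k + ν + 1)` increases in `k` from `k = 1` on. -/
lemma exists_le_Gamma_shift {ν : ℝ} (hν : -1 < ν) :
    ∃ m : ℝ, 0 < m ∧ ∀ k : ℕ, m ≤ Real.Gamma ((k : ℝ) + ν + 1) := by
  refine ⟨min (Real.Gamma (((0 : ℕ) : ℝ) + ν + 1)) (Real.Gamma (((1 : ℕ) : ℝ) + ν + 1)),
    lt_min (Gamma_shift_pos hν 0) (Gamma_shift_pos hν 1), ?_⟩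
  have h1 : ∀ k : ℕ, Real.Gamma (((1 : ℕ) : ℝ) + ν + 1) ≤
      Real.Gamma (((k + 1 : ℕ) : ℝ) + ν + 1) := by
    intro k
    induction k with
    | zero => simp
    | succ k ih =>
      rw [Gamma_shift_succ hν (k + 1)]
      have := k.cast_nonneg (α := ℝ)
      refine ih.trans (le_mul_of_one_le_left (Gamma_shift_pos hν _).le ?_)
      push_cast
      linarith
  rintro (_ | k)
  · exact min_le_left _ _
  · exact (min_le_right _ _).trans (h1 k)

lemma summable_clifford_norm {ν : ℝ} (hν : -1 < ν) (r : ℝ) :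
    Summable fun k : ℕ => ‖(-r) ^ k / ((k.factorial : ℝ) * Real.Gamma ((k : ℝ) + ν + 1))‖ := by
  obtain ⟨m, hm, h⟩ := exists_le_Gamma_shift hν
  refine Summable.of_nonneg_of_le (fun _ => norm_nonneg _) (fun k => ?_)
    ((Real.summable_pow_div_factorial |r|).mul_left m⁻¹)
  have h1 := Gamma_shift_pos hν k
  have h2 : (0 : ℝ) < k.factorial := by positivity
  rw [norm_div, norm_mul, norm_pow, norm_neg, Real.norm_eq_abs, Real.norm_of_nonneg h2.le,
    Real.norm_of_nonneg h1.le, ← div_div, div_eq_mul_inv, mul_comm]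
  exact mul_le_mul_of_nonneg_right (inv_anti₀ hm (h k)) (by positivity)

lemma summable_clifford {ν : ℝ} (hν : -1 < ν) (r : ℝ) :
    Summable fun k : ℕ => (-r) ^ k / ((k.factorial : ℝ) * Real.Gamma ((k : ℝ) + ν + 1)) :=
  (summable_clifford_norm hν r).of_norm

lemma besselJ_div_rpow {u : ℝ} (ν : ℝ) (hu : 0 < u) :
    besselJ ν u / u ^ ν = 2 ^ (-ν) * clifford ν (u ^ 2 / 4) := by
  unfold besselJ clifford
  rw [← tsum_div_const, ← tsum_mul_left]
  refine tsum_congr fun k => ?_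
  have h1 : (u / 2) ^ (2 * (k : ℝ) + ν) = (u ^ 2 / 4) ^ k * (u ^ ν * 2 ^ (-ν)) := by
    rw [Real.rpow_add (by positivity), mul_comm (2 : ℝ), Real.rpow_mul (by positivity),
      Real.rpow_natCast, Real.rpow_two, Real.div_rpow hu.le (by norm_num),
      Real.rpow_neg (by norm_num), ← pow_mul, mul_comm k 2, pow_mul]
    congr 2
    ring
  have h2 : u ^ ν ≠ 0 := (Real.rpow_pos_of_pos hu ν).ne'
  have h3 : (-(u ^ 2 / 4)) ^ k = (-1) ^ k * (u ^ 2 / 4) ^ k := by rw [← mul_pow]; ring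
  rw [h1, h3]
  field_simp

/-- Termwise differentiation lowers `k` by one, which raises the order. -/
lemma hasDerivAt_clifford {ν : ℝ} (hν : -1 < ν) (r : ℝ) :
    HasDerivAt (clifford ν) (-clifford (ν + 1) r) r := by
  obtain ⟨m, hm, h⟩ := exists_le_Gamma_shift hν
  set ρ : ℝ := |r| + 1
  have hρ : 0 ≤ ρ := by positivity
  set u : ℕ → ℝ := fun k => (k * ρ ^ (k - 1)) / (k.factorial * m)
  set g' : ℕ → ℝ → ℝ := fun k y =>
    (k * (-y) ^ (k - 1) * (-1)) / ((k.factorial : ℝ) * Real.Gamma ((k : ℝ) + ν + 1))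
  have hu : Summable u := by
    rw [← summable_nat_add_iff 1]
    refine ((Real.summable_pow_div_factorial ρ).mul_left m⁻¹).congr fun k => ?_
    simp only [u, Nat.factorial_succ]
    push_cast
    field_simp
  have hd := hasDerivAt_tsum_of_isPreconnected (g := fun (k : ℕ) y =>
      (-y) ^ k / ((k.factorial : ℝ) * Real.Gamma ((k : ℝ) + ν + 1))) (g' := g') hu
      (t := Metric.ball 0 ρ) (y₀ := r) (y := r)
      Metric.isOpen_ball (convex_ball _ _).isPreconnected
      (fun k y _ => ((hasDerivAt_neg y).pow k).div_const _)
      (fun k y hy => by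
        have h1 := Gamma_shift_pos hν k
        have hy' : |y| ≤ ρ := by simpa using (Metric.mem_ball.1 hy).le
        simp only [g', u]
        rw [norm_div, norm_mul, norm_mul, norm_mul, norm_pow, norm_neg, Real.norm_eq_abs y,
          Real.norm_of_nonneg h1.le, Real.norm_natCast, Real.norm_natCast]
        simp only [norm_neg, norm_one, mul_one]
        gcongr
        exact h k)
      (by simp [ρ]) (summable_clifford hν r) (by simp [ρ])
  refine HasDerivAt.congr_deriv (f := clifford ν) hd ?_
  have hs : Summable fun k => g' k r := by
    refine Summable.of_norm_bounded hu fun k => ?_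
    have h1 := Gamma_shift_pos hν k
    have hy' : |r| ≤ ρ := by simp [ρ]
    simp only [g', u]
    rw [norm_div, norm_mul, norm_mul, norm_mul, norm_pow, norm_neg, Real.norm_eq_abs r,
      Real.norm_of_nonneg h1.le, Real.norm_natCast, Real.norm_natCast]
    simp only [norm_neg, norm_one, mul_one]
    gcongr
    exact h k
  rw [hs.tsum_eq_zero_add]
  simp only [g', Nat.cast_zero, zero_mul, zero_div, zero_add]
  unfold clifford
  rw [← tsum_neg]
  refine tsum_congr fun k => ?_
  have h1 := Gamma_shift_pos hν (k + 1)
  have e : Real.Gamma ((k : ℝ) + (ν + 1) + 1) = Real.Gamma (((k + 1 : ℕ) : ℝ) + ν + 1) := by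
    push_cast; ring_nf
  rw [e, Nat.factorial_succ]
  simp only [Nat.add_sub_cancel]
  push_cast at h1 ⊢
  field_simp

lemma continuous_clifford {ν : ℝ} (hν : -1 < ν) : Continuous (clifford ν) :=
  continuous_iff_continuousAt.2 fun r => (hasDerivAt_clifford hν r).continuousAt

/-- The three-term recurrence, `J_ν(u) + J_{ν+2}(u) = 2 (ν + 1) J_{ν+1}(u) / u` in the classical
normalisation. -/
lemma clifford_recurrence {ν : ℝ} (hν : -1 < ν) (r : ℝ) :
    clifford ν r = (ν + 1) * clifford (ν + 1) r - r * clifford (ν + 2) r := by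
  unfold clifford
  have h1 := (summable_clifford (show -1 < ν + 1 by linarith) r).mul_left (ν + 1)
  have h2 := (summable_clifford (show -1 < ν + 2 by linarith) r).mul_left r
  rw [← tsum_mul_left, ← tsum_mul_left, (summable_clifford hν r).tsum_eq_zero_add,
    h1.tsum_eq_zero_add, add_sub_assoc,
    ← Summable.tsum_sub ((summable_nat_add_iff 1).2 h1) h2]
  congr 1
  · have := Gamma_shift_succ hν 0
    have hp := Gamma_shift_pos hν 0
    have hn : ν + 1 ≠ 0 := by linarith
    simp only [Nat.cast_zero, zero_add, Nat.cast_one] at this hp ⊢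
    rw [show (ν + 1 + 1) = 1 + ν + 1 by ring, this]
    field_simp
  · refine tsum_congr fun k => ?_
    have hk := k.cast_nonneg (α := ℝ)
    have p := Gamma_shift_pos hν (k + 1)
    have e1 := Gamma_shift_succ hν (k + 1)
    have e2 : Real.Gamma (((k + 1 : ℕ) : ℝ) + (ν + 1) + 1) =
        (k + 1 + ν + 1) * Real.Gamma (((k + 1 : ℕ) : ℝ) + ν + 1) := by
      push_cast at e1 ⊢; rw [← e1]; ring_nf
    have e3 : Real.Gamma ((k : ℝ) + (ν + 2) + 1) =
        (k + 1 + ν + 1) * Real.Gamma (((k + 1 : ℕ) : ℝ) + ν + 1) := by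
      push_cast at e1 ⊢; rw [← e1]; ring_nf
    have hn : (k + 1 + ν + 1 : ℝ) ≠ 0 := by linarith
    rw [e2, e3, Nat.factorial_succ, pow_succ]
    push_cast at p ⊢
    field_simp
    ring

/-- The classical `(u^ν J_ν)' = u^ν J_{ν-1}` in the variable `τ`: this is what relates the kernels
with parameters `β + 1` and `β`. -/
lemma hasDerivAt_rpow_mul_clifford {ν : ℝ} (hν : -1 < ν) (η : ℝ) {τ : ℝ} (hτ : 0 < τ) :
    HasDerivAt (fun τ => τ ^ (ν + 1) * clifford (ν + 1) (τ * η))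
      (τ ^ ν * clifford ν (τ * η)) τ := by
  have h1 := (hasDerivAt_clifford (show -1 < ν + 1 by linarith) (τ * η)).comp τ
    ((hasDerivAt_id τ).mul_const η)
  have h2 := Real.hasDerivAt_rpow_const (x := τ) (p := ν + 1) (Or.inl hτ.ne')
  refine HasDerivAt.congr_deriv (h2.mul h1) ?_
  rw [clifford_recurrence hν, show ν + 1 - 1 = ν by ring, show ν + 1 + 1 = ν + 2 by ring,
    Real.rpow_add_one hτ.ne']
  ring

/-! ### Asymptotics at infinity -/

/-- If `|A'| ≤ M / u²` on `[1, ∞)`, then `A` has a limit at infinity and is `M / u`-close to it: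
`A + M / u` decreases and `A - M / u` increases. -/
lemma exists_limit_of_deriv_le {A A' : ℝ → ℝ} {M : ℝ} (hM : 0 ≤ M)
    (hA : ∀ u, 0 < u → HasDerivAt A (A' u) u) (hb : ∀ u, 1 ≤ u → |A' u| ≤ M / u ^ 2) :
    ∃ a, ∀ u, 1 ≤ u → |A u - a| ≤ M / u := by
  have hd : ∀ u : ℝ, 0 < u → HasDerivAt (fun u => M / u) (-(M / u ^ 2)) u := by
    intro u hu
    have := (hasDerivAt_inv hu.ne').const_mul M
    refine HasDerivAt.congr_deriv (f := fun u => M / u) this ?_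
    ring
  have hup : AntitoneOn (fun u => A u + M / u) (Set.Ici 1) := by
    refine antitoneOn_of_hasDerivWithinAt_nonpos (f' := fun u => A' u + -(M / u ^ 2))
      (convex_Ici 1) ?_ ?_ ?_
    · intro u hu
      have hu' : (0 : ℝ) < u := zero_lt_one.trans_le hu
      exact ((hA u hu').add (hd u hu')).continuousAt.continuousWithinAt
    · intro u hu
      have hu' : (1 : ℝ) < u := by simpa using hu
      exact ((hA u (by linarith)).add (hd u (by linarith))).hasDerivWithinAt
    · intro u hu
      have hu' : (1 : ℝ) < u := by simpa using hu
      have := (abs_le.1 (hb u hu'.le)).2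
      linarith
  have hlo : MonotoneOn (fun u => A u - M / u) (Set.Ici 1) := by
    refine monotoneOn_of_hasDerivWithinAt_nonneg (f' := fun u => A' u - -(M / u ^ 2))
      (convex_Ici 1) ?_ ?_ ?_
    · intro u hu
      have hu' : (0 : ℝ) < u := zero_lt_one.trans_le hu
      exact ((hA u hu').sub (hd u hu')).continuousAt.continuousWithinAt
    · intro u hu
      have hu' : (1 : ℝ) < u := by simpa using hu
      exact ((hA u (by linarith)).sub (hd u (by linarith))).hasDerivWithinAt
    · intro u hu
      have hu' : (1 : ℝ) < u := by simpa using hu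
      have := (abs_le.1 (hb u hu'.le)).1
      linarith
  have hle : ∀ u v : ℝ, 1 ≤ u → 1 ≤ v → A u - M / u ≤ A v + M / v := by
    intro u v hu hv
    have h1 := hlo (Set.mem_Ici.2 hu) (Set.mem_Ici.2 (hu.trans (le_max_left _ _)))
      (le_max_left u v)
    have h2 := hup (Set.mem_Ici.2 hv) (Set.mem_Ici.2 (hu.trans (le_max_left _ _)))
      (le_max_right u v)
    have h3 : 0 ≤ M / max u v := div_nonneg hM (by linarith [le_max_left u v])
    simp only at h1 h2
    linarith
  refine ⟨sSup ((fun u => A u - M / u) '' Set.Ici 1), fun u hu => ?_⟩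
  have h1 : A u - M / u ≤ sSup ((fun u => A u - M / u) '' Set.Ici 1) := by
    refine le_csSup ⟨A 1 + M / 1, ?_⟩ ⟨u, hu, rfl⟩
    rintro _ ⟨v, hv, rfl⟩
    exact hle v 1 hv le_rfl
  have h2 : sSup ((fun u => A u - M / u) '' Set.Ici 1) ≤ A u + M / u := by
    refine csSup_le ⟨_, 1, Set.mem_Ici.2 le_rfl, rfl⟩ ?_
    rintro _ ⟨v, hv, rfl⟩
    exact hle v u hv hu
  rw [abs_le]
  constructor <;> linarith

/-- Every solution of `S'' = -(1 - q / u²) S` is bounded on `[1, ∞)` and is a pure oscillation up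
to `O(1 / u)`. Boundedness comes from the energy `S² + S'²`, whose logarithmic derivative is at most
`|q| / u²`; the oscillation is found by variation of constants. -/
lemma exists_oscillation_of_ode {S V : ℝ → ℝ} {q : ℝ} (hS : ∀ u, 0 < u → HasDerivAt S (V u) u)
    (hV : ∀ u, 0 < u → HasDerivAt V (-(1 - q / u ^ 2) * S u) u) :
    ∃ C d δ : ℝ, ∀ u, 1 ≤ u → |S u| ≤ C ∧ |S u - d * Real.cos (u - δ)| ≤ C / u := by
  -- the energy, with an integrating factor that makes it antitone
  set E : ℝ → ℝ := fun u => (S u ^ 2 + V u ^ 2) * Real.exp (|q| / u)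
  have hE : ∀ u, 0 < u → HasDerivAt E
      ((2 * S u * V u + 2 * V u * (-(1 - q / u ^ 2) * S u)) * Real.exp (|q| / u) +
        (S u ^ 2 + V u ^ 2) * (Real.exp (|q| / u) * (-(|q| / u ^ 2)))) u := by
    intro u hu
    have h1 : HasDerivAt (fun u => |q| / u) (-(|q| / u ^ 2)) u := by
      refine HasDerivAt.congr_deriv (f := fun u => |q| / u)
        ((hasDerivAt_inv hu.ne').const_mul |q|) ?_
      ring
    have h2 := (((hS u hu).pow 2).add ((hV u hu).pow 2)).mul h1.exp
    refine HasDerivAt.congr_deriv (f := E) h2 ?_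
    simp only [Pi.add_apply, Pi.pow_apply]
    push_cast
    ring
  have hanti : AntitoneOn E (Set.Ici 1) := by
    refine antitoneOn_of_hasDerivWithinAt_nonpos (convex_Ici 1)
      (fun u hu => (hE u (zero_lt_one.trans_le hu)).continuousAt.continuousWithinAt)
      (fun u hu => (hE u (zero_lt_one.trans (by simpa using hu))).hasDerivWithinAt) ?_
    intro u hu
    have hu' : (1 : ℝ) < u := by simpa using hu
    have hq : 2 * S u * V u * q ≤ |q| * (S u ^ 2 + V u ^ 2) := by
      have h1 : |2 * S u * V u| ≤ S u ^ 2 + V u ^ 2 := by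
        rw [abs_le]; constructor <;> nlinarith [sq_nonneg (S u + V u), sq_nonneg (S u - V u)]
      calc 2 * S u * V u * q ≤ |2 * S u * V u * q| := le_abs_self _
        _ = |q| * |2 * S u * V u| := by rw [abs_mul, mul_comm]
        _ ≤ _ := by gcongr
    have : (2 * S u * V u + 2 * V u * (-(1 - q / u ^ 2) * S u)) * Real.exp (|q| / u) +
        (S u ^ 2 + V u ^ 2) * (Real.exp (|q| / u) * (-(|q| / u ^ 2))) =
        (Real.exp (|q| / u) / u ^ 2) * (2 * S u * V u * q - |q| * (S u ^ 2 + V u ^ 2)) := by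
      ring
    rw [this]
    exact mul_nonpos_of_nonneg_of_nonpos (by positivity) (by linarith)
  set M₀ : ℝ := Real.sqrt (E 1)
  have hSb : ∀ u, 1 ≤ u → |S u| ≤ M₀ := by
    intro u hu
    refine Real.abs_le_sqrt (le_trans ?_ (hanti (Set.mem_Ici.2 le_rfl) hu hu))
    have h1 : 1 ≤ Real.exp (|q| / u) := Real.one_le_exp (div_nonneg (abs_nonneg _) (by linarith))
    simp only [E]
    nlinarith [sq_nonneg (S u), sq_nonneg (V u)]
  have hM₀ : 0 ≤ M₀ := Real.sqrt_nonneg _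
  have hM : 0 ≤ |q| * M₀ := by positivity
  -- rotating `(S, S')` by the angle `u` removes the free oscillation
  obtain ⟨a, ha⟩ := exists_limit_of_deriv_le (A := fun u => S u * Real.cos u - V u * Real.sin u)
    (A' := fun u => -(q / u ^ 2 * S u * Real.sin u)) hM
    (fun u hu => by
      refine HasDerivAt.congr_deriv (((hS u hu).mul (Real.hasDerivAt_cos u)).sub
        ((hV u hu).mul (Real.hasDerivAt_sin u))) ?_
      ring)
    (fun u hu => by
      have h1 := hSb u hu
      have h2 := Real.abs_sin_le_one u
      rw [abs_neg, abs_mul, abs_mul, abs_div, abs_of_nonneg (sq_nonneg u)]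
      calc |q| / u ^ 2 * |S u| * |Real.sin u| ≤ |q| / u ^ 2 * M₀ * 1 := by gcongr
        _ = _ := by ring)
  obtain ⟨b, hb⟩ := exists_limit_of_deriv_le (A := fun u => S u * Real.sin u + V u * Real.cos u)
    (A' := fun u => q / u ^ 2 * S u * Real.cos u) hM
    (fun u hu => by
      refine HasDerivAt.congr_deriv (((hS u hu).mul (Real.hasDerivAt_sin u)).add
        ((hV u hu).mul (Real.hasDerivAt_cos u))) ?_
      ring)
    (fun u hu => by
      have h1 := hSb u hu
      have h2 := Real.abs_cos_le_one u
      rw [abs_mul, abs_mul, abs_div, abs_of_nonneg (sq_nonneg u)]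
      calc |q| / u ^ 2 * |S u| * |Real.cos u| ≤ |q| / u ^ 2 * M₀ * 1 := by gcongr
        _ = _ := by ring)
  refine ⟨max M₀ (2 * (|q| * M₀)), ‖(⟨a, b⟩ : ℂ)‖, Complex.arg ⟨a, b⟩, fun u hu =>
    ⟨(hSb u hu).trans (le_max_left _ _), ?_⟩⟩
  have hu0 : 0 < u := by linarith
  have h1 := ha u hu
  have h2 := hb u hu
  have h3 : S u - ‖(⟨a, b⟩ : ℂ)‖ * Real.cos (u - Complex.arg ⟨a, b⟩) =
      (S u * Real.cos u - V u * Real.sin u - a) * Real.cos u +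
      (S u * Real.sin u + V u * Real.cos u - b) * Real.sin u := by
    have e1 : ‖(⟨a, b⟩ : ℂ)‖ * Real.cos (Complex.arg ⟨a, b⟩) = a := Complex.norm_mul_cos_arg _
    have e2 : ‖(⟨a, b⟩ : ℂ)‖ * Real.sin (Complex.arg ⟨a, b⟩) = b := Complex.norm_mul_sin_arg _
    rw [Real.cos_sub]
    linear_combination (-Real.cos u) * e1 - Real.sin u * e2 - S u * Real.sin_sq_add_cos_sq u
  rw [h3]
  calc _ ≤ |(S u * Real.cos u - V u * Real.sin u - a) * Real.cos u| +
      |(S u * Real.sin u + V u * Real.cos u - b) * Real.sin u| := abs_add_le _ _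
    _ ≤ |q| * M₀ / u * 1 + |q| * M₀ / u * 1 := by
      rw [abs_mul, abs_mul]
      gcongr
      · exact Real.abs_cos_le_one u
      · exact Real.abs_sin_le_one u
    _ = 2 * (|q| * M₀) / u := by ring
    _ ≤ _ := by gcongr; exact le_max_right _ _

lemma hasDerivAt_clifford_sq {ν : ℝ} (hν : -1 < ν) (u : ℝ) :
    HasDerivAt (fun u => clifford ν (u ^ 2 / 4)) (-(u / 2) * clifford (ν + 1) (u ^ 2 / 4)) u := by
  have h := (hasDerivAt_clifford hν (u ^ 2 / 4)).comp u (((hasDerivAt_id u).pow 2).div_const 4)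
  refine HasDerivAt.congr_deriv (f := fun u => clifford ν (u ^ 2 / 4)) h ?_
  simp only [id]
  push_cast
  ring

/-- Boundedness and leading asymptotics of `√u J_ν(u)`, from the differential equation
`S'' = -(1 - (ν² - 1/4) / u²) S` satisfied by `S(u) = u^(ν + 1/2) clifford ν (u² / 4)`. -/
lemma exists_clifford_bound {ν : ℝ} (hν : -(1 / 2) < ν) :
    ∃ C : ℝ, 0 < C ∧ ∃ d δ : ℝ, (∀ r, 0 ≤ r → |clifford ν r| ≤ C) ∧
      ∀ u, 0 < u → |u ^ (ν + 1 / 2) * clifford ν (u ^ 2 / 4)| ≤ C ∧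
        |u ^ (ν + 1 / 2) * clifford ν (u ^ 2 / 4) - d * Real.cos (u - δ)| ≤ C / u := by
  set S : ℝ → ℝ := fun u => u ^ (ν + 1 / 2) * clifford ν (u ^ 2 / 4) with hSdef
  set V : ℝ → ℝ := fun u => (ν + 1 / 2) * (u ^ (ν - 1 / 2) * clifford ν (u ^ 2 / 4)) -
    2⁻¹ * (u ^ (ν + 3 / 2) * clifford (ν + 1) (u ^ 2 / 4)) with hVdef
  have hp : ∀ (p u : ℝ), 0 < u → HasDerivAt (fun u : ℝ => u ^ p) (p * u ^ (p - 1)) u :=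
    fun p u hu => Real.hasDerivAt_rpow_const (Or.inl hu.ne')
  have hS : ∀ u, 0 < u → HasDerivAt S (V u) u := by
    intro u hu
    refine HasDerivAt.congr_deriv (f := S) ((hp (ν + 1 / 2) u hu).mul
      (hasDerivAt_clifford_sq (by linarith) u)) ?_
    have e1 : u ^ (ν + 3 / 2) = u ^ (ν + 1 / 2) * u := by
      rw [← Real.rpow_add_one hu.ne']; ring_nf
    simp only [hVdef, e1]
    rw [show ν + 1 / 2 - 1 = ν - 1 / 2 by ring]
    ring
  have hV : ∀ u, 0 < u → HasDerivAt V (-(1 - (ν ^ 2 - 1 / 4) / u ^ 2) * S u) u := by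
    intro u hu
    refine HasDerivAt.congr_deriv (f := V)
      ((((hp (ν - 1 / 2) u hu).mul (hasDerivAt_clifford_sq (by linarith) u)).const_mul
        (ν + 1 / 2)).sub (((hp (ν + 3 / 2) u hu).mul
        (hasDerivAt_clifford_sq (show -1 < ν + 1 by linarith) u)).const_mul 2⁻¹)) ?_
    have r := clifford_recurrence (show -1 < ν by linarith) (u ^ 2 / 4)
    have e1 : u ^ (ν + 3 / 2) = u ^ (ν - 1 / 2 - 1) * u ^ 3 := by
      rw [← Real.rpow_natCast, ← Real.rpow_add hu]; push_cast; ring_nf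
    have e2 : u ^ (ν - 1 / 2) = u ^ (ν - 1 / 2 - 1) * u := by
      rw [← Real.rpow_add_one hu.ne']; ring_nf
    have e3 : u ^ (ν + 3 / 2 - 1) = u ^ (ν - 1 / 2 - 1) * u ^ 2 := by
      rw [← Real.rpow_natCast, ← Real.rpow_add hu]; push_cast; ring_nf
    have e4 : u ^ (ν + 1 / 2) = u ^ (ν - 1 / 2 - 1) * u ^ 2 := by
      rw [← Real.rpow_natCast, ← Real.rpow_add hu]; push_cast; ring_nf
    simp only [hSdef, e1, e2, e3, e4]
    rw [show ν + 1 + 1 = ν + 2 by ring]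
    generalize u ^ (ν - 1 / 2 - 1) = w
    field_simp
    linear_combination (16 * w * u ^ 2) * r
  obtain ⟨C₁, d, δ, h⟩ := exists_oscillation_of_ode hS hV
  -- the asymptotics hold from `u = 1` on; compactness covers the rest
  obtain ⟨C₂, hC₂⟩ := (isCompact_Icc (a := (0 : ℝ)) (b := 1)).exists_bound_of_continuousOn
    (continuous_clifford (show -1 < ν by linarith)).continuousOn
  have hC₁ : 0 ≤ C₁ := (abs_nonneg _).trans (h 1 le_rfl).1
  have hC₂' : 0 ≤ C₂ := (norm_nonneg _).trans (hC₂ 0 (by simp))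
  have hsmall : ∀ u, 0 < u → u ≤ 1 → |S u| ≤ C₂ := by
    intro u hu hu1
    rw [hSdef, abs_mul, abs_of_pos (Real.rpow_pos_of_pos hu _)]
    have h1 : u ^ (ν + 1 / 2) ≤ 1 := Real.rpow_le_one hu.le hu1 (by linarith)
    have h2 := hC₂ (u ^ 2 / 4) ⟨by positivity, by nlinarith⟩
    rw [Real.norm_eq_abs] at h2
    calc _ ≤ 1 * C₂ := by gcongr
      _ = _ := one_mul _
  have hSall : ∀ u, 0 < u → |S u| ≤ C₁ + C₂ := by
    intro u hu
    rcases le_total u 1 with h1 | h1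
    · linarith [hsmall u hu h1]
    · linarith [(h u h1).1]
  refine ⟨C₁ + C₂ + |d| + 2 ^ (ν + 1 / 2) * (C₁ + C₂) + 1, by positivity, d, δ,
    fun r hr => ?_, fun u hu => ⟨?_, ?_⟩⟩
  · have hpos : 0 ≤ 2 ^ (ν + 1 / 2) * (C₁ + C₂) := by positivity
    rcases le_total r 1 with h1 | h1
    · have := hC₂ r ⟨hr, h1⟩
      rw [Real.norm_eq_abs] at this
      linarith [abs_nonneg d]
    · have hs1 : 1 ≤ Real.sqrt r := Real.one_le_sqrt.2 h1
      have h2 := (h (2 * Real.sqrt r) (by linarith)).1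
      have e : (2 * Real.sqrt r) ^ 2 / 4 = r := by
        rw [mul_pow, Real.sq_sqrt hr]; ring
      simp only [hSdef, e] at h2
      rw [abs_mul, abs_of_nonneg (by positivity)] at h2
      have h3 : 1 ≤ (2 * Real.sqrt r) ^ (ν + 1 / 2) :=
        Real.one_le_rpow (by linarith) (by linarith)
      nlinarith [abs_nonneg (clifford ν r), abs_nonneg d]
  · have hpos : 0 ≤ 2 ^ (ν + 1 / 2) * (C₁ + C₂) := by positivity
    exact (hSall u hu).trans (by linarith [abs_nonneg d])
  · have hpos : 0 ≤ 2 ^ (ν + 1 / 2) * (C₁ + C₂) := by positivity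
    rcases le_total u 1 with h1 | h1
    · calc |S u - d * Real.cos (u - δ)| ≤ |S u| + |d * Real.cos (u - δ)| := abs_sub _ _
        _ ≤ (C₁ + C₂) + |d| * 1 := by
          rw [abs_mul d]
          gcongr
          · exact hSall u hu
          · exact Real.abs_cos_le_one _
        _ ≤ C₁ + C₂ + |d| + 2 ^ (ν + 1 / 2) * (C₁ + C₂) + 1 := by linarith
        _ ≤ _ := by
          rw [le_div_iff₀ hu]
          exact mul_le_of_le_one_right (by positivity) h1
    · refine (h u h1).2.trans ?_
      gcongr
      linarith [abs_nonneg d]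

/-- Power decay with any exponent up to the optimal `ν / 2 + 1 / 4`. The free exponent `s` allows
the same bound to be used near the origin and at infinity. -/
lemma exists_clifford_decay {ν : ℝ} (hν : -(1 / 2) < ν) :
    ∃ C : ℝ, 0 < C ∧ ∀ s r : ℝ, 0 ≤ s → s ≤ ν / 2 + 1 / 4 → 0 < r →
      |clifford ν r| ≤ C * r ^ (-s) := by
  obtain ⟨C, hC, d, δ, h1, h2⟩ := exists_clifford_bound hν
  refine ⟨C, hC, fun s r hs hsν hr => ?_⟩
  rcases le_total r 1 with hr1 | hr1
  · exact (h1 r hr.le).trans (le_mul_of_one_le_right hC.le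
      (Real.one_le_rpow_of_pos_of_le_one_of_nonpos hr hr1 (by linarith)))
  · have h := (h2 (2 * Real.sqrt r) (by positivity)).1
    have e : (2 * Real.sqrt r) ^ 2 / 4 = r := by rw [mul_pow, Real.sq_sqrt hr.le]; ring
    have e2 : (Real.sqrt r) ^ (ν + 1 / 2) = r ^ (ν / 2 + 1 / 4) := by
      rw [Real.sqrt_eq_rpow, ← Real.rpow_mul hr.le]; ring_nf
    rw [e, abs_mul, abs_of_nonneg (by positivity), Real.mul_rpow (by norm_num) (by positivity),
      e2] at h
    have h3 : (1 : ℝ) ≤ 2 ^ (ν + 1 / 2) := Real.one_le_rpow (by norm_num) (by linarith)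
    have h4 : r ^ s ≤ r ^ (ν / 2 + 1 / 4) := Real.rpow_le_rpow_of_exponent_le hr1 hsν
    rw [Real.rpow_neg hr.le, ← div_eq_mul_inv, le_div_iff₀ (by positivity)]
    calc |clifford ν r| * r ^ s = 1 * r ^ s * |clifford ν r| := by ring
      _ ≤ 2 ^ (ν + 1 / 2) * r ^ (ν / 2 + 1 / 4) * |clifford ν r| := by gcongr
      _ ≤ C := h

/-! ### Uniform tail bounds for the truncated kernel -/

lemma continuousOn_rpow_uIcc {A B : ℝ} (hA : 0 < A) (hAB : A ≤ B) (s : ℝ) :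
    ContinuousOn (fun η : ℝ => η ^ s) (Set.uIcc A B) := by
  rw [Set.uIcc_of_le hAB]
  exact continuousOn_id.rpow_const fun η hη => Or.inl (hA.trans_le hη.1).ne'

lemma integral_rpow_tail_le {p A B : ℝ} (hp : 0 < p) (hA : 0 < A) (hAB : A ≤ B) :
    ∫ η in A..B, η ^ (-p - 1) ≤ A ^ (-p) / p := by
  have h0 : (0 : ℝ) ∉ Set.uIcc A B := by
    rw [Set.uIcc_of_le hAB]; exact fun h => absurd h.1 (not_le.2 hA)
  rw [integral_rpow (Or.inr ⟨by linarith, h0⟩), show -p - 1 + 1 = -p by ring]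
  have := Real.rpow_pos_of_pos (hA.trans_le hAB) (-p)
  rw [div_neg, ← neg_div]
  gcongr
  linarith

/-- Integration by parts for a chirp with nonvanishing frequency. -/
lemma abs_integral_rpow_mul_cos_le {p A B ω : ℝ} (δ : ℝ) (hp : 0 < p) (hA : 0 < A) (hAB : A ≤ B)
    (hω : ω ≠ 0) :
    |∫ η in A..B, η ^ (-p - 1 / 2) * Real.cos (2 * ω * Real.sqrt η - δ)| ≤
      3 * A ^ (-p) * (1 / |ω|) := by
  have hpos : ∀ η ∈ Set.uIcc A B, 0 < η := by
    rw [Set.uIcc_of_le hAB]; exact fun η h => hA.trans_le h.1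
  have hω' : 0 < |ω| := abs_pos.2 hω
  have hu : ∀ η ∈ Set.uIcc A B, HasDerivAt (fun η : ℝ => η ^ (-p)) (-p * η ^ (-p - 1)) η :=
    fun η h => Real.hasDerivAt_rpow_const (Or.inl (hpos η h).ne')
  have hv : ∀ η ∈ Set.uIcc A B,
      HasDerivAt (fun η : ℝ => Real.sin (2 * ω * Real.sqrt η - δ) / ω)
        (η ^ (-(1 / 2) : ℝ) * Real.cos (2 * ω * Real.sqrt η - δ)) η := by
    intro η h
    have h0 := hpos η h
    refine HasDerivAt.congr_deriv ((((Real.hasDerivAt_sqrt h0.ne').const_mul (2 * ω)).sub_const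
      δ).sin.div_const ω) ?_
    rw [Real.rpow_neg h0.le, ← Real.sqrt_eq_rpow]
    have : Real.sqrt η ≠ 0 := (Real.sqrt_pos.2 h0).ne'
    field_simp
  have hc1 := continuousOn_rpow_uIcc hA hAB
  have hc2 : Continuous fun η : ℝ => Real.cos (2 * ω * Real.sqrt η - δ) := by fun_prop
  have hparts := intervalIntegral.integral_mul_deriv_eq_deriv_mul hu hv
    ((hc1 _).const_smul (-p)).intervalIntegrable
    ((hc1 _).mul hc2.continuousOn).intervalIntegrable
  have e : ∫ η in A..B, η ^ (-p - 1 / 2) * Real.cos (2 * ω * Real.sqrt η - δ) =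
      ∫ η in A..B, η ^ (-p) * (η ^ (-(1 / 2) : ℝ) * Real.cos (2 * ω * Real.sqrt η - δ)) := by
    refine intervalIntegral.integral_congr fun η h => ?_
    rw [← mul_assoc, ← Real.rpow_add (hpos η h), sub_eq_add_neg]
  have hB : 0 < B := hA.trans_le hAB
  have hBA : B ^ (-p) ≤ A ^ (-p) := Real.rpow_le_rpow_of_nonpos hA hAB (by linarith)
  have hbd : ∀ η : ℝ, |Real.sin (2 * ω * Real.sqrt η - δ) / ω| ≤ 1 / |ω| := fun η => by
    rw [abs_div]; gcongr; exact Real.abs_sin_le_one _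
  have hint : |∫ η in A..B, -p * η ^ (-p - 1) * (Real.sin (2 * ω * Real.sqrt η - δ) / ω)| ≤
      A ^ (-p) * (1 / |ω|) := by
    have h1 : |∫ η in A..B, -p * η ^ (-p - 1) * (Real.sin (2 * ω * Real.sqrt η - δ) / ω)| ≤
        ∫ η in A..B, p * (1 / |ω|) * η ^ (-p - 1) := by
      rw [← Real.norm_eq_abs]
      refine intervalIntegral.norm_integral_le_of_norm_le hAB (Filter.Eventually.of_forall
        fun η hη => ?_) (continuousOn_const.mul (hc1 (-p - 1))).intervalIntegrable
      have h0 : 0 < η := hA.trans hη.1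
      rw [norm_mul, norm_mul, norm_neg, Real.norm_of_nonneg hp.le,
        Real.norm_of_nonneg (Real.rpow_nonneg h0.le _)]
      calc _ ≤ p * η ^ (-p - 1) * (1 / |ω|) := by gcongr; exact hbd η
        _ = _ := by ring
    refine h1.trans ?_
    rw [intervalIntegral.integral_const_mul]
    calc _ ≤ p * (1 / |ω|) * (A ^ (-p) / p) := by
          gcongr; exact integral_rpow_tail_le hp hA hAB
      _ = _ := by field_simp
  rw [e, hparts]
  calc _ ≤ |B ^ (-p) * (Real.sin (2 * ω * Real.sqrt B - δ) / ω)| +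
        |A ^ (-p) * (Real.sin (2 * ω * Real.sqrt A - δ) / ω)| +
        |∫ η in A..B, -p * η ^ (-p - 1) * (Real.sin (2 * ω * Real.sqrt η - δ) / ω)| :=
        (abs_sub _ _).trans (by gcongr; exact abs_sub _ _)
    _ ≤ A ^ (-p) * (1 / |ω|) + A ^ (-p) * (1 / |ω|) + A ^ (-p) * (1 / |ω|) := by
        rw [abs_mul, abs_mul, abs_of_nonneg (Real.rpow_nonneg hA.le _),
          abs_of_nonneg (Real.rpow_nonneg hB.le _)]
        gcongr
        · exact hbd B
        · exact hbd A
    _ = _ := by ring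

/-- The part of the integrand that does not involve `t`, in the variable `η = y² / 4`. -/
noncomputable def besselPair (α x z η : ℝ) : ℝ :=
  clifford α (x ^ 2 * η) * clifford α (z ^ 2 * η) * η ^ α

/-- The integrand of the kernel in the variable `η = y² / 4`, with constant factors removed. -/
noncomputable def reducedIntegrand (ν α t x z η : ℝ) : ℝ :=
  clifford ν (t ^ 2 * η) * besselPair α x z η

/-- The dependence on `t, x, z` of the tail bound: it blows up exactly where one of the frequencies
`t ± x ± z` vanishes. -/
noncomputable def tailFactor (ν α t x z : ℝ) : ℝ :=
  t ^ (-(ν + 1 / 2)) * x ^ (-(α + 1 / 2)) * z ^ (-(α + 1 / 2)) *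
    (1 / t + 1 / x + 1 / z + 1 / |t + x + z| + 1 / |t + x - z| + 1 / |t - x + z| + 1 / |t - x - z|)

/-- The product of three oscillations is a sum of four with frequencies `t ± x ± z`. -/
lemma abs_integral_cos_mul_cos_mul_cos_le {p A B t x z : ℝ} (δ₁ δ₂ δ₃ : ℝ) (hp : 0 < p)
    (hA : 0 < A) (hAB : A ≤ B) (h1 : t + x + z ≠ 0) (h2 : t + x - z ≠ 0) (h3 : t - x + z ≠ 0)
    (h4 : t - x - z ≠ 0) :
    |∫ η in A..B, η ^ (-p - 1 / 2) * (Real.cos (2 * t * Real.sqrt η - δ₁) *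
        Real.cos (2 * x * Real.sqrt η - δ₂) * Real.cos (2 * z * Real.sqrt η - δ₃))| ≤
      A ^ (-p) *
        (1 / |t + x + z| + 1 / |t + x - z| + 1 / |t - x + z| + 1 / |t - x - z|) := by
  have hc1 := continuousOn_rpow_uIcc hA hAB
  have hI : ∀ ω δ : ℝ, IntervalIntegrable
      (fun η : ℝ => η ^ (-p - 1 / 2) * Real.cos (2 * ω * Real.sqrt η - δ))
      MeasureTheory.volume A B := fun ω δ =>
    ((hc1 _).mul (Continuous.continuousOn (by fun_prop))).intervalIntegrable
  have e : ∀ η : ℝ, η ^ (-p - 1 / 2) * (Real.cos (2 * t * Real.sqrt η - δ₁) *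
        Real.cos (2 * x * Real.sqrt η - δ₂) * Real.cos (2 * z * Real.sqrt η - δ₃)) = 4⁻¹ *
      (η ^ (-p - 1 / 2) * Real.cos (2 * (t + x + z) * Real.sqrt η - (δ₁ + δ₂ + δ₃)) +
      η ^ (-p - 1 / 2) * Real.cos (2 * (t + x - z) * Real.sqrt η - (δ₁ + δ₂ - δ₃)) +
      η ^ (-p - 1 / 2) * Real.cos (2 * (t - x + z) * Real.sqrt η - (δ₁ - δ₂ + δ₃)) +
      η ^ (-p - 1 / 2) * Real.cos (2 * (t - x - z) * Real.sqrt η - (δ₁ - δ₂ - δ₃))) := by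
    intro η
    set a := 2 * t * Real.sqrt η - δ₁
    set b := 2 * x * Real.sqrt η - δ₂
    set c := 2 * z * Real.sqrt η - δ₃
    rw [
      show 2 * (t + x + z) * Real.sqrt η - (δ₁ + δ₂ + δ₃) = a + b + c by simp only [a, b, c]; ring,
      show 2 * (t + x - z) * Real.sqrt η - (δ₁ + δ₂ - δ₃) = a + b - c by simp only [a, b, c]; ring,
      show 2 * (t - x + z) * Real.sqrt η - (δ₁ - δ₂ + δ₃) = a - b + c by simp only [a, b, c]; ring,
      show 2 * (t - x - z) * Real.sqrt η - (δ₁ - δ₂ - δ₃) = a - b - c by simp only [a, b, c]; ring]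
    simp only [Real.cos_add, Real.cos_sub, Real.sin_add, Real.sin_sub]
    ring
  simp_rw [e]
  rw [intervalIntegral.integral_const_mul, intervalIntegral.integral_add
    (((hI _ _).add (hI _ _)).add (hI _ _)) (hI _ _), intervalIntegral.integral_add
    ((hI _ _).add (hI _ _)) (hI _ _), intervalIntegral.integral_add (hI _ _) (hI _ _)]
  have b1 := abs_le.1 (abs_integral_rpow_mul_cos_le (δ₁ + δ₂ + δ₃) hp hA hAB h1)
  have b2 := abs_le.1 (abs_integral_rpow_mul_cos_le (δ₁ + δ₂ - δ₃) hp hA hAB h2)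
  have b3 := abs_le.1 (abs_integral_rpow_mul_cos_le (δ₁ - δ₂ + δ₃) hp hA hAB h3)
  have b4 := abs_le.1 (abs_integral_rpow_mul_cos_le (δ₁ - δ₂ - δ₃) hp hA hAB h4)
  have hn : ∀ ω : ℝ, 0 ≤ A ^ (-p) * (1 / |ω|) := fun ω => by positivity
  have n1 := hn (t + x + z)
  have n2 := hn (t + x - z)
  have n3 := hn (t - x + z)
  have n4 := hn (t - x - z)
  rw [abs_le]
  constructor <;> nlinarith [b1.1, b1.2, b2.1, b2.2, b3.1, b3.2, b4.1, b4.2]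

/-- The Bessel function of order `ν` at `u = 2 t √η`, multiplied by `2^ν √u`: a bounded
oscillation. -/
noncomputable def besselProfile (ν t η : ℝ) : ℝ :=
  (2 * t * Real.sqrt η) ^ (ν + 1 / 2) * clifford ν (t ^ 2 * η)

/-- `exists_clifford_bound` at `u = 2 t √η`. -/
lemma exists_besselProfile_bound {ν : ℝ} (hν : -(1 / 2) < ν) :
    ∃ D d δ : ℝ, 0 < D ∧ |d| ≤ D ∧ ∀ t η : ℝ, 0 < t → 0 < η → |besselProfile ν t η| ≤ D ∧
      |besselProfile ν t η - d * Real.cos (2 * t * Real.sqrt η - δ)| ≤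
        D / t * η ^ (-(1 / 2) : ℝ) := by
  obtain ⟨C, hC, d, δ, -, h⟩ := exists_clifford_bound hν
  refine ⟨C + |d|, d, δ, by positivity, by linarith, fun t η ht hη => ?_⟩
  have hs : 0 < Real.sqrt η := Real.sqrt_pos.2 hη
  have h' := h (2 * t * Real.sqrt η) (by positivity)
  have hsq : (2 * t * Real.sqrt η) ^ 2 / 4 = t ^ 2 * η := by
    rw [mul_pow, Real.sq_sqrt hη.le]; ring
  rw [hsq] at h'
  have hd := abs_nonneg d
  refine ⟨h'.1.trans (by linarith), h'.2.trans ?_⟩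
  rw [Real.rpow_neg hη.le, ← Real.sqrt_eq_rpow, ← div_eq_mul_inv, div_div]
  have : t * Real.sqrt η ≤ 2 * t * Real.sqrt η := by
    have : 0 < t * Real.sqrt η := by positivity
    linarith
  gcongr
  linarith

lemma continuous_besselProfile {ν : ℝ} (hν : -(1 / 2) < ν) (t : ℝ) :
    Continuous (besselProfile ν t) := by
  have h := continuous_clifford (show -1 < ν by linarith)
  have hr : Continuous fun η : ℝ => (2 * t * Real.sqrt η) ^ (ν + 1 / 2) :=
    Continuous.rpow_const (by fun_prop) fun _ => Or.inr (by linarith)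
  exact hr.mul (by fun_prop)

lemma clifford_eq_besselProfile (ν : ℝ) {t η : ℝ} (ht : 0 < t) (hη : 0 < η) :
    clifford ν (t ^ 2 * η) = 2 ^ (-(ν + 1 / 2)) * t ^ (-(ν + 1 / 2)) * η ^ (-(ν / 2 + 1 / 4)) *
      besselProfile ν t η := by
  have hs : 0 < Real.sqrt η := Real.sqrt_pos.2 hη
  have e1 : η ^ (-(ν / 2 + 1 / 4)) = Real.sqrt η ^ (-(ν + 1 / 2)) := by
    rw [Real.sqrt_eq_rpow, ← Real.rpow_mul hη.le]; ring_nf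
  have h0 : 0 < 2 * t * Real.sqrt η := by positivity
  have e2 : 2 ^ (-(ν + 1 / 2)) * t ^ (-(ν + 1 / 2)) * Real.sqrt η ^ (-(ν + 1 / 2)) =
      (2 * t * Real.sqrt η) ^ (-(ν + 1 / 2)) := by
    rw [Real.mul_rpow (by positivity) hs.le, Real.mul_rpow (by positivity) ht.le]
  rw [e1, e2, besselProfile, ← mul_assoc, ← Real.rpow_add h0]
  simp

/-- The reduced integrand with the decay of its three Bessel functions factored out. -/
lemma reducedIntegrand_eq_besselProfile (ν α : ℝ) {t x z η : ℝ} (ht : 0 < t) (hx : 0 < x)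
    (hz : 0 < z) (hη : 0 < η) :
    reducedIntegrand ν α t x z η =
      2 ^ (-(ν + 1 / 2)) * 2 ^ (-(α + 1 / 2)) * 2 ^ (-(α + 1 / 2)) *
      (t ^ (-(ν + 1 / 2)) * x ^ (-(α + 1 / 2)) * z ^ (-(α + 1 / 2))) *
      (η ^ (-(ν / 2 + 1 / 4) - 1 / 2) *
        (besselProfile ν t η * besselProfile α x η * besselProfile α z η)) := by
  have e1 : η ^ (-(ν / 2 + 1 / 4) - 1 / 2) =
      η ^ (-(ν / 2 + 1 / 4)) * η ^ (-(α / 2 + 1 / 4)) * η ^ (-(α / 2 + 1 / 4)) * η ^ α := by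
    rw [← Real.rpow_add hη, ← Real.rpow_add hη, ← Real.rpow_add hη]
    congr 1
    ring
  rw [reducedIntegrand, besselPair, clifford_eq_besselProfile ν ht hη,
    clifford_eq_besselProfile α hx hη,
    clifford_eq_besselProfile α hz hη, e1]
  ring

lemma abs_mul_mul_sub_mul_mul_le {D ε₁ ε₂ ε₃ a₁ a₂ a₃ b₁ b₂ b₃ : ℝ}
    (h₁ : |a₁ - b₁| ≤ ε₁) (h₂ : |a₂ - b₂| ≤ ε₂) (h₃ : |a₃ - b₃| ≤ ε₃) (ha₂ : |a₂| ≤ D)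
    (ha₃ : |a₃| ≤ D) (hb₁ : |b₁| ≤ D) (hb₂ : |b₂| ≤ D) :
    |a₁ * a₂ * a₃ - b₁ * b₂ * b₃| ≤ D ^ 2 * (ε₁ + ε₂ + ε₃) := by
  have hD : 0 ≤ D := (abs_nonneg _).trans ha₂
  have e₁ : 0 ≤ ε₁ := (abs_nonneg _).trans h₁
  have e₂ : 0 ≤ ε₂ := (abs_nonneg _).trans h₂
  have e : a₁ * a₂ * a₃ - b₁ * b₂ * b₃ =
      (a₁ - b₁) * a₂ * a₃ + b₁ * (a₂ - b₂) * a₃ + b₁ * b₂ * (a₃ - b₃) := by ring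
  rw [e]
  calc _ ≤ |a₁ - b₁| * |a₂| * |a₃| + |b₁| * |a₂ - b₂| * |a₃| + |b₁| * |b₂| * |a₃ - b₃| := by
        simp only [← abs_mul]
        exact (abs_add_le _ _).trans (by gcongr; exact abs_add_le _ _)
    _ ≤ ε₁ * D * D + D * ε₂ * D + D * D * ε₃ := by gcongr
    _ = _ := by ring

/-- Cauchy bound for the truncated integrals: each Bessel function is replaced by its leading
oscillation, the product of the three oscillations is integrated by parts, and the error terms are
absolutely integrable. -/
lemma exists_abs_integral_reducedIntegrand_le {ν α : ℝ} (hν : -(1 / 2) < ν) (hα : -(1 / 2) < α) :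
    ∃ C : ℝ, 0 < C ∧ ∀ t x z : ℝ, 0 < t → 0 < x → 0 < z → t + x - z ≠ 0 → t - x + z ≠ 0 →
      t - x - z ≠ 0 → ∀ A B : ℝ, 0 < A → A ≤ B →
      |∫ η in A..B, reducedIntegrand ν α t x z η| ≤
        C * tailFactor ν α t x z * A ^ (-(ν / 2 + 1 / 4)) := by
  obtain ⟨D₁, d₁, δ₁, hD₁, hd₁, h1⟩ := exists_besselProfile_bound hν
  obtain ⟨D₂, d₂, δ₂, hD₂, hd₂, h2⟩ := exists_besselProfile_bound hα
  set κ : ℝ := 2 ^ (-(ν + 1 / 2)) * 2 ^ (-(α + 1 / 2)) * 2 ^ (-(α + 1 / 2)) with hκ_def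
  have hκ : 0 < κ := by positivity
  have hp : 0 < ν / 2 + 1 / 4 := by linarith
  refine ⟨κ * (D₁ + D₂) ^ 3 * (1 + 1 / (ν / 2 + 1 / 4)), by positivity,
    fun t x z ht hx hz w2 w3 w4 A B hA hAB => ?_⟩
  have hfac := fun η (hη : 0 < η) => reducedIntegrand_eq_besselProfile ν α ht hx hz hη
  generalize ν / 2 + 1 / 4 = p at hp hfac ⊢
  have w1 : t + x + z ≠ 0 := by positivity
  set D : ℝ := D₁ + D₂
  have hD : 0 < D := by positivity
  have hT : ∀ d s : ℝ, |d| ≤ D → |d * Real.cos s| ≤ D := by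
    intro d s hd
    rw [abs_mul]
    exact (mul_le_of_le_one_right (abs_nonneg _) (Real.abs_cos_le_one _)).trans hd
  -- the exact product of profiles, and the product of their leading oscillations
  set S : ℝ → ℝ := fun η => besselProfile ν t η * besselProfile α x η * besselProfile α z η
    with hS_def
  set T : ℝ → ℝ := fun η => d₁ * d₂ * d₂ * (Real.cos (2 * t * Real.sqrt η - δ₁) *
    Real.cos (2 * x * Real.sqrt η - δ₂) * Real.cos (2 * z * Real.sqrt η - δ₂)) with hT_def
  have herr : ∀ η, 0 < η →
      |S η - T η| ≤ D ^ 3 * (1 / t + 1 / x + 1 / z) * η ^ (-(1 / 2) : ℝ) := by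
    intro η hη
    have hr : 0 < η ^ (-(1 / 2) : ℝ) := by positivity
    have := abs_mul_mul_sub_mul_mul_le (D := D) (h1 t η ht hη).2 (h2 x η hx hη).2 (h2 z η hz hη).2
      ((h2 x η hx hη).1.trans (by simp [D, hD₁.le])) ((h2 z η hz hη).1.trans (by simp [D, hD₁.le]))
      (hT _ _ (hd₁.trans (by simp [D, hD₂.le]))) (hT _ _ (hd₂.trans (by simp [D, hD₁.le])))
    have e : T η = d₁ * Real.cos (2 * t * Real.sqrt η - δ₁) *
        (d₂ * Real.cos (2 * x * Real.sqrt η - δ₂)) *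
        (d₂ * Real.cos (2 * z * Real.sqrt η - δ₂)) := by rw [hT_def]; ring
    rw [e]
    refine this.trans ?_
    calc _ ≤ D ^ 2 * (D / t * η ^ (-(1 / 2) : ℝ) + D / x * η ^ (-(1 / 2) : ℝ) +
          D / z * η ^ (-(1 / 2) : ℝ)) := by
          gcongr <;> simp [D, hD₁.le, hD₂.le]
      _ = _ := by ring
  have hpos : ∀ η ∈ Set.uIcc A B, 0 < η := by
    rw [Set.uIcc_of_le hAB]; exact fun η h => hA.trans_le h.1
  have hw := continuousOn_rpow_uIcc hA hAB
  have hTc : Continuous T := by rw [hT_def]; fun_prop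
  have hSc : Continuous S := ((continuous_besselProfile hν t).mul
    (continuous_besselProfile hα x)).mul (continuous_besselProfile hα z)
  have hI1 : IntervalIntegrable (fun η => η ^ (-p - 1 / 2) * T η)
      MeasureTheory.volume A B := ((hw _).mul hTc.continuousOn).intervalIntegrable
  have hI2 : IntervalIntegrable (fun η => η ^ (-p - 1 / 2) * (S η - T η))
      MeasureTheory.volume A B := ((hw _).mul (hSc.sub hTc).continuousOn).intervalIntegrable
  set c : ℝ := κ * (t ^ (-(ν + 1 / 2)) * x ^ (-(α + 1 / 2)) * z ^ (-(α + 1 / 2))) with hc_def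
  have hc : 0 < c := by positivity
  have hsplit : ∫ η in A..B, reducedIntegrand ν α t x z η =
      c * ((∫ η in A..B, η ^ (-p - 1 / 2) * T η) +
        ∫ η in A..B, η ^ (-p - 1 / 2) * (S η - T η)) := by
    rw [← intervalIntegral.integral_add hI1 hI2, ← intervalIntegral.integral_const_mul]
    refine intervalIntegral.integral_congr fun η hη => ?_
    rw [hfac η (hpos η hη)]
    ring
  have hmain : |∫ η in A..B, η ^ (-p - 1 / 2) * T η| ≤ D ^ 3 * (A ^ (-p) *
      (1 / |t + x + z| + 1 / |t + x - z| + 1 / |t - x + z| + 1 / |t - x - z|)) := by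
    have e : ∀ η, η ^ (-p - 1 / 2) * T η = d₁ * d₂ * d₂ *
        (η ^ (-p - 1 / 2) * (Real.cos (2 * t * Real.sqrt η - δ₁) *
        Real.cos (2 * x * Real.sqrt η - δ₂) * Real.cos (2 * z * Real.sqrt η - δ₂))) := by
      intro η; rw [hT_def]; ring
    simp_rw [e]
    rw [intervalIntegral.integral_const_mul, abs_mul]
    gcongr
    · rw [abs_mul, abs_mul]
      calc |d₁| * |d₂| * |d₂| ≤ D * D * D := by
            gcongr
            · exact hd₁.trans (by simp [D, hD₂.le])
            · exact hd₂.trans (by simp [D, hD₁.le])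
            · exact hd₂.trans (by simp [D, hD₁.le])
        _ = _ := by ring
    · exact abs_integral_cos_mul_cos_mul_cos_le δ₁ δ₂ δ₂ hp hA hAB w1 w2 w3 w4
  have hrem : |∫ η in A..B, η ^ (-p - 1 / 2) * (S η - T η)| ≤
      D ^ 3 * (1 / t + 1 / x + 1 / z) * (A ^ (-p) / p) := by
    have : |∫ η in A..B, η ^ (-p - 1 / 2) * (S η - T η)| ≤
        ∫ η in A..B, D ^ 3 * (1 / t + 1 / x + 1 / z) * η ^ (-p - 1) := by
      rw [← Real.norm_eq_abs]
      refine intervalIntegral.norm_integral_le_of_norm_le hAB (Filter.Eventually.of_forall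
        fun η hη => ?_) (continuousOn_const.mul (hw (-p - 1))).intervalIntegrable
      have h0 : 0 < η := hA.trans hη.1
      rw [norm_mul, Real.norm_of_nonneg (Real.rpow_nonneg h0.le _), Real.norm_eq_abs]
      calc _ ≤ η ^ (-p - 1 / 2) * (D ^ 3 * (1 / t + 1 / x + 1 / z) * η ^ (-(1 / 2) : ℝ)) := by
            gcongr; exact herr η h0
        _ = D ^ 3 * (1 / t + 1 / x + 1 / z) * (η ^ (-p - 1 / 2) * η ^ (-(1 / 2) : ℝ)) := by ring
        _ = _ := by rw [← Real.rpow_add h0]; ring_nf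
    refine this.trans ?_
    rw [intervalIntegral.integral_const_mul]
    gcongr
    exact integral_rpow_tail_le hp hA hAB
  rw [hsplit, abs_mul, abs_of_pos hc]
  set W : ℝ := 1 / |t + x + z| + 1 / |t + x - z| + 1 / |t - x + z| + 1 / |t - x - z| with hW_def
  set U : ℝ := 1 / t + 1 / x + 1 / z with hU_def
  have hW : 0 ≤ W := by positivity
  have hU : 0 ≤ U := by positivity
  have hAp : 0 ≤ A ^ (-p) := by positivity
  have htail : tailFactor ν α t x z =
      t ^ (-(ν + 1 / 2)) * x ^ (-(α + 1 / 2)) * z ^ (-(α + 1 / 2)) * (U + W) := by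
    simp only [tailFactor, hU_def, hW_def]; ring
  calc c * |_ + _| ≤ c * (D ^ 3 * (A ^ (-p) * W) + D ^ 3 * U * (A ^ (-p) / p)) := by
        gcongr
        exact (abs_add_le _ _).trans (add_le_add hmain hrem)
    _ = c * D ^ 3 * A ^ (-p) * (W + U * (1 / p)) := by ring
    _ ≤ c * D ^ 3 * A ^ (-p) * ((1 + 1 / p) * (U + W)) := by
        gcongr
        have : 0 ≤ 1 / p := by positivity
        nlinarith [mul_nonneg this hW]
    _ = _ := by rw [htail, hc_def]; ring

/-! ### Laplace transforms of Bessel functions -/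

lemma integrableOn_rpow_mul_exp_neg {s p : ℝ} (hs : -1 < s) (hp : 0 < p) :
    MeasureTheory.IntegrableOn (fun η : ℝ => η ^ s * Real.exp (-(p * η))) (Set.Ioi 0) := by
  have := integrableOn_rpow_mul_exp_neg_mul_rpow hs one_pos hp
  simpa [Real.rpow_one, neg_mul] using this

lemma integral_rpow_mul_exp_neg {s p : ℝ} (hs : -1 < s) (hp : 0 < p) :
    ∫ η in Set.Ioi (0 : ℝ), η ^ s * Real.exp (-(p * η)) =
      (1 / p) ^ (s + 1) * Real.Gamma (s + 1) := by
  rw [← Real.integral_rpow_mul_exp_neg_mul_Ioi (by linarith) hp]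
  simp

/-- Termwise Laplace transform of a power series. -/
lemma hasSum_laplace_powerSeries {s p : ℝ} (hs : -1 < s) (hp : 0 < p) (c : ℕ → ℝ)
    (hc : Summable fun k : ℕ => |c k| * ((1 / p) ^ (k + s + 1) * Real.Gamma (k + s + 1))) :
    HasSum (fun k : ℕ => c k * ((1 / p) ^ (k + s + 1) * Real.Gamma (k + s + 1)))
      (∫ η in Set.Ioi (0 : ℝ), (∑' k : ℕ, c k * η ^ k) * η ^ s * Real.exp (-(p * η))) := by
  have hks : ∀ k : ℕ, -1 < (k : ℝ) + s := fun k => by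
    have := k.cast_nonneg (α := ℝ); linarith
  have hI := fun k : ℕ => integrableOn_rpow_mul_exp_neg (hks k) hp
  have h := MeasureTheory.hasSum_integral_of_summable_integral_norm
    (μ := MeasureTheory.volume.restrict (Set.Ioi (0 : ℝ)))
    (F := fun (k : ℕ) (η : ℝ) => c k * (η ^ ((k : ℝ) + s) * Real.exp (-(p * η))))
    (fun k => (hI k).const_mul _) (by
      refine hc.congr fun k => ?_
      rw [← integral_rpow_mul_exp_neg (hks k) hp, ← MeasureTheory.integral_const_mul]
      refine MeasureTheory.setIntegral_congr_fun measurableSet_Ioi fun η hη => ?_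
      have hη' : 0 < η := hη
      rw [norm_mul, Real.norm_eq_abs (c k), Real.norm_of_nonneg (by positivity)])
  convert! h using 1
  · funext k
    rw [MeasureTheory.integral_const_mul, integral_rpow_mul_exp_neg (hks k) hp]
  · refine MeasureTheory.setIntegral_congr_fun measurableSet_Ioi fun η hη => ?_
    have hη' : 0 < η := hη
    rw [← tsum_mul_right, ← tsum_mul_right]
    refine tsum_congr fun k => ?_
    rw [Real.rpow_add hη', Real.rpow_natCast]
    ring

lemma clifford_mul_eq_tsum (ν r η : ℝ) :
    clifford ν (r * η) =
      ∑' k : ℕ, ((-r) ^ k / ((k.factorial : ℝ) * Real.Gamma ((k : ℝ) + ν + 1))) * η ^ k := by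
  unfold clifford
  refine tsum_congr fun k => ?_
  rw [← neg_mul, mul_pow]
  ring

lemma one_div_rpow_nat_add {p : ℝ} (hp : 0 < p) (k : ℕ) (s : ℝ) :
    (1 / p) ^ ((k : ℝ) + s + 1) = (1 / p) ^ k * (1 / p) ^ (s + 1) := by
  rw [add_assoc, Real.rpow_add (by positivity), Real.rpow_natCast]

/-- Weber's first exponential integral. -/
lemma integral_rpow_mul_clifford_mul_exp {ν s : ℝ} (hν : -1 < ν) (hs : 0 < s) (η : ℝ) :
    ∫ τ in Set.Ioi (0 : ℝ), clifford ν (η * τ) * τ ^ ν * Real.exp (-(s * τ)) =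
      (1 / s) ^ (ν + 1) * Real.exp (-(η / s)) := by
  simp_rw [clifford_mul_eq_tsum]
  have e : ∀ y : ℝ, ∀ k : ℕ, y ^ k / ((k.factorial : ℝ) * Real.Gamma ((k : ℝ) + ν + 1)) *
      ((1 / s) ^ ((k : ℝ) + ν + 1) * Real.Gamma (k + ν + 1)) =
      (1 / s) ^ (ν + 1) * ((y / s) ^ k / k.factorial) := by
    intro y k
    have := (Gamma_shift_pos hν k).ne'
    rw [one_div_rpow_nat_add hs]
    rw [div_pow, div_pow, one_pow]
    field_simp
  refine (hasSum_laplace_powerSeries hν hs _ ?_).unique ?_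
  · refine ((Real.summable_pow_div_factorial (|η| / s)).mul_left ((1 / s) ^ (ν + 1))).congr
      fun k => ?_
    have h1 := (Gamma_shift_pos hν k)
    rw [← e, abs_div, abs_pow, abs_neg, abs_of_pos (a := _ * _) (by positivity)]
  · simp_rw [e]
    have := (NormedSpace.expSeries_div_hasSum_exp (-(η / s))).mul_left ((1 / s) ^ (ν + 1))
    rw [← Real.exp_eq_exp_ℝ] at this
    convert! this using 5
    rw [neg_div]

/-- Chu–Vandermonde summation. -/
lemma sum_choose_mul_descFactorial_div_Gamma (k : ℕ) :
    ∀ (j : ℕ) {α : ℝ}, -1 < α →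
      ∑ m ∈ Finset.range (k + 1), (k.choose m : ℝ) * (j.descFactorial m) / Real.Gamma (m + α + 1) =
        Real.Gamma (j + k + α + 1) / (Real.Gamma (j + α + 1) * Real.Gamma (k + α + 1)) := by
  induction k with
  | zero =>
    intro j α hα
    have := (Gamma_shift_pos hα j).ne'
    simp
    field_simp
  | succ k ih =>
    intro j α hα
    have hs : ∑ m ∈ Finset.range (k + 1 + 1),
        ((k + 1).choose m : ℝ) * (j.descFactorial m) / Real.Gamma (m + α + 1) =
        (∑ m ∈ Finset.range (k + 1),
          (k.choose m : ℝ) * (j.descFactorial m) / Real.Gamma (m + α + 1)) +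
        ∑ m ∈ Finset.range (k + 1),
          (k.choose m : ℝ) * (j.descFactorial (m + 1)) / Real.Gamma (m + (α + 1) + 1) := by
      rw [Finset.sum_range_succ']
      have h1 : ∑ m ∈ Finset.range (k + 1),
          (k.choose m : ℝ) * (j.descFactorial m) / Real.Gamma (m + α + 1) =
          ∑ m ∈ Finset.range (k + 1), (k.choose (m + 1) : ℝ) * (j.descFactorial (m + 1)) /
            Real.Gamma (((m + 1 : ℕ) : ℝ) + α + 1) + 1 / Real.Gamma (((0 : ℕ) : ℝ) + α + 1) := by
        rw [Finset.sum_range_succ', Finset.sum_range_succ _ k]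
        simp
      rw [h1, add_right_comm (∑ _ ∈ _, _), ← Finset.sum_add_distrib]
      congr 1
      · refine Finset.sum_congr rfl fun m _ => ?_
        rw [Nat.choose_succ_succ]
        push_cast
        rw [show (m : ℝ) + (α + 1) + 1 = m + 1 + α + 1 by ring]
        ring
      · simp
    rw [hs, ih j hα]
    have gk := Gamma_shift_succ hα k
    have gk0 := (Gamma_shift_pos hα k).ne'
    have hkn := k.cast_nonneg (α := ℝ)
    cases j with
    | zero =>
      simp only [Nat.zero_descFactorial_succ, Nat.cast_zero, mul_zero, zero_div,
        Finset.sum_const_zero, add_zero, zero_add]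
      have gk1 := (Gamma_shift_pos hα (k + 1)).ne'
      field_simp
    | succ j =>
      have hjn := j.cast_nonneg (α := ℝ)
      simp_rw [Nat.succ_descFactorial_succ]
      have h2 : ∑ m ∈ Finset.range (k + 1), (k.choose m : ℝ) *
          (((j + 1) * j.descFactorial m : ℕ) : ℝ) / Real.Gamma (m + (α + 1) + 1) =
          (j + 1) * ∑ m ∈ Finset.range (k + 1), (k.choose m : ℝ) * (j.descFactorial m) /
            Real.Gamma (m + (α + 1) + 1) := by
        rw [Finset.mul_sum]
        refine Finset.sum_congr rfl fun m _ => ?_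
        push_cast
        ring
      rw [h2, ih j (show -1 < α + 1 by linarith)]
      have gj0 := (Gamma_shift_pos hα (j + 1)).ne'
      have G1 : Real.Gamma ((((j + 1 : ℕ) : ℝ)) + ((k + 1 : ℕ) : ℝ) + α + 1) =
          (j + 1 + k + α + 1) * Real.Gamma (((j + 1 : ℕ) : ℝ) + k + α + 1) := by
        have := Gamma_shift_succ hα (j + 1 + k)
        push_cast at this ⊢
        rw [← this]
        ring_nf
      have G2 : Real.Gamma ((j : ℝ) + k + (α + 1) + 1) =
          Real.Gamma (((j + 1 : ℕ) : ℝ) + k + α + 1) := by push_cast; ring_nf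
      have G3 : Real.Gamma ((j : ℝ) + (α + 1) + 1) =
          Real.Gamma (((j + 1 : ℕ) : ℝ) + α + 1) := by push_cast; ring_nf
      have G4 : Real.Gamma ((k : ℝ) + (α + 1) + 1) = (k + α + 1) * Real.Gamma (k + α + 1) := by
        rw [← gk]; push_cast; ring_nf
      have hka : (k : ℝ) + α + 1 ≠ 0 := by linarith
      rw [G1, G2, G3, G4, gk]
      field_simp
      ring

lemma hasSum_pow_div_factorial_mul_descFactorial (m : ℕ) (y : ℝ) :
    HasSum (fun j : ℕ => y ^ j / j.factorial * (j.descFactorial m)) (y ^ m * Real.exp y) := by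
  rw [← hasSum_nat_add_iff' m]
  have h0 : ∑ i ∈ Finset.range m, y ^ i / i.factorial * ((i.descFactorial m : ℕ) : ℝ) = 0 := by
    refine Finset.sum_eq_zero fun i hi => ?_
    rw [Nat.descFactorial_of_lt (Finset.mem_range.1 hi)]
    simp
  rw [h0, sub_zero]
  have := (NormedSpace.expSeries_div_hasSum_exp y).mul_left (y ^ m)
  rw [← Real.exp_eq_exp_ℝ] at this
  refine this.congr_fun fun i => ?_
  have h1 := Nat.factorial_mul_descFactorial (Nat.le_add_left m i)
  rw [Nat.add_sub_cancel] at h1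
  have h2 : ((i + m).factorial : ℝ) ≠ 0 := by positivity
  have h3 : (i.factorial : ℝ) ≠ 0 := by positivity
  have h4 : (i.factorial : ℝ) * ((i + m).descFactorial m : ℝ) = (i + m).factorial := by
    exact_mod_cast h1
  rw [← h4] at h2 ⊢
  field_simp [right_ne_zero_of_mul h2]
  ring

/-- Termwise evaluation of the Laplace transform of `η^(k + α) clifford α (X η)`: by Chu–Vandermonde
it is `e^(-X/p)` times a Laguerre polynomial in `X / p`, up to normalisation. -/
lemma hasSum_cliffordMoment {α p : ℝ} (hα : -1 < α) (hp : 0 < p) (k : ℕ) (X : ℝ) :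
    HasSum (fun j : ℕ => (-X) ^ j / ((j.factorial : ℝ) * Real.Gamma (j + α + 1)) *
        ((1 / p) ^ ((j : ℝ) + (k + α) + 1) * Real.Gamma (j + (k + α) + 1)))
      ((1 / p) ^ (k + α + 1) * Real.Gamma (k + α + 1) * Real.exp (-(X / p)) *
        ∑ m ∈ Finset.range (k + 1), (k.choose m : ℝ) * (-(X / p)) ^ m /
          Real.Gamma (m + α + 1)) := by
  have h := (hasSum_sum fun m (_ : m ∈ Finset.range (k + 1)) =>
    (hasSum_pow_div_factorial_mul_descFactorial m (-(X / p))).mul_left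
      ((k.choose m : ℝ) / Real.Gamma (m + α + 1))).mul_left
        ((1 / p) ^ (k + α + 1) * Real.Gamma (k + α + 1))
  convert! h using 1
  · funext j
    have V := sum_choose_mul_descFactorial_div_Gamma k j hα
    have e : ∑ m ∈ Finset.range (k + 1), (k.choose m : ℝ) / Real.Gamma (m + α + 1) *
        ((-(X / p)) ^ j / j.factorial * (j.descFactorial m)) = ((-(X / p)) ^ j / j.factorial) *
        (Real.Gamma (j + k + α + 1) / (Real.Gamma (j + α + 1) * Real.Gamma (k + α + 1))) := by
      rw [← V, Finset.mul_sum]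
      exact Finset.sum_congr rfl fun m _ => by ring
    have g1 := (Gamma_shift_pos hα j).ne'
    have g2 := (Gamma_shift_pos hα k).ne'
    rw [e, one_div_rpow_nat_add hp, show (j : ℝ) + (k + α) + 1 = j + k + α + 1 by ring]
    rw [show -(X / p) = -X * (1 / p) by ring, mul_pow]
    field_simp
  · rw [mul_assoc, Finset.mul_sum]
    congr 1
    exact Finset.sum_congr rfl fun m _ => by ring

/-- Taking absolute values of the terms of `hasSum_cliffordMoment` amounts to replacing `X` by
`-|X|`. -/
lemma summable_cliffordMoment_abs {α p : ℝ} (hα : -1 < α) (hp : 0 < p) (k : ℕ) (X : ℝ) :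
    Summable fun j : ℕ => |(-X) ^ j / ((j.factorial : ℝ) * Real.Gamma (j + α + 1))| *
        ((1 / p) ^ ((j : ℝ) + (k + α) + 1) * Real.Gamma (j + (k + α) + 1)) := by
  refine (hasSum_cliffordMoment hα hp k (-|X|)).summable.congr fun j => ?_
  have h1 := Gamma_shift_pos hα j
  rw [abs_div, abs_pow, abs_neg, neg_neg, abs_of_pos (a := _ * _) (by positivity)]

lemma integral_rpow_nat_mul_clifford_mul_exp {α p : ℝ} (hα : -1 < α) (hp : 0 < p) (k : ℕ)
    (X : ℝ) :
    ∫ η in Set.Ioi (0 : ℝ), clifford α (X * η) * η ^ (k + α) * Real.exp (-(p * η)) =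
      (1 / p) ^ (k + α + 1) * Real.Gamma (k + α + 1) * Real.exp (-(X / p)) *
        ∑ m ∈ Finset.range (k + 1), (k.choose m : ℝ) * (-(X / p)) ^ m / Real.Gamma (m + α + 1) := by
  simp_rw [clifford_mul_eq_tsum]
  have := k.cast_nonneg (α := ℝ)
  exact (hasSum_laplace_powerSeries (by linarith) hp _
    (summable_cliffordMoment_abs hα hp k X)).unique (hasSum_cliffordMoment hα hp k X)

/-- Weber's second exponential integral. The second Bessel function is expanded in its power series,
each term is a Laguerre-type finite sum, and the resulting double series is a Cauchy product. -/
lemma integral_clifford_mul_clifford_mul_exp {α p X Z : ℝ} (hα : -(1 / 2) < α) (hp : 0 < p)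
    (hX : 0 ≤ X) :
    ∫ η in Set.Ioi (0 : ℝ), clifford α (X * η) * clifford α (Z * η) * η ^ α *
        Real.exp (-(p * η)) =
      (1 / p) ^ (α + 1) * Real.exp (-((X + Z) / p)) * clifford α (-(X * Z / p ^ 2)) := by
  have hα' : -1 < α := by linarith
  obtain ⟨C, hC, -, -, hCb, -⟩ := exists_clifford_bound hα
  have hks : ∀ k : ℕ, -1 < (k : ℝ) + α := fun k => by
    have := k.cast_nonneg (α := ℝ); linarith
  set c : ℕ → ℝ := fun k => (-Z) ^ k / ((k.factorial : ℝ) * Real.Gamma ((k : ℝ) + α + 1))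
  set F : ℕ → ℝ → ℝ := fun k η =>
    c k * (clifford α (X * η) * η ^ ((k : ℝ) + α) * Real.exp (-(p * η)))
  have hcont := continuous_clifford hα'
  have hI : ∀ k : ℕ, MeasureTheory.IntegrableOn
      (fun η : ℝ => clifford α (X * η) * η ^ ((k : ℝ) + α) * Real.exp (-(p * η)))
      (Set.Ioi 0) := by
    intro k
    simp_rw [mul_assoc]
    refine MeasureTheory.Integrable.bdd_mul (c := C) (integrableOn_rpow_mul_exp_neg (hks k) hp)
      (Continuous.aestronglyMeasurable (by fun_prop)) ?_
    refine (MeasureTheory.ae_restrict_mem measurableSet_Ioi).mono fun η hη => ?_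
    exact hCb _ (mul_nonneg hX (le_of_lt hη))
  have hbound : ∀ k : ℕ, ∫ η in Set.Ioi (0 : ℝ), ‖F k η‖ ≤
      C * (1 / p) ^ (α + 1) * ((|Z| / p) ^ k / k.factorial) := by
    intro k
    have h1 : ∫ η in Set.Ioi (0 : ℝ), ‖F k η‖ ≤
        ∫ η in Set.Ioi (0 : ℝ), |c k| * C * (η ^ ((k : ℝ) + α) * Real.exp (-(p * η))) := by
      refine MeasureTheory.setIntegral_mono_on ((hI k).const_mul _).norm
        ((integrableOn_rpow_mul_exp_neg (hks k) hp).const_mul _) measurableSet_Ioi fun η hη => ?_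
      have hη' : 0 < η := hη
      simp only [F]
      rw [norm_mul, mul_assoc (clifford α _), norm_mul (clifford α _), Real.norm_eq_abs (c k),
        mul_assoc, Real.norm_of_nonneg (r := η ^ ((k : ℝ) + α) * _) (by positivity)]
      gcongr
      exact hCb _ (mul_nonneg hX hη'.le)
    refine h1.trans (le_of_eq ?_)
    rw [MeasureTheory.integral_const_mul, integral_rpow_mul_exp_neg (hks k) hp,
      one_div_rpow_nat_add hp]
    have g := Gamma_shift_pos hα' k
    simp only [c]
    rw [abs_div, abs_pow, abs_neg, abs_of_pos (a := _ * _) (by positivity), div_pow, div_pow,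
      one_pow]
    field_simp
  have h := MeasureTheory.hasSum_integral_of_summable_integral_norm
    (μ := MeasureTheory.volume.restrict (Set.Ioi (0 : ℝ))) (F := F)
    (fun k => (hI k).const_mul _)
    (Summable.of_nonneg_of_le
      (fun k => MeasureTheory.integral_nonneg fun _ => norm_nonneg _) hbound
      ((Real.summable_pow_div_factorial (|Z| / p)).mul_left _))
  have e1 : ∫ η in Set.Ioi (0 : ℝ), clifford α (X * η) * clifford α (Z * η) * η ^ α *
        Real.exp (-(p * η)) = ∫ η in Set.Ioi (0 : ℝ), ∑' k, F k η := by
    refine MeasureTheory.setIntegral_congr_fun measurableSet_Ioi fun η hη => ?_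
    have hη' : 0 < η := hη
    simp only [F]
    have : ∀ k : ℕ, c k * (clifford α (X * η) * η ^ ((k : ℝ) + α) * Real.exp (-(p * η))) =
        (c k * η ^ k) * (clifford α (X * η) * η ^ α * Real.exp (-(p * η))) := by
      intro k
      rw [Real.rpow_add hη', Real.rpow_natCast]; ring
    simp_rw [this]
    rw [tsum_mul_right, clifford_mul_eq_tsum α Z η]
    ring
  rw [e1, ← h.tsum_eq]
  have e2 : ∀ k : ℕ, ∫ η in Set.Ioi (0 : ℝ), F k η = (1 / p) ^ (α + 1) * Real.exp (-(X / p)) *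
      ∑ m ∈ Finset.range (k + 1), ((X / p * (Z / p)) ^ m / (m.factorial * Real.Gamma (m + α + 1))) *
        ((-(Z / p)) ^ (k - m) / (k - m).factorial) := by
    intro k
    simp only [F]
    rw [MeasureTheory.integral_const_mul, integral_rpow_nat_mul_clifford_mul_exp hα' hp,
      one_div_rpow_nat_add hp]
    have g := (Gamma_shift_pos hα' k).ne'
    simp only [c]
    have e3 : ∀ S E : ℝ, (-Z) ^ k / ((k.factorial : ℝ) * Real.Gamma (k + α + 1)) *
        ((1 / p) ^ k * (1 / p) ^ (α + 1) * Real.Gamma (k + α + 1) * E * S) =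
        (1 / p) ^ (α + 1) * E * ((-(Z / p)) ^ k / k.factorial * S) := by
      intro S E
      rw [show -(Z / p) = -Z * (1 / p) by ring, mul_pow]
      field_simp
    rw [e3, Finset.mul_sum]
    congr 1
    refine Finset.sum_congr rfl fun m hm => ?_
    have hmk : m ≤ k := Nat.lt_succ_iff.1 (Finset.mem_range.1 hm)
    rw [Nat.cast_choose ℝ hmk, ← Nat.sub_add_cancel hmk, pow_add, Nat.add_sub_cancel]
    have g2 := (Gamma_shift_pos hα' m).ne'
    have e4 : (X / p * (Z / p)) ^ m = (-(X / p)) ^ m * (-(Z / p)) ^ m := by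
      rw [← mul_pow]; ring
    rw [e4]
    have f1 : ((k - m + m).factorial : ℝ) ≠ 0 := by positivity
    have f2 : ((k - m).factorial : ℝ) ≠ 0 := by positivity
    have f3 : (m.factorial : ℝ) ≠ 0 := by positivity
    generalize ((k - m + m).factorial : ℝ) = A at *
    generalize ((k - m).factorial : ℝ) = B at *
    generalize (-(X / p)) ^ m = xx
    generalize (-(Z / p)) ^ m = zz
    generalize (-(Z / p)) ^ (k - m) = yy
    field_simp
  simp_rw [e2]
  rw [tsum_mul_left]
  have hs1 := summable_clifford_norm hα' (-(X / p * (Z / p)))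
  have hs2 : Summable fun n : ℕ => ‖(-(Z / p)) ^ n / (n.factorial : ℝ)‖ := by
    refine (Real.summable_pow_div_factorial |Z / p|).congr fun n => ?_
    rw [norm_div, norm_pow, norm_neg, Real.norm_eq_abs, Real.norm_natCast]
  simp only [neg_neg] at hs1
  -- Cauchy product of the Clifford series at `-XZ/p²` and the exponential series at `-Z/p`
  rw [← tsum_mul_tsum_eq_tsum_sum_range_of_summable_norm hs1 hs2]
  have e5 : ∑' n : ℕ, (-(Z / p)) ^ n / (n.factorial : ℝ) = Real.exp (-(Z / p)) := by
    rw [Real.exp_eq_exp_ℝ, NormedSpace.exp_eq_tsum_div]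
  have e6 : clifford α (-(X * Z / p ^ 2)) =
      ∑' m : ℕ, (X / p * (Z / p)) ^ m / (m.factorial * Real.Gamma (m + α + 1)) := by
    unfold clifford
    refine tsum_congr fun m => ?_
    rw [neg_neg, show X * Z / p ^ 2 = X / p * (Z / p) by ring]
  rw [e5, e6, show -((X + Z) / p) = -(X / p) + -(Z / p) by ring, Real.exp_add]
  ring

/-! ### The symmetric beta weight and the Poisson integral -/

/-- Two-parameter beta weight on `(0, 1)`. -/
lemma integrableOn_beta {a b : ℝ} (ha : 0 < a) (hb : 0 < b) :
    MeasureTheory.IntegrableOn (fun u : ℝ => u ^ (a - 1) * (1 - u) ^ (b - 1)) (Set.Ioo 0 1) := by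
  have h := Complex.betaIntegral_convergent (u := (a : ℂ)) (v := (b : ℂ)) (by simpa) (by simpa)
  rw [intervalIntegrable_iff_integrableOn_Ioo_of_le zero_le_one] at h
  refine (MeasureTheory.IntegrableOn.congr_fun h.norm (fun u hu => ?_) measurableSet_Ioo)
  have h1 : 0 < 1 - u := by linarith [hu.2]
  have e : (1 : ℂ) - (u : ℂ) = ((1 - u : ℝ) : ℂ) := by push_cast; rfl
  rw [e, norm_mul, Complex.norm_cpow_eq_rpow_re_of_pos hu.1, Complex.norm_cpow_eq_rpow_re_of_pos h1]
  simp

/-- The weight `(u (1 - u))^(α - 1/2)` on `(0, 1)`, which is `sin^(2α) θ dθ` up to a constant when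
`cos θ = 1 - 2 u`. -/
noncomputable def betaWeight (α u : ℝ) : ℝ := (u * (1 - u)) ^ (α - 1 / 2)

/-- Total mass of `betaWeight`. -/
noncomputable def betaMass (α : ℝ) : ℝ := ∫ u in Set.Ioo (0 : ℝ) 1, betaWeight α u

lemma betaWeight_pos (α : ℝ) {u : ℝ} (hu : u ∈ Set.Ioo (0 : ℝ) 1) : 0 < betaWeight α u :=
  Real.rpow_pos_of_pos (mul_pos hu.1 (by linarith [hu.2])) _

lemma betaWeight_eq (α : ℝ) {u : ℝ} (hu : u ∈ Set.Ioo (0 : ℝ) 1) :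
    betaWeight α u = u ^ (α + 1 / 2 - 1) * (1 - u) ^ (α + 1 / 2 - 1) := by
  rw [betaWeight, Real.mul_rpow hu.1.le (by linarith [hu.2])]
  ring_nf

lemma integrableOn_betaWeight {α : ℝ} (hα : -(1 / 2) < α) :
    MeasureTheory.IntegrableOn (betaWeight α) (Set.Ioo 0 1) :=
  (integrableOn_beta (a := α + 1 / 2) (b := α + 1 / 2) (by linarith) (by linarith)).congr_fun
    (fun _ hu => (betaWeight_eq α hu).symm) measurableSet_Ioo

lemma betaMass_pos {α : ℝ} (hα : -(1 / 2) < α) : 0 < betaMass α := by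
  refine (MeasureTheory.setIntegral_pos_iff_support_of_nonneg_ae
    ((MeasureTheory.ae_restrict_mem measurableSet_Ioo).mono fun u hu => (betaWeight_pos α hu).le)
    (integrableOn_betaWeight hα)).2 ?_
  have : Set.Ioo (0 : ℝ) 1 ⊆ Function.support (betaWeight α) ∩ Set.Ioo 0 1 :=
    fun u hu => ⟨(betaWeight_pos α hu).ne', hu⟩
  exact lt_of_lt_of_le (by simp) (MeasureTheory.measure_mono this)

/-- Moments of `betaWeight` in the centred variable `1 - 2u`. -/
noncomputable def betaMoment (α : ℝ) (n : ℕ) : ℝ :=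
  ∫ u in Set.Ioo (0 : ℝ) 1, (1 - 2 * u) ^ n * betaWeight α u

lemma integrableOn_mul_betaWeight {α : ℝ} (hα : -(1 / 2) < α) {f : ℝ → ℝ} (hf : Continuous f) :
    MeasureTheory.IntegrableOn (fun u => f u * betaWeight α u) (Set.Ioo 0 1) := by
  obtain ⟨C, hC⟩ := (isCompact_Icc (a := (0 : ℝ)) (b := 1)).exists_bound_of_continuousOn
    hf.continuousOn
  refine MeasureTheory.Integrable.bdd_mul (c := C) (integrableOn_betaWeight hα)
    hf.aestronglyMeasurable ?_
  exact (MeasureTheory.ae_restrict_mem measurableSet_Ioo).mono fun u hu => hC u ⟨hu.1.le, hu.2.le⟩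

/-- Integration of the derivative of `(1 - 2u)ⁿ (u (1 - u))^(α + 1/2)`, which vanishes at both ends.
For `n = 0` the truncated index `n - 1` carries the coefficient `0`. -/
lemma betaMoment_succ {α : ℝ} (hα : -(1 / 2) < α) (n : ℕ) :
    (α + 1 / 2 + n / 2) * betaMoment α (n + 1) = n / 2 * betaMoment α (n - 1) := by
  set f : ℝ → ℝ := fun u => (1 - 2 * u) ^ n * (u * (1 - u)) ^ (α + 1 / 2)
  set f' : ℝ → ℝ := fun u => (α + 1 / 2 + n / 2) * ((1 - 2 * u) ^ (n + 1) * betaWeight α u) -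
    n / 2 * ((1 - 2 * u) ^ (n - 1) * betaWeight α u)
  have hi1 : MeasureTheory.IntegrableOn (fun u => (1 - 2 * u) ^ (n + 1) * betaWeight α u)
      (Set.Ioo 0 1) := integrableOn_mul_betaWeight hα (by fun_prop)
  have hi2 : MeasureTheory.IntegrableOn (fun u => (1 - 2 * u) ^ (n - 1) * betaWeight α u)
      (Set.Ioo 0 1) := integrableOn_mul_betaWeight hα (by fun_prop)
  have hI : MeasureTheory.IntegrableOn f' (Set.Ioo 0 1) := (hi1.const_mul _).sub (hi2.const_mul _)
  have hcont : ContinuousOn f (Set.Icc 0 1) := by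
    refine ContinuousOn.mul (by fun_prop) (ContinuousOn.rpow_const (by fun_prop) ?_)
    exact fun u _ => Or.inr (by linarith)
  have hder : ∀ u ∈ Set.Ioo (0 : ℝ) 1, HasDerivAt f (f' u) u := by
    intro u hu
    have hw : 0 < u * (1 - u) := mul_pos hu.1 (by linarith [hu.2])
    have d1 : HasDerivAt (fun u : ℝ => 1 - 2 * u) (-2) u := by
      simpa using ((hasDerivAt_id u).const_mul 2).const_sub 1
    have d2 : HasDerivAt (fun u : ℝ => u * (1 - u)) (1 - 2 * u) u := by
      refine HasDerivAt.congr_deriv ((hasDerivAt_id u).mul ((hasDerivAt_id u).const_sub 1)) ?_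
      simp only [id]
      ring
    refine HasDerivAt.congr_deriv (f := f) ((d1.pow n).mul
      (d2.rpow_const (p := α + 1 / 2) (Or.inl hw.ne'))) ?_
    have e1 : (u * (1 - u)) ^ (α + 1 / 2) = betaWeight α u * (u * (1 - u)) := by
      rw [betaWeight, ← Real.rpow_add_one hw.ne']; ring_nf
    have e2 : (u * (1 - u)) ^ (α + 1 / 2 - 1) = betaWeight α u := by
      rw [betaWeight]; ring_nf
    simp only [f', Pi.pow_apply, e1, e2]
    rcases n with _ | n
    · simp
      ring
    · simp only [Nat.add_sub_cancel]
      push_cast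
      ring
  have h := intervalIntegral.integral_eq_sub_of_hasDerivAt_of_le zero_le_one hcont hder
    ((intervalIntegrable_iff_integrableOn_Ioo_of_le zero_le_one).2 hI)
  have hz : (0 : ℝ) ^ (α + 1 / 2) = 0 := Real.zero_rpow (by linarith)
  have hf0 : f 0 = 0 := by simp only [f, zero_mul, hz, mul_zero]
  have hf1 : f 1 = 0 := by simp only [f, sub_self, mul_zero, hz]
  rw [hf0, hf1, sub_zero, intervalIntegral.integral_of_le zero_le_one,
    MeasureTheory.integral_Ioc_eq_integral_Ioo] at h
  simp only [f'] at h
  rw [MeasureTheory.integral_sub (hi1.const_mul _) (hi2.const_mul _),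
    MeasureTheory.integral_const_mul, MeasureTheory.integral_const_mul] at h
  simp only [betaMoment]
  linarith

lemma betaMoment_odd {α : ℝ} (hα : -(1 / 2) < α) (m : ℕ) : betaMoment α (2 * m + 1) = 0 := by
  induction m with
  | zero =>
    have h := betaMoment_succ hα 0
    simp only [Nat.cast_zero, zero_div, add_zero, zero_mul] at h
    exact (mul_eq_zero.1 h).resolve_left (by linarith)
  | succ m ih =>
    have h := betaMoment_succ hα (2 * m + 2)
    rw [show 2 * m + 2 - 1 = 2 * m + 1 by omega, ih, mul_zero] at h
    refine (mul_eq_zero.1 h).resolve_left ?_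
    have := (2 * m + 2).cast_nonneg (α := ℝ)
    linarith

lemma betaMoment_even {α : ℝ} (hα : -(1 / 2) < α) (m : ℕ) :
    betaMoment α (2 * m) = betaMass α * Real.Gamma (α + 1) * (2 * m).factorial /
      (4 ^ m * m.factorial * Real.Gamma (m + α + 1)) := by
  induction m with
  | zero =>
    have := (Real.Gamma_pos_of_pos (show 0 < α + 1 by linarith)).ne'
    simp [betaMoment, betaMass]
    field_simp
  | succ m ih =>
    have h := betaMoment_succ hα (2 * m + 1)
    rw [show 2 * m + 1 - 1 = 2 * m by omega, ih] at h
    have hm := m.cast_nonneg (α := ℝ)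
    have hn : (m : ℝ) + α + 1 ≠ 0 := by linarith
    have g := (Gamma_shift_pos (show -1 < α by linarith) m).ne'
    rw [Gamma_shift_succ (show -1 < α by linarith) m, show 2 * (m + 1) = 2 * m + 1 + 1 by ring,
      Nat.factorial_succ, Nat.factorial_succ, Nat.factorial_succ]
    have e : α + 1 / 2 + ((2 * m + 1 : ℕ) : ℝ) / 2 = m + α + 1 := by push_cast; ring
    rw [e] at h
    refine mul_left_cancel₀ hn (h.trans ?_)
    push_cast
    field_simp
    ring

/-- Poisson's integral for the modified Bessel function. -/
lemma integral_exp_mul_betaWeight {α : ℝ} (hα : -(1 / 2) < α) (κ : ℝ) :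
    ∫ u in Set.Ioo (0 : ℝ) 1, Real.exp (κ * (1 - 2 * u)) * betaWeight α u =
      betaMass α * Real.Gamma (α + 1) * clifford α (-(κ ^ 2 / 4)) := by
  set F : ℕ → ℝ → ℝ := fun n u => κ ^ n / n.factorial * ((1 - 2 * u) ^ n * betaWeight α u)
  have hI : ∀ n : ℕ, MeasureTheory.IntegrableOn (fun u => (1 - 2 * u) ^ n * betaWeight α u)
      (Set.Ioo 0 1) := fun n => integrableOn_mul_betaWeight hα (by fun_prop)
  have h := MeasureTheory.hasSum_integral_of_summable_integral_norm
    (μ := MeasureTheory.volume.restrict (Set.Ioo (0 : ℝ) 1)) (F := F)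
    (fun n => (hI n).const_mul _) (by
      refine Summable.of_nonneg_of_le
        (fun n => MeasureTheory.integral_nonneg fun _ => norm_nonneg _)
        (fun n => ?_) ((Real.summable_pow_div_factorial |κ|).mul_right (betaMass α))
      rw [betaMass, ← MeasureTheory.integral_const_mul]
      refine MeasureTheory.setIntegral_mono_on ((hI n).const_mul _).norm
        ((integrableOn_betaWeight hα).const_mul _) measurableSet_Ioo fun u hu => ?_
      have hw := betaWeight_pos α hu
      have h1 : |1 - 2 * u| ≤ 1 := by
        rw [abs_le]; constructor <;> linarith [hu.1, hu.2]
      simp only [F]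
      rw [norm_mul, norm_mul, norm_div, norm_pow, norm_pow, Real.norm_natCast,
        Real.norm_of_nonneg hw.le, Real.norm_eq_abs, Real.norm_eq_abs]
      gcongr
      exact mul_le_of_le_one_left hw.le (pow_le_one₀ (abs_nonneg _) h1))
  have e1 : ∫ u in Set.Ioo (0 : ℝ) 1, Real.exp (κ * (1 - 2 * u)) * betaWeight α u =
      ∫ u in Set.Ioo (0 : ℝ) 1, ∑' n, F n u := by
    refine MeasureTheory.integral_congr_ae (Filter.Eventually.of_forall fun u => ?_)
    simp only [F]
    rw [Real.exp_eq_exp_ℝ, NormedSpace.exp_eq_tsum_div, ← tsum_mul_right]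
    refine tsum_congr fun n => ?_
    rw [mul_pow]
    ring
  have e2 : ∀ n : ℕ, ∫ u in Set.Ioo (0 : ℝ) 1, F n u = κ ^ n / n.factorial * betaMoment α n :=
    fun n => MeasureTheory.integral_const_mul _ _
  rw [e1]
  simp_rw [e2] at h
  refine h.unique ?_
  have hodd : HasSum (fun m : ℕ => κ ^ (2 * m + 1) / (2 * m + 1).factorial *
      betaMoment α (2 * m + 1)) 0 := by
    simp_rw [betaMoment_odd hα, mul_zero]
    exact hasSum_zero
  have heven : HasSum (fun m : ℕ => κ ^ (2 * m) / (2 * m).factorial * betaMoment α (2 * m))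
      (betaMass α * Real.Gamma (α + 1) * clifford α (-(κ ^ 2 / 4))) := by
    have := (summable_clifford (show -1 < α by linarith) (-(κ ^ 2 / 4))).hasSum.mul_left
      (betaMass α * Real.Gamma (α + 1))
    convert! this using 1
    funext m
    have f1 : ((2 * m).factorial : ℝ) ≠ 0 := by positivity
    have f2 : (m.factorial : ℝ) ≠ 0 := by positivity
    have g := (Gamma_shift_pos (show -1 < α by linarith) m).ne'
    rw [betaMoment_even hα, neg_neg, pow_mul, div_pow]
    field_simp
  have := HasSum.even_add_odd (f := fun n : ℕ => κ ^ n / n.factorial * betaMoment α n) heven hodd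
  rwa [add_zero] at this

/-! ### Uniqueness of Laplace transforms -/

/-- A continuous function on `(0, ∞)` with vanishing Laplace transform is nowhere positive. In the
variable `e^(-τ)` the hypothesis is the vanishing of all moments, so by Weierstrass the function is
orthogonal to every tent function of `e^(-τ)`. -/
lemma nonpos_of_laplace_eq_zero {h : ℝ → ℝ} (hc : ContinuousOn h (Set.Ioi 0))
    (hi : ∀ s : ℝ, 0 < s →
      MeasureTheory.IntegrableOn (fun τ => h τ * Real.exp (-(s * τ))) (Set.Ioi 0))
    (h0 : ∀ s : ℝ, 0 < s → ∫ τ in Set.Ioi (0 : ℝ), h τ * Real.exp (-(s * τ)) = 0)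
    {τ₀ : ℝ} (hτ₀ : 0 < τ₀) : h τ₀ ≤ 0 := by
  by_contra! hpos
  set g : ℝ → ℝ := fun τ => h τ * Real.exp (-(1 * τ)) with hg
  have hgi : MeasureTheory.IntegrableOn g (Set.Ioi 0) := hi 1 one_pos
  have hbdd : ∀ f : ℝ → ℝ, Continuous f →
      MeasureTheory.IntegrableOn (fun τ => f (Real.exp (-τ)) * g τ) (Set.Ioi 0) := by
    intro f hf
    obtain ⟨C, hC⟩ := (isCompact_Icc (a := (0 : ℝ)) (b := 1)).exists_bound_of_continuousOn
      hf.continuousOn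
    refine MeasureTheory.Integrable.bdd_mul (c := C) hgi
      (Continuous.aestronglyMeasurable (by fun_prop)) ?_
    refine (MeasureTheory.ae_restrict_mem measurableSet_Ioi).mono fun τ hτ =>
      hC _ ⟨by positivity, ?_⟩
    have hτ' : 0 < τ := hτ
    exact Real.exp_le_one_iff.2 (by linarith)
  have hmono : ∀ n : ℕ, ∫ τ in Set.Ioi (0 : ℝ), Real.exp (-τ) ^ n * g τ = 0 := by
    intro n
    have e : ∀ τ, Real.exp (-τ) ^ n * g τ = h τ * Real.exp (-(((n : ℝ) + 1) * τ)) := by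
      intro τ
      simp only [hg]
      rw [← Real.exp_nat_mul, mul_left_comm, ← Real.exp_add]
      ring_nf
    simp_rw [e]
    exact h0 (n + 1) (by positivity)
  have hpoly : ∀ p : Polynomial ℝ,
      ∫ τ in Set.Ioi (0 : ℝ), p.eval (Real.exp (-τ)) * g τ = 0 := by
    intro p
    have e : ∀ τ, p.eval (Real.exp (-τ)) * g τ =
        ∑ n ∈ Finset.range (p.natDegree + 1), p.coeff n * (Real.exp (-τ) ^ n * g τ) := by
      intro τ
      rw [Polynomial.eval_eq_sum_range, Finset.sum_mul]
      exact Finset.sum_congr rfl fun n _ => by ring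
    simp_rw [e]
    rw [MeasureTheory.integral_finsetSum _ fun n _ =>
      (hbdd (fun u => u ^ n) (by fun_prop)).const_mul _]
    refine Finset.sum_eq_zero fun n _ => ?_
    rw [MeasureTheory.integral_const_mul, hmono, mul_zero]
  have hcont : ∀ f : ℝ → ℝ, Continuous f →
      ∫ τ in Set.Ioi (0 : ℝ), f (Real.exp (-τ)) * g τ = 0 := by
    intro f hf
    set I : ℝ := ∫ τ in Set.Ioi (0 : ℝ), ‖g τ‖
    have hI : 0 ≤ I := MeasureTheory.integral_nonneg fun _ => norm_nonneg _
    by_contra hne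
    set J : ℝ := ∫ τ in Set.Ioi (0 : ℝ), f (Real.exp (-τ)) * g τ
    have hJ : 0 < |J| := abs_pos.2 hne
    set ε : ℝ := |J| / (2 * (I + 1))
    have hε : 0 < ε := by positivity
    obtain ⟨p, hp⟩ := exists_polynomial_near_of_continuousOn 0 1 f hf.continuousOn ε hε
    have hb : |J| ≤ ε * I := by
      have e : J = ∫ τ in Set.Ioi (0 : ℝ),
          (f (Real.exp (-τ)) * g τ - p.eval (Real.exp (-τ)) * g τ) := by
        rw [MeasureTheory.integral_sub (hbdd f hf) (hbdd _ p.continuous), hpoly, sub_zero]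
      rw [e, ← Real.norm_eq_abs, ← MeasureTheory.integral_const_mul]
      refine MeasureTheory.norm_integral_le_of_norm_le (hgi.norm.const_mul ε) ?_
      refine (MeasureTheory.ae_restrict_mem measurableSet_Ioi).mono fun τ hτ => ?_
      have hτ' : 0 < τ := hτ
      have := hp (Real.exp (-τ)) ⟨by positivity, Real.exp_le_one_iff.2 (by linarith)⟩
      rw [← sub_mul, norm_mul, Real.norm_eq_abs, abs_sub_comm]
      gcongr
    have h2 : ε * I ≤ |J| / 2 := by
      have : ε * (I + 1) = |J| / 2 := by simp only [ε]; field_simp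
      nlinarith
    linarith
  -- positivity of `h` near `τ₀`, transported to a neighbourhood of `e^(-τ₀)`
  have hev : ∀ᶠ τ in 𝓝 τ₀, 0 < h τ :=
    (hc.continuousAt (Ioi_mem_nhds hτ₀)).eventually (lt_mem_nhds hpos)
  set u₀ : ℝ := Real.exp (-τ₀)
  have hlog : Tendsto (fun u => -Real.log u) (𝓝 u₀) (𝓝 τ₀) := by
    have : ContinuousAt (fun u => -Real.log u) u₀ :=
      (Real.continuousAt_log (Real.exp_pos _).ne').neg
    have e : -Real.log u₀ = τ₀ := by simp [u₀]
    rw [← e]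
    exact this
  obtain ⟨δ, hδ, hδ'⟩ := Metric.eventually_nhds_iff.1 (hlog.eventually hev)
  have hnear : ∀ τ, |Real.exp (-τ) - u₀| < δ → 0 < h τ := by
    intro τ hτ
    have := hδ' (y := Real.exp (-τ)) (by rwa [Real.dist_eq])
    simpa using this
  -- a tent function of `e^(-τ)` supported where `h` is positive
  set f : ℝ → ℝ := fun u => max 0 (δ - |u - u₀|)
  have hfc : Continuous f := by fun_prop
  have hnonneg : ∀ τ, 0 ≤ f (Real.exp (-τ)) * g τ := by
    intro τ
    by_cases hτ : |Real.exp (-τ) - u₀| < δ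
    · exact mul_nonneg (le_max_left _ _) (mul_nonneg (hnear τ hτ).le (Real.exp_pos _).le)
    · have : f (Real.exp (-τ)) = 0 := max_eq_left (by linarith)
      rw [this, zero_mul]
  have hpos' : 0 < ∫ τ in Set.Ioi (0 : ℝ), f (Real.exp (-τ)) * g τ := by
    refine (MeasureTheory.setIntegral_pos_iff_support_of_nonneg_ae
      (Filter.Eventually.of_forall hnonneg) (hbdd f hfc)).2 ?_
    set U : Set ℝ := {τ | |Real.exp (-τ) - u₀| < δ} ∩ Set.Ioi 0
    have hU : IsOpen U := (isOpen_lt (by fun_prop) continuous_const).inter isOpen_Ioi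
    have hUne : U.Nonempty := ⟨τ₀, by simp [u₀, hδ], hτ₀⟩
    refine lt_of_lt_of_le (hU.measure_pos MeasureTheory.volume hUne)
      (MeasureTheory.measure_mono fun τ hτ => ⟨?_, hτ.2⟩)
    have h1 : 0 < f (Real.exp (-τ)) := by
      have : |Real.exp (-τ) - u₀| < δ := hτ.1
      exact lt_max_of_lt_right (by linarith)
    exact (mul_pos h1 (mul_pos (hnear τ hτ.1) (Real.exp_pos _))).ne'
  linarith [hcont f hfc]

/-- Continuous functions on `(0, ∞)` with the same Laplace transform agree. -/
lemma eq_of_laplace_eq {f g : ℝ → ℝ} (hf : ContinuousOn f (Set.Ioi 0))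
    (hg : ContinuousOn g (Set.Ioi 0))
    (hfi : ∀ s : ℝ, 0 < s →
      MeasureTheory.IntegrableOn (fun τ => f τ * Real.exp (-(s * τ))) (Set.Ioi 0))
    (hgi : ∀ s : ℝ, 0 < s →
      MeasureTheory.IntegrableOn (fun τ => g τ * Real.exp (-(s * τ))) (Set.Ioi 0))
    (h : ∀ s : ℝ, 0 < s → ∫ τ in Set.Ioi (0 : ℝ), f τ * Real.exp (-(s * τ)) =
      ∫ τ in Set.Ioi (0 : ℝ), g τ * Real.exp (-(s * τ)))
    {τ : ℝ} (hτ : 0 < τ) : f τ = g τ := by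
  have key : ∀ {f g : ℝ → ℝ}, ContinuousOn f (Set.Ioi 0) → ContinuousOn g (Set.Ioi 0) →
      (∀ s : ℝ, 0 < s →
        MeasureTheory.IntegrableOn (fun τ => f τ * Real.exp (-(s * τ))) (Set.Ioi 0)) →
      (∀ s : ℝ, 0 < s →
        MeasureTheory.IntegrableOn (fun τ => g τ * Real.exp (-(s * τ))) (Set.Ioi 0)) →
      (∀ s : ℝ, 0 < s → ∫ τ in Set.Ioi (0 : ℝ), f τ * Real.exp (-(s * τ)) =
        ∫ τ in Set.Ioi (0 : ℝ), g τ * Real.exp (-(s * τ))) → f τ ≤ g τ := by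
    intro f g hf hg hfi hgi h
    refine sub_nonpos.1 (nonpos_of_laplace_eq_zero (h := fun τ => f τ - g τ) (hf.sub hg)
      (fun s hs => ?_) (fun s hs => ?_) hτ)
    · simp_rw [sub_mul]
      exact (hfi s hs).sub (hgi s hs)
    · simp_rw [sub_mul]
      rw [MeasureTheory.integral_sub (hfi s hs) (hgi s hs), h s hs, sub_self]
  exact le_antisymm (key hf hg hfi hgi h) (key hg hf hgi hfi fun s hs => (h s hs).symm)

/-! ### The explicit formula for the kernel -/

/-- The power `y₊^γ`, vanishing for `y ≤ 0` also when `γ ≤ 0`. -/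
noncomputable def posPow (γ y : ℝ) : ℝ := if 0 < y then y ^ γ else 0

lemma posPow_nonneg (γ y : ℝ) : 0 ≤ posPow γ y := by
  unfold posPow
  split_ifs with h
  · positivity
  · exact le_rfl

lemma measurable_posPow (γ : ℝ) : Measurable (posPow γ) :=
  Measurable.ite measurableSet_Ioi (measurable_id.pow_const γ) measurable_const

lemma posPow_of_pos (γ : ℝ) {y : ℝ} (hy : 0 < y) : posPow γ y = y ^ γ := if_pos hy

lemma posPow_of_nonpos (γ : ℝ) {y : ℝ} (hy : y ≤ 0) : posPow γ y = 0 := if_neg (not_lt.2 hy)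

lemma posPow_eq_max {γ : ℝ} (hγ : 0 < γ) (y : ℝ) : posPow γ y = max y 0 ^ γ := by
  rcases lt_or_ge 0 y with h | h
  · rw [posPow_of_pos γ h, max_eq_left h.le]
  · rw [posPow_of_nonpos γ h, max_eq_right h, Real.zero_rpow hγ.ne']

lemma continuous_posPow {γ : ℝ} (hγ : 0 < γ) : Continuous (posPow γ) := by
  have : posPow γ = fun y => max y 0 ^ γ := funext (posPow_eq_max hγ)
  rw [this]
  exact Continuous.rpow_const (by fun_prop) fun _ => Or.inr hγ.le

/-- The square of the third side of a triangle with sides `x`, `z` enclosing the angle `θ`, where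
`cos θ = 1 - 2 u`. -/
def sideSq (x z u : ℝ) : ℝ := (x - z) ^ 2 + 4 * (x * z) * u

lemma continuous_sideSq (x z : ℝ) : Continuous (sideSq x z) := by
  unfold sideSq; fun_prop

lemma sideSq_nonneg {x z u : ℝ} (hx : 0 < x) (hz : 0 < z) (hu : u ∈ Set.Ioo (0 : ℝ) 1) :
    0 ≤ sideSq x z u := by
  have := hu.1
  unfold sideSq
  positivity

/-- The generalised translate of `(τ - w²)₊^(β - 1)`, where `w²` is `sideSq`. Up to a
constant and a power of `t`, this is the kernel at `τ = t²`. -/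
noncomputable def translate (α β x z τ : ℝ) : ℝ :=
  ∫ u in Set.Ioo (0 : ℝ) 1, posPow (β - 1) (τ - sideSq x z u) * betaWeight α u

lemma measurable_betaWeight (α : ℝ) : Measurable (betaWeight α) := by
  unfold betaWeight
  exact (measurable_id.mul (measurable_const.sub measurable_id)).pow_const _

lemma posPow_mul_exp_translate (β s c τ : ℝ) :
    posPow (β - 1) (τ - c) * Real.exp (-(s * τ)) = Real.exp (-(s * c)) *
      (posPow (β - 1) (τ - c) * Real.exp (-(s * (τ - c)))) := by
  rw [mul_left_comm, ← Real.exp_add]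
  ring_nf

lemma integrable_posPow_mul_exp {β s : ℝ} (hβ : 0 < β) (hs : 0 < s) :
    MeasureTheory.Integrable fun τ => posPow (β - 1) τ * Real.exp (-(s * τ)) := by
  have h := integrableOn_rpow_mul_exp_neg (show -1 < β - 1 by linarith) hs
  rw [← MeasureTheory.integrable_indicator_iff measurableSet_Ioi] at h
  refine h.congr (Filter.Eventually.of_forall fun τ => ?_)
  by_cases hτ : 0 < τ
  · simp [Set.indicator, hτ, posPow]
  · simp [Set.indicator, hτ, posPow]

lemma integral_posPow_mul_exp {β s : ℝ} (hβ : 0 < β) (hs : 0 < s) :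
    ∫ τ, posPow (β - 1) τ * Real.exp (-(s * τ)) = (1 / s) ^ β * Real.Gamma β := by
  rw [← MeasureTheory.setIntegral_eq_integral_of_forall_compl_eq_zero (s := Set.Ioi (0 : ℝ))]
  · rw [← Real.integral_rpow_mul_exp_neg_mul_Ioi hβ hs]
    refine MeasureTheory.setIntegral_congr_fun measurableSet_Ioi fun τ hτ => ?_
    rw [posPow_of_pos _ hτ]
  · intro τ hτ
    rw [posPow_of_nonpos _ (not_lt.1 hτ), zero_mul]

lemma integrableOn_posPow_sub_mul_exp {β s : ℝ} (hβ : 0 < β) (hs : 0 < s) (c : ℝ) :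
    MeasureTheory.IntegrableOn (fun τ => posPow (β - 1) (τ - c) * Real.exp (-(s * τ)))
      (Set.Ioi 0) := by
  simp_rw [posPow_mul_exp_translate β s c]
  exact (((integrable_posPow_mul_exp hβ hs).comp_sub_right c).const_mul _).integrableOn

lemma integral_posPow_sub_mul_exp {β s c : ℝ} (hβ : 0 < β) (hs : 0 < s) (hc : 0 ≤ c) :
    ∫ τ in Set.Ioi (0 : ℝ), posPow (β - 1) (τ - c) * Real.exp (-(s * τ)) =
      Real.exp (-(s * c)) * ((1 / s) ^ β * Real.Gamma β) := by
  rw [MeasureTheory.setIntegral_eq_integral_of_forall_compl_eq_zero]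
  · simp_rw [posPow_mul_exp_translate β s c]
    rw [MeasureTheory.integral_const_mul, ← integral_posPow_mul_exp hβ hs,
      MeasureTheory.integral_sub_right_eq_self
        (fun τ => posPow (β - 1) τ * Real.exp (-(s * τ))) c]
  · intro τ hτ
    have : τ ≤ 0 := not_lt.1 hτ
    rw [posPow_of_nonpos _ (by linarith), zero_mul]

lemma integrable_translate_prod {α β s x z : ℝ} (hα : -(1 / 2) < α) (hβ : 0 < β) (hs : 0 < s)
    (hx : 0 < x) (hz : 0 < z) :
    MeasureTheory.Integrable
      (fun q : ℝ × ℝ => posPow (β - 1) (q.1 - sideSq x z q.2) * betaWeight α q.2 *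
        Real.exp (-(s * q.1)))
      ((MeasureTheory.volume.restrict (Set.Ioi (0 : ℝ))).prod
        (MeasureTheory.volume.restrict (Set.Ioo (0 : ℝ) 1))) := by
  have hm : Measurable (fun q : ℝ × ℝ => posPow (β - 1) (q.1 - sideSq x z q.2) *
      betaWeight α q.2 * Real.exp (-(s * q.1))) := by
    refine (Measurable.mul ?_ ?_).mul (Continuous.measurable (by fun_prop))
    · refine (measurable_posPow _).comp (Continuous.measurable ?_)
      have := continuous_sideSq x z
      fun_prop
    · exact (measurable_betaWeight α).comp measurable_snd
  have e : ∀ u τ : ℝ, posPow (β - 1) (τ - sideSq x z u) * betaWeight α u * Real.exp (-(s * τ)) =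
      betaWeight α u * (posPow (β - 1) (τ - sideSq x z u) * Real.exp (-(s * τ))) :=
    fun u τ => by ring
  refine (MeasureTheory.integrable_prod_iff' hm.aestronglyMeasurable).2 ⟨?_, ?_⟩
  · refine Filter.Eventually.of_forall fun u => ?_
    simp only [e]
    exact (integrableOn_posPow_sub_mul_exp hβ hs _).const_mul _
  · have h1 : MeasureTheory.IntegrableOn (fun u => Real.exp (-(s * sideSq x z u)) *
        betaWeight α u * ((1 / s) ^ β * Real.Gamma β)) (Set.Ioo 0 1) := by
      refine (integrableOn_mul_betaWeight hα ?_).mul_const _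
      have := continuous_sideSq x z
      fun_prop
    refine h1.congr ((MeasureTheory.ae_restrict_mem measurableSet_Ioo).mono fun u hu => ?_)
    have hw := betaWeight_pos α hu
    have e2 : ∀ τ : ℝ, ‖posPow (β - 1) (τ - sideSq x z u) * betaWeight α u *
        Real.exp (-(s * τ))‖ =
        betaWeight α u * (posPow (β - 1) (τ - sideSq x z u) * Real.exp (-(s * τ))) := by
      intro τ
      have := posPow_nonneg (β - 1) (τ - sideSq x z u)
      rw [Real.norm_of_nonneg (by positivity), e]
    simp only [e2]
    rw [MeasureTheory.integral_const_mul,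
      integral_posPow_sub_mul_exp hβ hs (sideSq_nonneg hx hz hu)]
    ring

lemma integrableOn_translate_mul_exp {α β s x z : ℝ} (hα : -(1 / 2) < α) (hβ : 0 < β)
    (hs : 0 < s) (hx : 0 < x) (hz : 0 < z) :
    MeasureTheory.IntegrableOn (fun τ => translate α β x z τ * Real.exp (-(s * τ)))
      (Set.Ioi 0) := by
  refine (integrable_translate_prod hα hβ hs hx hz).integral_prod_left.congr
    (Filter.Eventually.of_forall fun τ => ?_)
  simp only [translate]
  rw [← MeasureTheory.integral_mul_const]

/-- The Laplace transform of the translate, by Fubini and `integral_posPow_sub_mul_exp`. -/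
lemma integral_translate_mul_exp {α β s x z : ℝ} (hα : -(1 / 2) < α) (hβ : 0 < β)
    (hs : 0 < s) (hx : 0 < x) (hz : 0 < z) :
    ∫ τ in Set.Ioi (0 : ℝ), translate α β x z τ * Real.exp (-(s * τ)) =
      (1 / s) ^ β * Real.Gamma β *
        ∫ u in Set.Ioo (0 : ℝ) 1, Real.exp (-(s * sideSq x z u)) * betaWeight α u := by
  have h := MeasureTheory.integral_integral_swap
    (f := fun τ u => posPow (β - 1) (τ - sideSq x z u) * betaWeight α u * Real.exp (-(s * τ)))
    (integrable_translate_prod hα hβ hs hx hz)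
  simp only [translate]
  simp_rw [← MeasureTheory.integral_mul_const]
  rw [h, ← MeasureTheory.integral_const_mul]
  refine MeasureTheory.setIntegral_congr_fun measurableSet_Ioo fun u hu => ?_
  have e : ∀ τ : ℝ, posPow (β - 1) (τ - sideSq x z u) * betaWeight α u * Real.exp (-(s * τ)) =
      betaWeight α u * (posPow (β - 1) (τ - sideSq x z u) * Real.exp (-(s * τ))) :=
    fun τ => by ring
  simp only [e]
  rw [MeasureTheory.integral_const_mul,
    integral_posPow_sub_mul_exp hβ hs (sideSq_nonneg hx hz hu)]
  ring

/-- For `β > 1` the integrand `(τ - w²)₊^(β - 1)` is continuous, hence so is its translate. -/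
lemma continuous_translate {α β : ℝ} (hα : -(1 / 2) < α) (hβ : 1 < β) (x z : ℝ) :
    Continuous (translate α β x z) := by
  have hp := continuous_posPow (show 0 < β - 1 by linarith)
  have hs := continuous_sideSq x z
  refine continuous_iff_continuousAt.2 fun τ₀ => ?_
  obtain ⟨C, hC⟩ := ((isCompact_Icc (a := τ₀ - 1) (b := τ₀ + 1)).prod
    (isCompact_Icc (a := (0 : ℝ)) (b := 1))).exists_bound_of_continuousOn
    (f := fun q : ℝ × ℝ => posPow (β - 1) (q.1 - sideSq x z q.2))
    (Continuous.continuousOn (by fun_prop))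
  refine MeasureTheory.continuousAt_of_dominated (bound := fun u => C * betaWeight α u) ?_ ?_ ?_ ?_
  · refine Filter.Eventually.of_forall fun τ => Measurable.aestronglyMeasurable ?_
    exact (Continuous.measurable (by fun_prop)).mul (measurable_betaWeight α)
  · filter_upwards [Icc_mem_nhds (show τ₀ - 1 < τ₀ by linarith) (show τ₀ < τ₀ + 1 by linarith)]
      with τ hτ
    refine (MeasureTheory.ae_restrict_mem measurableSet_Ioo).mono fun u hu => ?_
    rw [norm_mul, Real.norm_of_nonneg (betaWeight_pos α hu).le]
    exact mul_le_mul_of_nonneg_right (hC (τ, u) ⟨hτ, hu.1.le, hu.2.le⟩) (betaWeight_pos α hu).le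
  · exact (integrableOn_betaWeight hα).const_mul C
  · refine Filter.Eventually.of_forall fun u => Continuous.continuousAt ?_
    fun_prop

/-! ### Absolute convergence for `β ≥ 1` -/

/-- The exponent `α / 2 + 3 / 4` lies in the range `(1/2, α + 1)` that makes the integral converge
at infinity and at the origin respectively, and `clifford ν` decays that fast once `ν ≥ α + 1`. -/
lemma integrableOn_besselPair_mul_rpow {α x z : ℝ} (hα : -(1 / 2) < α) (hx : 0 < x) (hz : 0 < z) :
    MeasureTheory.IntegrableOn
      (fun η => besselPair α x z η * η ^ (-(α / 2 + 3 / 4))) (Set.Ioi 0) := by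
  obtain ⟨C, hC, h⟩ := exists_clifford_decay hα
  have hcα := (continuous_clifford (show -1 < α by linarith)).measurable
  have hm : Measurable (fun η => besselPair α x z η * η ^ (-(α / 2 + 3 / 4))) := by
    unfold besselPair
    exact (((hcα.comp (measurable_const.mul measurable_id)).mul
      (hcα.comp (measurable_const.mul measurable_id))).mul (measurable_id.pow_const _)).mul
      (measurable_id.pow_const _)
  have key : ∀ s η : ℝ, 0 ≤ s → s ≤ α / 2 + 1 / 4 → 0 < η →
      ‖besselPair α x z η * η ^ (-(α / 2 + 3 / 4))‖ ≤
        (C * (x ^ 2) ^ (-s)) * (C * (z ^ 2) ^ (-s)) * η ^ (-s + -s + α + -(α / 2 + 3 / 4)) := by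
    intro s η hs hs' hη
    have b1 := h s (x ^ 2 * η) hs hs' (by positivity)
    have b2 := h s (z ^ 2 * η) hs hs' (by positivity)
    rw [Real.mul_rpow (by positivity) hη.le] at b1 b2
    unfold besselPair
    rw [norm_mul, norm_mul, norm_mul, Real.norm_eq_abs, Real.norm_eq_abs,
      Real.norm_of_nonneg (r := η ^ α) (by positivity), Real.norm_of_nonneg (by positivity)]
    calc _ ≤ (C * ((x ^ 2) ^ (-s) * η ^ (-s))) * (C * ((z ^ 2) ^ (-s) * η ^ (-s))) * η ^ α *
          η ^ (-(α / 2 + 3 / 4)) := by gcongr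
      _ = (C * (x ^ 2) ^ (-s)) * (C * (z ^ 2) ^ (-s)) *
          (η ^ (-s) * η ^ (-s) * η ^ α * η ^ (-(α / 2 + 3 / 4))) := by ring
      _ = _ := by rw [← Real.rpow_add hη, ← Real.rpow_add hη, ← Real.rpow_add hη]
  rw [← Set.Ioc_union_Ioi_eq_Ioi (zero_le_one' ℝ)]
  refine MeasureTheory.IntegrableOn.union ?_ ?_
  · have hi : MeasureTheory.IntegrableOn
        (fun η : ℝ => η ^ (-0 + -0 + α + -(α / 2 + 3 / 4))) (Set.Ioc 0 1) := by
      rw [← intervalIntegrable_iff_integrableOn_Ioc_of_le zero_le_one]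
      exact intervalIntegral.intervalIntegrable_rpow' (by linarith)
    refine MeasureTheory.Integrable.mono' (hi.const_mul _) hm.aestronglyMeasurable
      ((MeasureTheory.ae_restrict_mem measurableSet_Ioc).mono fun η hη =>
        key 0 η le_rfl (by linarith) hη.1)
  · refine MeasureTheory.Integrable.mono' ((integrableOn_Ioi_rpow_of_lt
      (a := -(α / 2 + 1 / 4) + -(α / 2 + 1 / 4) + α + -(α / 2 + 3 / 4)) (by linarith)
      one_pos).const_mul _) hm.aestronglyMeasurable
      ((MeasureTheory.ae_restrict_mem measurableSet_Ioi).mono fun η hη =>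
        key (α / 2 + 1 / 4) η (by linarith) le_rfl (zero_lt_one.trans hη))

lemma measurable_besselPair {α : ℝ} (hα : -1 < α) (x z : ℝ) : Measurable (besselPair α x z) := by
  have hcα := (continuous_clifford hα).measurable
  unfold besselPair
  exact ((hcα.comp (measurable_const.mul measurable_id)).mul
      (hcα.comp (measurable_const.mul measurable_id))).mul (measurable_id.pow_const _)

/-- For `β ≥ 1` the factor depending on `τ` decays fast enough to dominate the integrand by the
integrable function of `integrableOn_besselPair_mul_rpow`, locally uniformly in `τ`. -/
lemma exists_norm_clifford_mul_besselPair_le {α β : ℝ} (hα : -(1 / 2) < α) (hβ : 1 ≤ β) :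
    ∃ C : ℝ, 0 < C ∧ ∀ x z τ η : ℝ, 0 < τ → 0 < η →
      ‖clifford (α + β) (τ * η) * besselPair α x z η‖ ≤
        C * τ ^ (-(α / 2 + 3 / 4)) * ‖besselPair α x z η * η ^ (-(α / 2 + 3 / 4))‖ := by
  obtain ⟨C, hC, h⟩ := exists_clifford_decay (show -(1 / 2) < α + β by linarith)
  refine ⟨C, hC, fun x z τ η hτ hη => ?_⟩
  have b := h (α / 2 + 3 / 4) (τ * η) (by linarith) (by linarith) (by positivity)
  rw [Real.mul_rpow hτ.le hη.le] at b
  rw [norm_mul, norm_mul, Real.norm_of_nonneg (r := η ^ _) (by positivity), Real.norm_eq_abs]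
  calc _ ≤ C * (τ ^ (-(α / 2 + 3 / 4)) * η ^ (-(α / 2 + 3 / 4))) * ‖besselPair α x z η‖ := by
        gcongr
    _ = _ := by ring

lemma integrableOn_clifford_mul_besselPair {α β x z τ : ℝ} (hα : -(1 / 2) < α) (hβ : 1 ≤ β)
    (hx : 0 < x) (hz : 0 < z) (hτ : 0 < τ) :
    MeasureTheory.IntegrableOn (fun η => clifford (α + β) (τ * η) * besselPair α x z η)
      (Set.Ioi 0) := by
  obtain ⟨C, hC, h⟩ := exists_norm_clifford_mul_besselPair_le hα hβ
  have hc := continuous_clifford (show -1 < α + β by linarith)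
  refine MeasureTheory.Integrable.mono'
    ((integrableOn_besselPair_mul_rpow hα hx hz).norm.const_mul _)
    (((hc.measurable.comp (measurable_const.mul measurable_id)).mul
      (measurable_besselPair (by linarith) x z)).aestronglyMeasurable)
    ((MeasureTheory.ae_restrict_mem measurableSet_Ioi).mono fun η hη => h x z τ η hτ hη)

/-- The limit of the truncated integrals for `β ≥ 1`, where the integral converges absolutely. -/
noncomputable def fullIntegral (α β x z τ : ℝ) : ℝ :=
  τ ^ (α + β) * ∫ η in Set.Ioi (0 : ℝ), clifford (α + β) (τ * η) * besselPair α x z η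

lemma continuousOn_fullIntegral {α β x z : ℝ} (hα : -(1 / 2) < α) (hβ : 1 ≤ β)
    (hx : 0 < x) (hz : 0 < z) : ContinuousOn (fullIntegral α β x z) (Set.Ioi 0) := by
  obtain ⟨C, hC, h⟩ := exists_norm_clifford_mul_besselPair_le hα hβ
  have hc := continuous_clifford (show -1 < α + β by linarith)
  refine ContinuousOn.mul
    (continuousOn_id.rpow_const fun τ hτ => Or.inl (ne_of_gt hτ)) fun τ₀ hτ₀ => ?_
  have hτ₀' : 0 < τ₀ := hτ₀
  refine ContinuousAt.continuousWithinAt ?_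
  refine MeasureTheory.continuousAt_of_dominated (bound := fun η =>
    C * (τ₀ / 2) ^ (-(α / 2 + 3 / 4)) * ‖besselPair α x z η * η ^ (-(α / 2 + 3 / 4))‖) ?_ ?_ ?_ ?_
  · refine Filter.Eventually.of_forall fun τ => ?_
    exact ((hc.measurable.comp (measurable_const.mul measurable_id)).mul
      (measurable_besselPair (by linarith) x z)).aestronglyMeasurable
  · filter_upwards [Ioi_mem_nhds (show τ₀ / 2 < τ₀ by linarith)] with τ hτ
    have hτ' : τ₀ / 2 < τ := hτ
    refine (MeasureTheory.ae_restrict_mem measurableSet_Ioi).mono fun η hη => ?_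
    refine (h x z τ η (by linarith) hη).trans ?_
    have : τ ^ (-(α / 2 + 3 / 4)) ≤ (τ₀ / 2) ^ (-(α / 2 + 3 / 4)) :=
      Real.rpow_le_rpow_of_nonpos (by positivity) hτ'.le (by linarith)
    gcongr
  · exact (integrableOn_besselPair_mul_rpow hα hx hz).norm.const_mul _
  · exact Filter.Eventually.of_forall fun η => Continuous.continuousAt (by fun_prop)

lemma integrable_fullIntegral_prod {α β s x z : ℝ} (hα : -(1 / 2) < α) (hβ : 1 ≤ β)
    (hs : 0 < s) (hx : 0 < x) (hz : 0 < z) :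
    MeasureTheory.Integrable
      (fun q : ℝ × ℝ => clifford (α + β) (q.1 * q.2) * besselPair α x z q.2 *
        (q.1 ^ (α + β) * Real.exp (-(s * q.1))))
      ((MeasureTheory.volume.restrict (Set.Ioi (0 : ℝ))).prod
        (MeasureTheory.volume.restrict (Set.Ioi (0 : ℝ)))) := by
  obtain ⟨C, hC, h⟩ := exists_norm_clifford_mul_besselPair_le hα hβ
  have hc := continuous_clifford (show -1 < α + β by linarith)
  have hm : Measurable (fun q : ℝ × ℝ => clifford (α + β) (q.1 * q.2) * besselPair α x z q.2 *
        (q.1 ^ (α + β) * Real.exp (-(s * q.1)))) := by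
    refine Measurable.mul (Measurable.mul (Continuous.measurable (by fun_prop))
      ((measurable_besselPair (by linarith) x z).comp measurable_snd)) ?_
    exact (measurable_fst.pow_const _).mul (Continuous.measurable (by fun_prop))
  have hdom := ((integrableOn_rpow_mul_exp_neg
    (show -1 < α + β - (α / 2 + 3 / 4) by linarith) hs).const_mul C).mul_prod
    (integrableOn_besselPair_mul_rpow hα hx hz).norm
  refine MeasureTheory.Integrable.mono' hdom hm.aestronglyMeasurable ?_
  rw [MeasureTheory.Measure.prod_restrict]
  refine (MeasureTheory.ae_restrict_mem (measurableSet_Ioi.prod measurableSet_Ioi)).mono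
    fun q hq => ?_
  have h1 : 0 < q.1 := hq.1
  have h2 : 0 < q.2 := hq.2
  rw [norm_mul, Real.norm_of_nonneg (r := _ * Real.exp _) (by positivity), sub_eq_add_neg,
    Real.rpow_add h1 (α + β)]
  calc _ ≤ (C * q.1 ^ (-(α / 2 + 3 / 4)) *
        ‖besselPair α x z q.2 * q.2 ^ (-(α / 2 + 3 / 4))‖) *
        (q.1 ^ (α + β) * Real.exp (-(s * q.1))) := by
        gcongr
        exact h x z q.1 q.2 h1 h2
    _ = _ := by ring

lemma fullIntegral_mul_exp (α β s x z τ : ℝ) :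
    fullIntegral α β x z τ * Real.exp (-(s * τ)) =
      ∫ η in Set.Ioi (0 : ℝ), clifford (α + β) (τ * η) * besselPair α x z η *
        (τ ^ (α + β) * Real.exp (-(s * τ))) := by
  rw [MeasureTheory.integral_mul_const, fullIntegral]
  ring

/-- The Laplace transform of the full integral, by Weber's two exponential integrals and Poisson's
integral. -/
lemma integral_fullIntegral_mul_exp {α β s x z : ℝ} (hα : -(1 / 2) < α) (hβ : 1 ≤ β)
    (hs : 0 < s) (hx : 0 < x) (hz : 0 < z) :
    betaMass α * Real.Gamma (α + 1) *
      ∫ τ in Set.Ioi (0 : ℝ), fullIntegral α β x z τ * Real.exp (-(s * τ)) =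
      (1 / s) ^ β *
        ∫ u in Set.Ioo (0 : ℝ) 1, Real.exp (-(s * sideSq x z u)) * betaWeight α u := by
  simp_rw [fullIntegral_mul_exp]
  rw [MeasureTheory.integral_integral_swap (integrable_fullIntegral_prod hα hβ hs hx hz)]
  have e1 : ∀ η : ℝ, ∫ τ in Set.Ioi (0 : ℝ), clifford (α + β) (τ * η) * besselPair α x z η *
      (τ ^ (α + β) * Real.exp (-(s * τ))) = (1 / s) ^ (α + β + 1) *
        (clifford α (x ^ 2 * η) * clifford α (z ^ 2 * η) * η ^ α * Real.exp (-(1 / s * η))) := by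
    intro η
    have e : ∀ τ : ℝ, clifford (α + β) (τ * η) * besselPair α x z η *
        (τ ^ (α + β) * Real.exp (-(s * τ))) = besselPair α x z η *
        (clifford (α + β) (η * τ) * τ ^ (α + β) * Real.exp (-(s * τ))) := by
      intro τ; rw [mul_comm τ η]; ring
    simp_rw [e]
    rw [MeasureTheory.integral_const_mul,
      integral_rpow_mul_clifford_mul_exp (by linarith) hs, besselPair,
      show η / s = 1 / s * η by ring]
    ring
  simp_rw [e1]
  rw [MeasureTheory.integral_const_mul,
    integral_clifford_mul_clifford_mul_exp hα (by positivity) (by positivity)]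
  have e2 : clifford α (-(x ^ 2 * z ^ 2 / (1 / s) ^ 2)) =
      clifford α (-((2 * s * (x * z)) ^ 2 / 4)) := by
    congr 2
    field_simp
    ring
  have e3 : ∫ u in Set.Ioo (0 : ℝ) 1, Real.exp (-(s * sideSq x z u)) * betaWeight α u =
      Real.exp (-(s * (x ^ 2 + z ^ 2))) *
        ∫ u in Set.Ioo (0 : ℝ) 1, Real.exp (2 * s * (x * z) * (1 - 2 * u)) * betaWeight α u := by
    rw [← MeasureTheory.integral_const_mul]
    refine MeasureTheory.integral_congr_ae (Filter.Eventually.of_forall fun u => ?_)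
    simp only [sideSq]
    rw [← mul_assoc (Real.exp _), ← Real.exp_add]
    ring_nf
  have e4 : (1 / s) ^ (α + β + 1) * (1 / (1 / s)) ^ (α + 1) = (1 / s) ^ β := by
    rw [one_div_one_div, one_div, Real.inv_rpow hs.le, Real.inv_rpow hs.le,
      ← Real.rpow_neg hs.le, ← Real.rpow_neg hs.le, ← Real.rpow_add hs]
    ring_nf
  have e5 : -((x ^ 2 + z ^ 2) / (1 / s)) = -(s * (x ^ 2 + z ^ 2)) := by field_simp
  rw [e2, e3, integral_exp_mul_betaWeight hα, e5, ← e4]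
  ring

/-- For `β > 1` the kernel is a generalised translate: both sides are continuous in `τ` with the
same Laplace transform. Continuity of the translate at every `τ > 0` is what requires `β > 1`. -/
lemma fullIntegral_eq_translate {α β x z τ : ℝ} (hα : -(1 / 2) < α) (hβ : 1 < β)
    (hx : 0 < x) (hz : 0 < z) (hτ : 0 < τ) :
    Real.Gamma β * (betaMass α * Real.Gamma (α + 1)) * fullIntegral α β x z τ =
      translate α β x z τ := by
  refine eq_of_laplace_eq
    (f := fun τ => Real.Gamma β * (betaMass α * Real.Gamma (α + 1)) * fullIntegral α β x z τ)
    (continuousOn_const.mul (continuousOn_fullIntegral hα hβ.le hx hz))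
    (continuous_translate hα hβ x z).continuousOn (fun s hs => ?_)
    (fun s hs => integrableOn_translate_mul_exp hα (by linarith) hs hx hz) (fun s hs => ?_) hτ
  · simp_rw [mul_assoc, fullIntegral_mul_exp]
    exact (((integrable_fullIntegral_prod hα hβ.le hs hx hz).integral_prod_left).const_mul
      _).const_mul _ |>.const_mul _
  · simp_rw [mul_assoc (Real.Gamma β * _)]
    rw [MeasureTheory.integral_const_mul, mul_assoc,
      integral_fullIntegral_mul_exp hα hβ.le hs hx hz,
      integral_translate_mul_exp hα (by linarith) hs hx hz]
    ring

/-! ### Reduction to Euler's integral -/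

/-- Euler's integral `∫₀¹ u^(a-1) (1-u)^(b-1) (1-ρu)^(c-1) du`. -/
noncomputable def eulerIntegral (a b c ρ : ℝ) : ℝ :=
  ∫ u in Set.Ioo (0 : ℝ) 1, u ^ (a - 1) * (1 - u) ^ (b - 1) * (1 - ρ * u) ^ (c - 1)

lemma one_sub_mul_rpow_le {c e y : ℝ} (he : 0 < e) (hey : e ≤ y) (hy : y ≤ 1) :
    y ^ (c - 1) ≤ 1 + e ^ (c - 1) := by
  have hy0 : 0 < y := he.trans_le hey
  have h0 : 0 < e ^ (c - 1) := by positivity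
  rcases le_total 1 c with hc | hc
  · have := Real.rpow_le_one hy0.le hy (show 0 ≤ c - 1 by linarith)
    linarith
  · have := Real.rpow_le_rpow_of_nonpos he hey (show c - 1 ≤ 0 by linarith)
    linarith

lemma measurable_eulerIntegrand (a b c ρ : ℝ) :
    Measurable fun u : ℝ => u ^ (a - 1) * (1 - u) ^ (b - 1) * (1 - ρ * u) ^ (c - 1) :=
  ((measurable_id.pow_const _).mul ((measurable_const.sub measurable_id).pow_const _)).mul
    ((measurable_const.sub (measurable_const.mul measurable_id)).pow_const _)

/-- A bound uniform in `ρ ≤ ρ₁ < 1`, used both for integrability and for continuity in `ρ`. -/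
lemma norm_eulerIntegrand_le {a b c ρ ρ₁ u : ℝ} (hρ : 0 < ρ) (hρρ₁ : ρ ≤ ρ₁) (hρ₁ : ρ₁ < 1)
    (hu : u ∈ Set.Ioo (0 : ℝ) 1) :
    ‖u ^ (a - 1) * (1 - u) ^ (b - 1) * (1 - ρ * u) ^ (c - 1)‖ ≤
      u ^ (a - 1) * (1 - u) ^ (b - 1) * (1 + (1 - ρ₁) ^ (c - 1)) := by
  have h0 := hu.1
  have h1 : 0 < 1 - u := by linarith [hu.2]
  have h2 : 1 - ρ₁ ≤ 1 - ρ * u := by nlinarith [hu.2]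
  have h3 : 0 < 1 - ρ * u := by linarith
  rw [Real.norm_of_nonneg (by positivity)]
  gcongr
  exact one_sub_mul_rpow_le (by linarith) h2 (by nlinarith)

lemma integrableOn_eulerIntegrand {a b c ρ : ℝ} (ha : 0 < a) (hb : 0 < b)
    (hρ : ρ ∈ Set.Ioo (0 : ℝ) 1) :
    MeasureTheory.IntegrableOn
      (fun u : ℝ => u ^ (a - 1) * (1 - u) ^ (b - 1) * (1 - ρ * u) ^ (c - 1)) (Set.Ioo 0 1) :=
  MeasureTheory.Integrable.mono' ((integrableOn_beta ha hb).mul_const (1 + (1 - ρ) ^ (c - 1)))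
    (measurable_eulerIntegrand a b c ρ).aestronglyMeasurable
    ((MeasureTheory.ae_restrict_mem measurableSet_Ioo).mono fun _ hu =>
      norm_eulerIntegrand_le hρ.1 le_rfl hρ.2 hu)

lemma continuousOn_eulerIntegral {a b : ℝ} (c : ℝ) (ha : 0 < a) (hb : 0 < b) :
    ContinuousOn (eulerIntegral a b c) (Set.Ioo 0 1) := by
  intro ρ₀ hρ₀
  refine ContinuousAt.continuousWithinAt ?_
  obtain ⟨ρ₁, h1, h2⟩ := exists_between hρ₀.2
  refine MeasureTheory.continuousAt_of_dominated (bound := fun u =>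
    u ^ (a - 1) * (1 - u) ^ (b - 1) * (1 + (1 - ρ₁) ^ (c - 1))) ?_ ?_ ?_ ?_
  · exact Filter.Eventually.of_forall fun ρ =>
      (measurable_eulerIntegrand a b c ρ).aestronglyMeasurable
  · filter_upwards [Ioo_mem_nhds hρ₀.1 h1] with ρ hρ
    exact (MeasureTheory.ae_restrict_mem measurableSet_Ioo).mono fun u hu =>
      norm_eulerIntegrand_le hρ.1 hρ.2.le h2 hu
  · exact (integrableOn_beta ha hb).mul_const _
  · refine (MeasureTheory.ae_restrict_mem measurableSet_Ioo).mono fun u hu => ?_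
    refine ContinuousAt.mul continuousAt_const (ContinuousAt.rpow_const (by fun_prop) (Or.inl ?_))
    have : ρ₀ * u < 1 := by nlinarith [hu.1, hu.2, hρ₀.1, hρ₀.2]
    linarith

/-- For `t > x + z` the positive part is superfluous, and `ρ = 4xz / (t² - (x - z)²)`. -/
lemma translate_outer {α β x z τ : ℝ} (hx : 0 < x) (hz : 0 < z) (h : (x + z) ^ 2 < τ) :
    translate α β x z τ = (τ - (x - z) ^ 2) ^ (β - 1) *
      eulerIntegral (α + 1 / 2) (α + 1 / 2) β (4 * (x * z) / (τ - (x - z) ^ 2)) := by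
  have hG : 0 < x * z := by positivity
  have hD : 0 < τ - (x - z) ^ 2 := by nlinarith
  rw [translate, eulerIntegral, ← MeasureTheory.integral_const_mul]
  refine MeasureTheory.setIntegral_congr_fun measurableSet_Ioo fun u hu => ?_
  have h1 : 0 < τ - sideSq x z u := by
    unfold sideSq
    nlinarith [hu.2]
  have h2 : τ - sideSq x z u =
      (τ - (x - z) ^ 2) * (1 - 4 * (x * z) / (τ - (x - z) ^ 2) * u) := by
    unfold sideSq
    field_simp
    ring
  have h3 : 0 ≤ 1 - 4 * (x * z) / (τ - (x - z) ^ 2) * u := by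
    rw [h2] at h1
    exact (pos_of_mul_pos_right h1 hD.le).le
  rw [posPow_of_pos _ h1, h2, Real.mul_rpow hD.le h3, betaWeight_eq α hu]
  ring

/-- For `|x - z| < t < x + z` the integrand is supported on `u < l` with
`l = (t² - (x - z)²) / (4xz)`. Rescaling `u = l v` gives Euler's integral with `ρ = l`, in which the
exponents of `1 - u` and `1 - ρ u` are interchanged compared with `translate_outer`. -/
lemma translate_inner {α β x z τ : ℝ} (hx : 0 < x) (hz : 0 < z) (h1 : (x - z) ^ 2 < τ)
    (h2 : τ < (x + z) ^ 2) :
    translate α β x z τ =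
      (τ - (x - z) ^ 2) ^ (β - 1) * ((τ - (x - z) ^ 2) / (4 * (x * z))) ^ (α + 1 / 2) *
      eulerIntegral (α + 1 / 2) β (α + 1 / 2) ((τ - (x - z) ^ 2) / (4 * (x * z))) := by
  have hG : 0 < 4 * (x * z) := by positivity
  have hτ : ∀ u, τ - sideSq x z u = τ - (x - z) ^ 2 - 4 * (x * z) * u := by
    intro u; unfold sideSq; ring
  have hDG : τ - (x - z) ^ 2 < 4 * (x * z) := by nlinarith
  have hD : 0 < τ - (x - z) ^ 2 := by linarith
  rw [translate]
  simp_rw [hτ]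
  generalize τ - (x - z) ^ 2 = D at *
  generalize 4 * (x * z) = G at *
  set l : ℝ := D / G with hl_def
  have hl : 0 < l := by positivity
  have hl1 : l < 1 := (div_lt_one hG).2 hDG
  have hGl : G * l = D := by rw [hl_def]; field_simp
  set f : ℝ → ℝ := (Set.Ioo (0 : ℝ) 1).indicator
    fun u => posPow (β - 1) (D - G * u) * betaWeight α u with hf
  have e1 : ∫ u in Set.Ioo (0 : ℝ) 1, posPow (β - 1) (D - G * u) * betaWeight α u =
      l * ∫ v, f (l * v) := by
    rw [MeasureTheory.Measure.integral_comp_mul_left, abs_of_pos (inv_pos.2 hl), smul_eq_mul,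
      ← mul_assoc, mul_inv_cancel₀ hl.ne', one_mul, hf,
      MeasureTheory.integral_indicator measurableSet_Ioo]
  have e2 : ∀ v, f (l * v) = (Set.Ioo (0 : ℝ) 1).indicator (fun v =>
      D ^ (β - 1) * l ^ (α - 1 / 2) *
        (v ^ (α + 1 / 2 - 1) * (1 - v) ^ (β - 1) * (1 - l * v) ^ (α + 1 / 2 - 1))) v := by
    intro v
    have hDv : D - G * (l * v) = D * (1 - v) := by rw [← mul_assoc, hGl]; ring
    by_cases hv : v ∈ Set.Ioo (0 : ℝ) 1
    · have hlv : l * v ∈ Set.Ioo (0 : ℝ) 1 := by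
        have := hv.1
        exact ⟨by positivity, by nlinarith [hv.2]⟩
      have hv1 : 0 < 1 - v := by linarith [hv.2]
      rw [hf, Set.indicator_of_mem hlv, Set.indicator_of_mem hv, hDv,
        posPow_of_pos _ (by positivity), Real.mul_rpow hD.le hv1.le, betaWeight,
        Real.mul_rpow hlv.1.le (by linarith [hlv.2]), Real.mul_rpow hl.le hv.1.le,
        show α + 1 / 2 - 1 = α - 1 / 2 by ring]
      ring
    · rw [Set.indicator_of_notMem hv, hf]
      by_cases hlv : l * v ∈ Set.Ioo (0 : ℝ) 1
      · have hv0 : 0 < v := pos_of_mul_pos_right hlv.1 hl.le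
        have hv1 : 1 ≤ v := by
          by_contra! hlt
          exact hv ⟨hv0, hlt⟩
        rw [Set.indicator_of_mem hlv, hDv, posPow_of_nonpos, zero_mul]
        nlinarith
      · rw [Set.indicator_of_notMem hlv]
  have e3 : l * l ^ (α - 1 / 2) = l ^ (α + 1 / 2) := by
    rw [mul_comm, ← Real.rpow_add_one hl.ne']
    ring_nf
  rw [e1]
  simp_rw [e2]
  rw [MeasureTheory.integral_indicator measurableSet_Ioo, MeasureTheory.integral_const_mul,
    ← e3, eulerIntegral]
  ring

/-- The open set on which the kernel is defined, in the variable `τ = t²`. -/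
def regularSet (x z : ℝ) : Set ℝ := {τ | (x - z) ^ 2 < τ ∧ τ ≠ (x + z) ^ 2}

lemma isOpen_regularSet (x z : ℝ) : IsOpen (regularSet x z) :=
  (isOpen_lt continuous_const continuous_id).inter
    (isOpen_ne_fun continuous_id continuous_const)

/-- For small `β` the translate is singular at `τ = (x + z)²`; away from it, continuity is that of
Euler's integral in `ρ`. -/
lemma continuousOn_translate {α β x z : ℝ} (hα : -(1 / 2) < α) (hβ : 0 < β) (hx : 0 < x)
    (hz : 0 < z) : ContinuousOn (translate α β x z) (regularSet x z) := by
  rintro τ₀ ⟨h1, h2⟩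
  refine ContinuousAt.continuousWithinAt ?_
  have hG : 0 < x * z := by positivity
  have hD : 0 < τ₀ - (x - z) ^ 2 := by linarith
  rcases lt_or_gt_of_ne h2 with h | h
  · have hev : translate α β x z =ᶠ[𝓝 τ₀] fun τ =>
        (τ - (x - z) ^ 2) ^ (β - 1) * ((τ - (x - z) ^ 2) / (4 * (x * z))) ^ (α + 1 / 2) *
        eulerIntegral (α + 1 / 2) β (α + 1 / 2) ((τ - (x - z) ^ 2) / (4 * (x * z))) := by
      filter_upwards [Ioo_mem_nhds h1 h] with τ hτ using translate_inner hx hz hτ.1 hτ.2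
    refine ContinuousAt.congr ?_ hev.symm
    refine ContinuousAt.mul (ContinuousAt.mul ?_ ?_) ?_
    · exact ContinuousAt.rpow_const (by fun_prop) (Or.inl hD.ne')
    · exact ContinuousAt.rpow_const (by fun_prop) (Or.inr (by linarith))
    · refine ContinuousAt.comp (f := fun τ => (τ - (x - z) ^ 2) / (4 * (x * z)))
        (g := eulerIntegral (α + 1 / 2) β (α + 1 / 2)) ?_ (by fun_prop)
      refine (continuousOn_eulerIntegral _ (by linarith) hβ).continuousAt (Ioo_mem_nhds ?_ ?_)
      · positivity
      · rw [div_lt_one (by positivity)]; nlinarith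
  · have hev : translate α β x z =ᶠ[𝓝 τ₀] fun τ => (τ - (x - z) ^ 2) ^ (β - 1) *
        eulerIntegral (α + 1 / 2) (α + 1 / 2) β (4 * (x * z) / (τ - (x - z) ^ 2)) := by
      filter_upwards [Ioi_mem_nhds h] with τ hτ using translate_outer hx hz hτ
    refine ContinuousAt.congr ?_ hev.symm
    refine ContinuousAt.mul ?_ ?_
    · exact ContinuousAt.rpow_const (by fun_prop) (Or.inl hD.ne')
    · refine ContinuousAt.comp (f := fun τ => 4 * (x * z) / (τ - (x - z) ^ 2))
        (g := eulerIntegral (α + 1 / 2) (α + 1 / 2) β) ?_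
        (ContinuousAt.div continuousAt_const (by fun_prop) hD.ne')
      refine (continuousOn_eulerIntegral _ (by linarith) (by linarith)).continuousAt
        (Ioo_mem_nhds ?_ ?_)
      · positivity
      · rw [div_lt_one hD]; nlinarith

/-! ### Lowering `β` by differentiation in `τ` -/

lemma intervalIntegrable_posPow {β : ℝ} (hβ : 0 < β) (a b : ℝ) :
    IntervalIntegrable (posPow (β - 1)) MeasureTheory.volume a b := by
  have h := (integrable_posPow_mul_exp hβ one_pos).intervalIntegrable (a := a) (b := b)
  have := h.mul_continuousOn (g := fun τ => Real.exp (1 * τ))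
    (Continuous.continuousOn (by fun_prop))
  refine this.congr fun τ _ => ?_
  rw [mul_assoc, ← Real.exp_add]
  simp

lemma integral_posPow {β a : ℝ} (hβ : 0 < β) (ha : a ≤ 0) (b : ℝ) :
    ∫ τ in a..b, posPow (β - 1) τ = posPow β b / β := by
  have hneg : ∀ c d : ℝ, c ≤ 0 → d ≤ 0 → ∫ τ in c..d, posPow (β - 1) τ = 0 := by
    intro c d hc hd
    rw [intervalIntegral.integral_congr (g := fun _ => (0 : ℝ)), intervalIntegral.integral_zero]
    intro τ hτ
    exact posPow_of_nonpos _ (hτ.2.trans (max_le hc hd))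
  rcases le_or_gt b 0 with hb | hb
  · rw [hneg a b ha hb, posPow_of_nonpos _ hb, zero_div]
  · rw [← intervalIntegral.integral_add_adjacent_intervals (intervalIntegrable_posPow hβ a 0)
      (intervalIntegrable_posPow hβ 0 b), hneg a 0 ha le_rfl, zero_add, posPow_of_pos _ hb]
    have : ∫ τ in (0 : ℝ)..b, posPow (β - 1) τ = ∫ τ in (0 : ℝ)..b, τ ^ (β - 1) := by
      refine intervalIntegral.integral_congr_ae (Filter.Eventually.of_forall fun τ hτ => ?_)
      rw [Set.uIoc_of_le hb.le] at hτ
      exact posPow_of_pos _ hτ.1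
    rw [this, integral_rpow (Or.inl (by linarith)), sub_add_cancel, Real.zero_rpow hβ.ne', sub_zero]

/-- The exponential weight of `integrable_translate_prod` is harmless on bounded intervals. -/
lemma integrable_translate_prod_Ioc {α β x z : ℝ} (hα : -(1 / 2) < α) (hβ : 0 < β)
    (hx : 0 < x) (hz : 0 < z) (T : ℝ) :
    MeasureTheory.Integrable
      (fun q : ℝ × ℝ => posPow (β - 1) (q.1 - sideSq x z q.2) * betaWeight α q.2)
      ((MeasureTheory.volume.restrict (Set.Ioc 0 T)).prod
        (MeasureTheory.volume.restrict (Set.Ioo (0 : ℝ) 1))) := by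
  have h := integrable_translate_prod hα hβ one_pos hx hz
  rw [MeasureTheory.Measure.prod_restrict] at h ⊢
  have h' := MeasureTheory.IntegrableOn.mono_set h
    (Set.prod_mono_left (t := Set.Ioo (0 : ℝ) 1)
      (show Set.Ioc 0 T ⊆ Set.Ioi 0 from Set.Ioc_subset_Ioi_self))
  have h2 := MeasureTheory.Integrable.bdd_mul (f := fun q : ℝ × ℝ => Real.exp (1 * q.1))
    (c := Real.exp T) h' (Continuous.aestronglyMeasurable (by fun_prop))
    ((MeasureTheory.ae_restrict_mem (measurableSet_Ioc.prod measurableSet_Ioo)).mono fun q hq => by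
      rw [Real.norm_of_nonneg (Real.exp_pos _).le, one_mul]
      exact Real.exp_le_exp.2 hq.1.2)
  refine h2.congr (Filter.Eventually.of_forall fun q => ?_)
  simp only
  rw [mul_left_comm, ← Real.exp_add]
  simp

/-- Raising `β` by one is integration in `τ`, because `y₊^β = β ∫₀^y σ₊^(β - 1) dσ`. -/
lemma translate_add_one {α β x z τ : ℝ} (hα : -(1 / 2) < α) (hβ : 0 < β)
    (hx : 0 < x) (hz : 0 < z) (hτ : 0 < τ) :
    translate α (β + 1) x z τ = β * ∫ σ in (0 : ℝ)..τ, translate α β x z σ := by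
  rw [intervalIntegral.integral_of_le hτ.le]
  unfold translate
  rw [MeasureTheory.integral_integral_swap (integrable_translate_prod_Ioc hα hβ hx hz τ),
    ← MeasureTheory.integral_const_mul]
  refine MeasureTheory.setIntegral_congr_fun measurableSet_Ioo fun u hu => ?_
  rw [MeasureTheory.integral_mul_const, ← intervalIntegral.integral_of_le hτ.le,
    intervalIntegral.integral_comp_sub_right (posPow (β - 1)),
    integral_posPow hβ (by linarith [sideSq_nonneg hx hz hu]), add_sub_cancel_right]
  field_simp

lemma intervalIntegrable_translate {α β x z τ : ℝ} (hα : -(1 / 2) < α) (hβ : 0 < β)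
    (hx : 0 < x) (hz : 0 < z) (hτ : 0 < τ) :
    IntervalIntegrable (translate α β x z) MeasureTheory.volume 0 τ := by
  rw [intervalIntegrable_iff_integrableOn_Ioc_of_le hτ.le]
  exact (integrable_translate_prod_Ioc hα hβ hx hz τ).integral_prod_left

lemma hasDerivAt_translate_add_one {α β x z τ : ℝ} (hα : -(1 / 2) < α) (hβ : 0 < β)
    (hx : 0 < x) (hz : 0 < z) (hτ : τ ∈ regularSet x z) :
    HasDerivAt (translate α (β + 1) x z) (β * translate α β x z τ) τ := by
  have hτ0 : 0 < τ := lt_of_le_of_lt (sq_nonneg _) hτ.1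
  have hc := continuousOn_translate hα hβ hx hz
  have hU := isOpen_regularSet x z
  have h := (intervalIntegral.integral_hasDerivAt_right
    (intervalIntegrable_translate hα hβ hx hz hτ0)
    (hc.stronglyMeasurableAtFilter hU τ hτ) (hc.continuousAt (hU.mem_nhds hτ))).const_mul β
  refine h.congr_of_eventuallyEq ?_
  filter_upwards [Ioi_mem_nhds hτ0] with σ hσ using translate_add_one hα hβ hx hz hσ

/-! ### Convergence for all `β > 0` -/

/-- `τ^ν` times the truncated integral of `J_ν J_α J_α` in the variables `τ = t²`, `η = y² / 4` and
in the normalisation of `clifford`. -/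
noncomputable def truncIntegral (ν α x z R τ : ℝ) : ℝ :=
  τ ^ ν * ∫ η in (0 : ℝ)..R, clifford ν (τ * η) * besselPair α x z η

lemma intervalIntegrable_besselPair {α : ℝ} (hα : -1 < α) (x z a b : ℝ) :
    IntervalIntegrable (besselPair α x z) MeasureTheory.volume a b := by
  have hc := continuous_clifford hα
  exact (intervalIntegral.intervalIntegrable_rpow' hα).continuousOn_mul
    (Continuous.continuousOn (by fun_prop))

lemma intervalIntegrable_clifford_mul_besselPair {ν α : ℝ} (hν : -1 < ν) (hα : -1 < α)
    (τ x z a b : ℝ) :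
    IntervalIntegrable (fun η => clifford ν (τ * η) * besselPair α x z η)
      MeasureTheory.volume a b := by
  have hc := continuous_clifford hν
  exact (intervalIntegrable_besselPair hα x z a b).continuousOn_mul
    (Continuous.continuousOn (by fun_prop))

/-- Lowering the order by one is differentiation in `τ`, by `hasDerivAt_rpow_mul_clifford`. -/
lemma hasDerivAt_truncIntegral {ν α : ℝ} (hν : -1 < ν) (hα : -1 < α) (x z R : ℝ) {τ : ℝ}
    (hτ : 0 < τ) :
    HasDerivAt (truncIntegral (ν + 1) α x z R) (truncIntegral ν α x z R τ) τ := by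
  have hc := continuous_clifford hν
  have hc1 := continuous_clifford (show -1 < ν + 1 by linarith)
  set F : ℝ → ℝ → ℝ := fun τ η =>
    τ ^ (ν + 1) * clifford (ν + 1) (τ * η) * besselPair α x z η
  set F' : ℝ → ℝ → ℝ := fun τ η => τ ^ ν * clifford ν (τ * η) * besselPair α x z η
  obtain ⟨C, hC⟩ := ((isCompact_Icc (a := τ / 2) (b := 2 * τ)).prod
    (isCompact_uIcc (a := (0 : ℝ)) (b := R))).exists_bound_of_continuousOn
    (f := fun q : ℝ × ℝ => q.1 ^ ν * clifford ν (q.1 * q.2))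
    (ContinuousOn.mul (continuousOn_fst.rpow_const fun q hq =>
      Or.inl (lt_of_lt_of_le (half_pos hτ) hq.1.1).ne') (Continuous.continuousOn (by fun_prop)))
  have hm : ∀ σ, MeasureTheory.AEStronglyMeasurable (F σ)
      (MeasureTheory.volume.restrict (Set.uIoc 0 R)) := fun σ =>
    ((Continuous.measurable (by fun_prop)).mul
      (measurable_besselPair hα x z)).aestronglyMeasurable
  have h := (intervalIntegral.hasDerivAt_integral_of_dominated_loc_of_deriv_le
    (μ := MeasureTheory.volume) (F := F) (F' := F') (x₀ := τ) (a := 0) (b := R)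
    (s := Set.Icc (τ / 2) (2 * τ)) (bound := fun η => C * ‖besselPair α x z η‖)
    (Icc_mem_nhds (by linarith) (by linarith))
    (Filter.Eventually.of_forall hm)
    ((intervalIntegrable_besselPair hα x z 0 R).continuousOn_mul
      (Continuous.continuousOn (by fun_prop)))
    (((Continuous.measurable (by fun_prop)).mul
      (measurable_besselPair hα x z)).aestronglyMeasurable)
    (Filter.Eventually.of_forall fun η hη σ hσ => by
      simp only [F']
      rw [norm_mul]
      exact mul_le_mul_of_nonneg_right (hC (σ, η) ⟨hσ, Set.uIoc_subset_uIcc hη⟩) (norm_nonneg _))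
    ((intervalIntegrable_besselPair hα x z 0 R).norm.const_mul C)
    (Filter.Eventually.of_forall fun η _ σ hσ =>
      (hasDerivAt_rpow_mul_clifford hν η (lt_of_lt_of_le (half_pos hτ) hσ.1)).mul_const _)).2
  have e : ∀ (μ σ : ℝ), truncIntegral μ α x z R σ =
      ∫ η in (0 : ℝ)..R, σ ^ μ * clifford μ (σ * η) * besselPair α x z η := by
    intro μ σ
    simp_rw [truncIntegral, mul_assoc]
    rw [intervalIntegral.integral_const_mul]
  have e1 : truncIntegral (ν + 1) α x z R = fun σ => ∫ η in (0 : ℝ)..R, F σ η :=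
    funext fun σ => e _ σ
  rw [e1, e ν τ]
  exact h

lemma tendsto_truncIntegral_of_one_le {α β x z τ : ℝ} (hα : -(1 / 2) < α) (hβ : 1 ≤ β)
    (hx : 0 < x) (hz : 0 < z) (hτ : 0 < τ) :
    Tendsto (fun R => truncIntegral (α + β) α x z R τ) atTop (𝓝 (fullIntegral α β x z τ)) :=
  (MeasureTheory.intervalIntegral_tendsto_integral_Ioi 0
    (integrableOn_clifford_mul_besselPair hα hβ hx hz hτ) tendsto_id).const_mul _

/-- On the regular set none of the frequencies `t ± x ± z` vanishes. -/
lemma sqrt_frequencies_ne_zero {x z τ : ℝ} (hx : 0 < x) (hz : 0 < z)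
    (hτ : τ ∈ regularSet x z) :
    0 < Real.sqrt τ ∧ Real.sqrt τ + x + z ≠ 0 ∧ Real.sqrt τ + x - z ≠ 0 ∧
      Real.sqrt τ - x + z ≠ 0 ∧ Real.sqrt τ - x - z ≠ 0 := by
  have hτ0 : 0 < τ := lt_of_le_of_lt (sq_nonneg _) hτ.1
  have hs : 0 < Real.sqrt τ := Real.sqrt_pos.2 hτ0
  have hsq : Real.sqrt τ ^ 2 = τ := Real.sq_sqrt hτ0.le
  obtain ⟨h1, h2⟩ := hτ
  refine ⟨hs, by positivity, fun h => ?_, fun h => ?_, fun h => ?_⟩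
  · have : Real.sqrt τ = -(x - z) := by linarith
    rw [this] at hsq; nlinarith
  · have : Real.sqrt τ = x - z := by linarith
    rw [this] at hsq; linarith
  · have : Real.sqrt τ = x + z := by linarith
    rw [this] at hsq; exact h2 hsq.symm

lemma continuousOn_tailFactor {ν α x z : ℝ} (hx : 0 < x) (hz : 0 < z) :
    ContinuousOn (fun τ => τ ^ ν * tailFactor ν α (Real.sqrt τ) x z) (regularSet x z) := by
  intro τ hτ
  refine ContinuousAt.continuousWithinAt ?_
  have hτ0 : 0 < τ := lt_of_le_of_lt (sq_nonneg _) hτ.1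
  obtain ⟨h0, h1, h2, h3, h4⟩ := sqrt_frequencies_ne_zero hx hz hτ
  have hr : ContinuousAt (fun τ => Real.sqrt τ ^ (-(ν + 1 / 2))) τ :=
    ContinuousAt.rpow_const (by fun_prop) (Or.inl h0.ne')
  have hr' : ContinuousAt (fun τ : ℝ => τ ^ ν) τ :=
    ContinuousAt.rpow_const (by fun_prop) (Or.inl hτ0.ne')
  have a1 := abs_ne_zero.2 h1
  have a2 := abs_ne_zero.2 h2
  have a3 := abs_ne_zero.2 h3
  have a4 := abs_ne_zero.2 h4
  have h0' := h0.ne'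
  unfold tailFactor
  refine hr'.mul (((hr.mul continuousAt_const).mul continuousAt_const).mul ?_)
  fun_prop (disch := assumption)

/-- `exists_abs_integral_reducedIntegrand_le` in the variable `τ = t²`. -/
lemma exists_abs_truncIntegral_sub_le {ν α : ℝ} (hν : -(1 / 2) < ν) (hα : -(1 / 2) < α)
    {x z : ℝ} (hx : 0 < x) (hz : 0 < z) :
    ∃ C : ℝ, 0 < C ∧ ∀ τ ∈ regularSet x z, ∀ A B : ℝ, 0 < A → A ≤ B →
      |truncIntegral ν α x z B τ - truncIntegral ν α x z A τ| ≤
        C * (τ ^ ν * tailFactor ν α (Real.sqrt τ) x z) * A ^ (-(ν / 2 + 1 / 4)) := by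
  obtain ⟨C, hC, h⟩ := exists_abs_integral_reducedIntegrand_le hν hα
  refine ⟨C, hC, fun τ hτ A B hA hAB => ?_⟩
  have hτ0 : 0 < τ := lt_of_le_of_lt (sq_nonneg _) hτ.1
  obtain ⟨h0, -, h2, h3, h4⟩ := sqrt_frequencies_ne_zero hx hz hτ
  have b := h (Real.sqrt τ) x z h0 hx hz h2 h3 h4 A B hA hAB
  unfold reducedIntegrand at b
  rw [Real.sq_sqrt hτ0.le] at b
  have hI := intervalIntegrable_clifford_mul_besselPair (show -1 < ν by linarith)
    (show -1 < α by linarith) τ x z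
  unfold truncIntegral
  rw [← mul_sub, intervalIntegral.integral_interval_sub_left (hI 0 B) (hI 0 A), abs_mul,
    abs_of_pos (Real.rpow_pos_of_pos hτ0 ν)]
  calc _ ≤ τ ^ ν * (C * tailFactor ν α (Real.sqrt τ) x z * A ^ (-(ν / 2 + 1 / 4))) := by gcongr
    _ = _ := by ring

/-- The truncated integrals converge locally uniformly off the singular set. -/
lemma exists_tendstoLocallyUniformlyOn_truncIntegral {ν α : ℝ} (hν : -(1 / 2) < ν)
    (hα : -(1 / 2) < α) {x z : ℝ} (hx : 0 < x) (hz : 0 < z) :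
    ∃ n : ℝ → ℝ,
      TendstoLocallyUniformlyOn (truncIntegral ν α x z) n atTop (regularSet x z) := by
  obtain ⟨C, hC, h⟩ := exists_abs_truncIntegral_sub_le hν hα hx hz
  set b : ℝ → ℝ := fun τ => C * (τ ^ ν * tailFactor ν α (Real.sqrt τ) x z) with hb_def
  have hb : ContinuousOn b (regularSet x z) :=
    continuousOn_const.mul (continuousOn_tailFactor hx hz)
  have hp : 0 < ν / 2 + 1 / 4 := by linarith
  have hdecay : ∀ M : ℝ, Tendsto (fun A : ℝ => M * A ^ (-(ν / 2 + 1 / 4))) atTop (𝓝 0) := by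
    intro M
    have := (tendsto_rpow_neg_atTop hp).const_mul M
    rwa [mul_zero] at this
  have hlim : ∀ τ ∈ regularSet x z,
      ∃ L, Tendsto (fun R => truncIntegral ν α x z R τ) atTop (𝓝 L) := by
    intro τ hτ
    refine cauchySeq_tendsto_of_complete (Metric.cauchySeq_iff'.2 fun ε hε => ?_)
    obtain ⟨N, hN⟩ := eventually_atTop.1
      (((hdecay (b τ)).eventually (gt_mem_nhds hε)).and (eventually_gt_atTop 0))
    refine ⟨N, fun n hn => ?_⟩
    rw [Real.dist_eq]
    exact (h τ hτ N n (hN N le_rfl).2 hn).trans_lt (hN N le_rfl).1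
  choose! n hn using hlim
  refine ⟨n, Metric.tendstoLocallyUniformlyOn_iff.2 fun ε hε τ₀ hτ₀ => ?_⟩
  refine ⟨{τ | b τ < b τ₀ + 1} ∩ regularSet x z, ?_, ?_⟩
  · have h1 := (hb τ₀ hτ₀).eventually (gt_mem_nhds (show b τ₀ < b τ₀ + 1 by linarith))
    exact Filter.inter_mem h1 self_mem_nhdsWithin
  · filter_upwards [(hdecay (b τ₀ + 1)).eventually (gt_mem_nhds hε), eventually_gt_atTop 0]
      with R hR hR0 τ hτ
    have hle : |n τ - truncIntegral ν α x z R τ| ≤ b τ * R ^ (-(ν / 2 + 1 / 4)) := by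
      refine le_of_tendsto ((hn τ hτ.2).sub_const _).abs ?_
      filter_upwards [eventually_ge_atTop R] with B hB using h τ hτ.2 R B hR0 hB
    rw [Real.dist_eq]
    refine hle.trans_lt (lt_of_le_of_lt ?_ hR)
    have : b τ < b τ₀ + 1 := hτ.1
    gcongr

/-- The truncated integrals converge to a positive multiple of the generalised translate. For
`β + 1` this is the absolutely convergent case; both sides for `β` are its derivative in `τ`. -/
lemma tendsto_truncIntegral {α β x z τ : ℝ} (hα : -(1 / 2) < α) (hβ : 0 < β)
    (hx : 0 < x) (hz : 0 < z) (hτ : τ ∈ regularSet x z) :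
    Tendsto (fun R => truncIntegral (α + β) α x z R τ) atTop
      (𝓝 (translate α β x z τ / (Real.Gamma β * (betaMass α * Real.Gamma (α + 1))))) := by
  obtain ⟨n, hn⟩ := exists_tendstoLocallyUniformlyOn_truncIntegral
    (show -(1 / 2) < α + β by linarith) hα hx hz
  have hpos : ∀ σ ∈ regularSet x z, 0 < σ := fun σ hσ => lt_of_le_of_lt (sq_nonneg _) hσ.1
  have hU := isOpen_regularSet x z
  have hd : HasDerivAt (fullIntegral α (β + 1) x z) (n τ) τ := by
    refine hasDerivAt_of_tendstoLocallyUniformlyOn hU hn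
      (Filter.Eventually.of_forall fun R σ hσ => hasDerivAt_truncIntegral (ν := α + β)
        (by linarith) (by linarith) x z R (hpos σ hσ)) (fun σ hσ => ?_) hτ
    have := tendsto_truncIntegral_of_one_le hα (show 1 ≤ β + 1 by linarith) hx hz (hpos σ hσ)
    rwa [← add_assoc] at this
  have hK : 0 < betaMass α * Real.Gamma (α + 1) :=
    mul_pos (betaMass_pos hα) (Real.Gamma_pos_of_pos (by linarith))
  have hG := Real.Gamma_pos_of_pos hβ
  have hG1 : Real.Gamma (β + 1) = β * Real.Gamma β := Real.Gamma_add_one hβ.ne'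
  have hd' : HasDerivAt (fullIntegral α (β + 1) x z)
      (β * translate α β x z τ / (Real.Gamma (β + 1) * (betaMass α * Real.Gamma (α + 1)))) τ := by
    refine ((hasDerivAt_translate_add_one hα hβ hx hz hτ).div_const _).congr_of_eventuallyEq ?_
    filter_upwards [Ioi_mem_nhds (hpos τ hτ)] with σ hσ
    rw [← fullIntegral_eq_translate hα (show 1 < β + 1 by linarith) hx hz hσ, hG1]
    generalize betaMass α * Real.Gamma (α + 1) = K at hK
    field_simp
  -- two derivatives of the same function, so the limit `n` is determined
  have e : n τ = translate α β x z τ / (Real.Gamma β * (betaMass α * Real.Gamma (α + 1))) := by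
    rw [hd.unique hd', hG1]
    field_simp
  rw [← e]
  exact hn.tendsto_at hτ

/-! ### Two-sided estimates for Euler's integral -/

lemma rpow_le_of_comparable {s m y : ℝ} (hm : 0 < m) (h1 : m / 2 ≤ y) (h2 : y ≤ 2 * m) :
    y ^ s ≤ (2 ^ s + (1 / 2) ^ s) * m ^ s := by
  have hy : 0 < y := by linarith
  rw [add_mul, ← Real.mul_rpow (by norm_num) hm.le, ← Real.mul_rpow (by norm_num) hm.le]
  rcases le_total 0 s with hs | hs
  · have : y ^ s ≤ (2 * m) ^ s := Real.rpow_le_rpow hy.le h2 hs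
    have : 0 ≤ (1 / 2 * m) ^ s := by positivity
    linarith
  · have : y ^ s ≤ (1 / 2 * m) ^ s :=
      Real.rpow_le_rpow_of_nonpos (by positivity) (by linarith) hs
    have : 0 ≤ (2 * m) ^ s := by positivity
    linarith

lemma le_rpow_of_comparable {s m y : ℝ} (hm : 0 < m) (h1 : m / 2 ≤ y) (h2 : y ≤ 2 * m) :
    min (2 ^ s) ((1 / 2) ^ s) * m ^ s ≤ y ^ s := by
  have hy : 0 < y := by linarith
  have hms : 0 ≤ m ^ s := by positivity
  rcases le_total 0 s with hs | hs
  · calc _ ≤ (1 / 2) ^ s * m ^ s := mul_le_mul_of_nonneg_right (min_le_right _ _) hms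
      _ = (1 / 2 * m) ^ s := (Real.mul_rpow (by norm_num) hm.le).symm
      _ ≤ y ^ s := Real.rpow_le_rpow (by positivity) (by linarith) hs
  · calc _ ≤ 2 ^ s * m ^ s := mul_le_mul_of_nonneg_right (min_le_left _ _) hms
      _ = (2 * m) ^ s := (Real.mul_rpow (by norm_num) hm.le).symm
      _ ≤ y ^ s := Real.rpow_le_rpow_of_nonpos hy h2 hs

/-- The singular part of Euler's integrand near `u = 1`, in the variable `w = 1 - u` and with
`e = 1 - ρ`: here `1 - ρ u = e + w - e w` is comparable to `max e w`. -/
noncomputable def eulerModel (b c e w : ℝ) : ℝ := w ^ (b - 1) * max e w ^ (c - 1)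

lemma intervalIntegrable_eulerModel {b e : ℝ} (c : ℝ) (hb : 0 < b) (he : 0 < e) (A B : ℝ) :
    IntervalIntegrable (eulerModel b c e) MeasureTheory.volume A B := by
  refine (intervalIntegral.intervalIntegrable_rpow' (by linarith)).mul_continuousOn
    (Continuous.continuousOn ?_)
  exact Continuous.rpow_const (by fun_prop) fun w => Or.inl (lt_max_of_lt_left he).ne'

lemma integral_eulerModel {b c e : ℝ} (hb : 0 < b) (he : 0 < e) (he1 : e < 1) :
    ∫ w in (0 : ℝ)..1, eulerModel b c e w =
      e ^ (b + c - 1) / b + ∫ w in e..1, w ^ (b + c - 1 - 1) := by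
  have hI := intervalIntegrable_eulerModel c hb he
  rw [← intervalIntegral.integral_add_adjacent_intervals (hI 0 e) (hI e 1)]
  congr 1
  · have : ∫ w in (0 : ℝ)..e, eulerModel b c e w =
        ∫ w in (0 : ℝ)..e, w ^ (b - 1) * e ^ (c - 1) := by
      refine intervalIntegral.integral_congr fun w hw => ?_
      rw [Set.uIcc_of_le he.le] at hw
      simp only [eulerModel]
      rw [max_eq_left hw.2]
    rw [this, intervalIntegral.integral_mul_const, integral_rpow (Or.inl (by linarith)),
      sub_add_cancel, Real.zero_rpow hb.ne', sub_zero, show b + c - 1 = b + (c - 1) by ring,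
      Real.rpow_add he]
    ring
  · refine intervalIntegral.integral_congr fun w hw => ?_
    rw [Set.uIcc_of_le he1.le] at hw
    have hw0 : 0 < w := he.trans_le hw.1
    simp only [eulerModel]
    rw [max_eq_right hw.1, ← Real.rpow_add hw0]
    ring_nf

/-- The growth of Euler's integral as `e = 1 - ρ` tends to `0`, with `p = b + c - 1`. -/
noncomputable def growth (p e : ℝ) : ℝ :=
  if p < 0 then e ^ p else if p = 0 then 1 + Real.log (1 / e) else 1

lemma one_le_growth (p : ℝ) {e : ℝ} (he : 0 < e) (he1 : e < 1) : 1 ≤ growth p e := by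
  unfold growth
  split_ifs with h h'
  · exact Real.one_le_rpow_of_pos_of_le_one_of_nonpos he he1.le h.le
  · have : 0 ≤ Real.log (1 / e) := Real.log_nonneg (by rw [le_div_iff₀ he]; linarith)
    linarith
  · exact le_rfl

/-- `growth` is exactly the size of `e^p / b + ∫_e^1 w^(p - 1) dw` in the three cases `p < 0`,
`p = 0`, `p > 0`. -/
lemma exists_integral_eulerModel_bounds {b : ℝ} (c : ℝ) (hb : 0 < b) :
    ∃ k K : ℝ, 0 < k ∧ 0 < K ∧ ∀ e : ℝ, 0 < e → e < 1 →
      k * growth (b + c - 1) e ≤ ∫ w in (0 : ℝ)..1, eulerModel b c e w ∧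
      ∫ w in (0 : ℝ)..1, eulerModel b c e w ≤ K * growth (b + c - 1) e := by
  have hval := fun (e : ℝ) (he : 0 < e) (he1 : e < 1) => integral_eulerModel (c := c) hb he he1
  generalize b + c - 1 = p at hval ⊢
  have h0 : ∀ e : ℝ, 0 < e → e < 1 → (0 : ℝ) ∉ Set.uIcc e 1 := by
    intro e he he1
    rw [Set.uIcc_of_le he1.le]
    exact fun h => absurd h.1 (not_le.2 he)
  have hint : p ≠ 0 → ∀ e : ℝ, 0 < e → e < 1 →
      ∫ w in e..1, w ^ (p - 1) = (1 - e ^ p) / p := by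
    intro hp e he he1
    rw [integral_rpow (Or.inr ⟨fun h => hp (by linarith), h0 e he he1⟩), sub_add_cancel,
      Real.one_rpow]
  have hb' : 0 < 1 / b := by positivity
  rcases lt_trichotomy p 0 with hp | hp | hp
  · have hp' : 0 < 1 / (-p) := by
      have : 0 < -p := by linarith
      positivity
    refine ⟨1 / b, 1 / b + 1 / (-p), hb', by positivity, fun e he he1 => ?_⟩
    have hep : 1 ≤ e ^ p := Real.one_le_rpow_of_pos_of_le_one_of_nonpos he he1.le hp.le
    rw [hval e he he1, hint hp.ne e he he1, growth, if_pos hp]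
    have e1 : (1 - e ^ p) / p = 1 / (-p) * (e ^ p - 1) := by
      have := hp.ne
      field_simp
      ring
    rw [e1]
    constructor
    · have : 0 ≤ 1 / (-p) * (e ^ p - 1) := mul_nonneg hp'.le (by linarith)
      have e2 : e ^ p / b = 1 / b * e ^ p := by ring
      linarith
    · have e2 : e ^ p / b = 1 / b * e ^ p := by ring
      nlinarith
  · refine ⟨min (1 / b) 1, 1 / b + 1, lt_min hb' one_pos, by positivity, fun e he he1 => ?_⟩
    have hl : 0 ≤ Real.log (1 / e) := Real.log_nonneg (by rw [le_div_iff₀ he]; linarith)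
    have hi : ∫ w in e..1, w ^ (p - 1) = Real.log (1 / e) := by
      rw [← integral_inv (h0 e he he1), hp]
      refine intervalIntegral.integral_congr fun w _ => ?_
      simp only [zero_sub]
      exact Real.rpow_neg_one w
    rw [hval e he he1, hi, growth, if_neg (by linarith), if_pos hp, hp, Real.rpow_zero]
    constructor
    · nlinarith [min_le_left (1 / b) 1, min_le_right (1 / b) 1]
    · nlinarith
  · have hp' : 0 < 1 / p := by positivity
    refine ⟨min (1 / b) (1 / p), 1 / b + 1 / p, lt_min hb' hp', by positivity, fun e he he1 => ?_⟩
    have hep : e ^ p ≤ 1 := Real.rpow_le_one he.le he1.le hp.le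
    have hep0 : 0 ≤ e ^ p := by positivity
    rw [hval e he he1, hint hp.ne' e he he1, growth, if_neg (by linarith), if_neg hp.ne',
      mul_one, mul_one, show e ^ p / b + (1 - e ^ p) / p =
        e ^ p * (1 / b) + (1 - e ^ p) * (1 / p) by ring]
    constructor
    · nlinarith [min_le_left (1 / b) (1 / p), min_le_right (1 / b) (1 / p)]
    · nlinarith

lemma eulerIntegral_eq_intervalIntegral (a b c ρ : ℝ) :
    eulerIntegral a b c ρ =
      ∫ u in (0 : ℝ)..1, u ^ (a - 1) * (1 - u) ^ (b - 1) * (1 - ρ * u) ^ (c - 1) := by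
  rw [intervalIntegral.integral_of_le zero_le_one, MeasureTheory.integral_Ioc_eq_integral_Ioo,
    eulerIntegral]

/-- On `u ≤ 1/2` only the singularity at `0` matters, on `u ≥ 1/2` only the one described by
`eulerModel`. -/
lemma exists_eulerIntegral_le {a b : ℝ} (c : ℝ) (ha : 0 < a) (hb : 0 < b) :
    ∃ K₁ K₂ : ℝ, 0 < K₁ ∧ 0 < K₂ ∧ ∀ ρ ∈ Set.Ioo (0 : ℝ) 1,
      eulerIntegral a b c ρ ≤ K₁ + K₂ * ∫ w in (0 : ℝ)..1, eulerModel b c (1 - ρ) w := by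
  set M₁ : ℝ := (1 + (1 / 2) ^ (b - 1)) * (1 + (1 / 2) ^ (c - 1))
  set M₂ : ℝ := (1 + (1 / 2) ^ (a - 1)) * (2 ^ (c - 1) + (1 / 2) ^ (c - 1))
  have hM₁ : 0 < M₁ := by positivity
  have hM₂ : 0 < M₂ := by positivity
  refine ⟨M₁ * (1 / a), M₂, by positivity, hM₂, fun ρ hρ => ?_⟩
  have he : 0 < 1 - ρ := by linarith [hρ.2]
  have hIe := (intervalIntegrable_eulerModel c hb he 0 1).comp_sub_left 1
  simp only [sub_zero, sub_self] at hIe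
  have hIa : IntervalIntegrable (fun u : ℝ => u ^ (a - 1)) MeasureTheory.volume 0 1 :=
    intervalIntegral.intervalIntegrable_rpow' (by linarith)
  have h1 : ∫ u in (0 : ℝ)..1, (M₁ * u ^ (a - 1) + M₂ * eulerModel b c (1 - ρ) (1 - u)) =
      M₁ * (1 / a) + M₂ * ∫ w in (0 : ℝ)..1, eulerModel b c (1 - ρ) w := by
    rw [intervalIntegral.integral_add (hIa.const_mul _) (hIe.symm.const_mul _),
      intervalIntegral.integral_const_mul, intervalIntegral.integral_const_mul,
      intervalIntegral.integral_comp_sub_left (eulerModel b c (1 - ρ)),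
      integral_rpow (Or.inl (by linarith)), sub_add_cancel, Real.zero_rpow ha.ne', Real.one_rpow]
    norm_num
  rw [← h1, intervalIntegral.integral_of_le zero_le_one,
    MeasureTheory.integral_Ioc_eq_integral_Ioo, eulerIntegral]
  refine MeasureTheory.setIntegral_mono_on (integrableOn_eulerIntegrand ha hb hρ) ?_
    measurableSet_Ioo fun u hu => ?_
  · exact (intervalIntegrable_iff_integrableOn_Ioo_of_le zero_le_one).1
      ((hIa.const_mul _).add (hIe.symm.const_mul _))
  have hu0 := hu.1
  have hw : 0 < 1 - u := by linarith [hu.2]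
  have hρu : 1 - ρ * u = (1 - ρ) + (1 - u) - (1 - ρ) * (1 - u) := by ring
  have hle1 : (1 - ρ) * (1 - u) ≤ 1 - u := by nlinarith [hρ.1]
  have hle2 : (1 - ρ) * (1 - u) ≤ 1 - ρ := by nlinarith
  have hle0 : 0 < (1 - ρ) * (1 - u) := by positivity
  have hy0 : 0 < 1 - ρ * u := by linarith
  have hm : 0 < eulerModel b c (1 - ρ) (1 - u) := by
    have : 0 < max (1 - ρ) (1 - u) := lt_max_of_lt_left he
    unfold eulerModel
    positivity
  have hua : 0 < u ^ (a - 1) := by positivity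
  rcases le_total u (1 / 2) with hu2 | hu2
  · have b1 : (1 - u) ^ (b - 1) ≤ 1 + (1 / 2) ^ (b - 1) :=
      one_sub_mul_rpow_le (by norm_num) (by linarith) (by linarith)
    have b2 : (1 - ρ * u) ^ (c - 1) ≤ 1 + (1 / 2) ^ (c - 1) :=
      one_sub_mul_rpow_le (by norm_num) (by nlinarith [hρ.1, hρ.2]) (by nlinarith [hρ.1])
    calc _ ≤ u ^ (a - 1) * (1 + (1 / 2) ^ (b - 1)) * (1 + (1 / 2) ^ (c - 1)) := by gcongr
      _ = M₁ * u ^ (a - 1) := by ring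
      _ ≤ _ := by
        have := mul_pos hM₂ hm
        linarith
  · have b1 : u ^ (a - 1) ≤ 1 + (1 / 2) ^ (a - 1) :=
      one_sub_mul_rpow_le (by norm_num) hu2 hu.2.le
    have b2 : (1 - ρ * u) ^ (c - 1) ≤
        (2 ^ (c - 1) + (1 / 2) ^ (c - 1)) * max (1 - ρ) (1 - u) ^ (c - 1) := by
      refine rpow_le_of_comparable (lt_max_of_lt_left he) ?_ ?_
      · rcases max_cases (1 - ρ) (1 - u) with h | h <;> linarith
      · linarith [le_max_left (1 - ρ) (1 - u), le_max_right (1 - ρ) (1 - u)]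
    calc _ ≤ (1 + (1 / 2) ^ (a - 1)) * (1 - u) ^ (b - 1) *
          ((2 ^ (c - 1) + (1 / 2) ^ (c - 1)) * max (1 - ρ) (1 - u) ^ (c - 1)) := by gcongr
      _ = M₂ * eulerModel b c (1 - ρ) (1 - u) := by unfold eulerModel; ring
      _ ≤ _ := by
        have := mul_pos hM₁ hua
        linarith

/-- Lower bound by the contribution of `u ∈ (1/2, 1)`, rescaled to the unit interval. -/
lemma exists_le_eulerIntegral {a b : ℝ} (c : ℝ) (ha : 0 < a) (hb : 0 < b) :
    ∃ k : ℝ, 0 < k ∧ ∀ ρ ∈ Set.Ioo (0 : ℝ) 1,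
      k * ∫ w in (0 : ℝ)..1, eulerModel b c (1 - ρ) w ≤ eulerIntegral a b c ρ := by
  set m : ℝ := min (2 ^ (a - 1)) ((1 / 2) ^ (a - 1)) * (1 / 2) ^ (b - 1) *
    min (2 ^ (c - 1)) ((1 / 2) ^ (c - 1))
  have hm : 0 < m := by positivity
  refine ⟨2⁻¹ * m, by positivity, fun ρ hρ => ?_⟩
  have he : 0 < 1 - ρ := by linarith [hρ.2]
  set f : ℝ → ℝ := fun u => u ^ (a - 1) * (1 - u) ^ (b - 1) * (1 - ρ * u) ^ (c - 1)
  have hfI : IntervalIntegrable f MeasureTheory.volume 0 1 :=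
    (intervalIntegrable_iff_integrableOn_Ioo_of_le zero_le_one).2
      (integrableOn_eulerIntegrand ha hb hρ)
  have hf0 : ∀ u ∈ Set.Icc (0 : ℝ) 1, 0 ≤ f u := by
    intro u hu
    have h1 : 0 ≤ 1 - u := by linarith [hu.2]
    have h2 : 0 ≤ 1 - ρ * u := by nlinarith [hu.1, hu.2, hρ.1, hρ.2]
    have h3 := hu.1
    simp only [f]
    positivity
  have hfI1 : IntervalIntegrable f MeasureTheory.volume 0 (1 / 2) :=
    hfI.mono_set (by rw [Set.uIcc_of_le, Set.uIcc_of_le] <;>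
      first | exact Set.Icc_subset_Icc_right (by norm_num) | norm_num)
  have hfI2 : IntervalIntegrable f MeasureTheory.volume (1 / 2) 1 :=
    hfI.mono_set (by rw [Set.uIcc_of_le, Set.uIcc_of_le] <;>
      first | exact Set.Icc_subset_Icc_left (by norm_num) | norm_num)
  have h1 : ∫ u in (1 / 2 : ℝ)..1, f u ≤ ∫ u in (0 : ℝ)..1, f u := by
    rw [← intervalIntegral.integral_add_adjacent_intervals hfI1 hfI2]
    have := intervalIntegral.integral_nonneg (μ := MeasureTheory.volume)
      (show (0 : ℝ) ≤ 1 / 2 by norm_num) (f := f)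
      fun u hu => hf0 u ⟨hu.1, hu.2.trans (by norm_num)⟩
    linarith
  have h2 : ∫ u in (1 / 2 : ℝ)..1, f u = 2⁻¹ * ∫ v in (0 : ℝ)..1, f (1 - 1 / 2 * v) := by
    rw [intervalIntegral.integral_comp_sub_mul f (by norm_num : (1 / 2 : ℝ) ≠ 0)]
    norm_num
    ring
  have hfI3 : IntervalIntegrable (fun v => f (1 - 1 / 2 * v)) MeasureTheory.volume 0 1 := by
    have := (hfI2.comp_sub_left 1).comp_mul_left (c := 1 / 2)
    norm_num at this
    simpa using this.symm
  have h3 : m * ∫ w in (0 : ℝ)..1, eulerModel b c (1 - ρ) w ≤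
      ∫ v in (0 : ℝ)..1, f (1 - 1 / 2 * v) := by
    rw [← intervalIntegral.integral_const_mul]
    refine intervalIntegral.integral_mono_on_of_le_Ioo zero_le_one
      ((intervalIntegrable_eulerModel c hb he 0 1).const_mul m) hfI3 fun v hv => ?_
    have hv0 := hv.1
    have hv1 := hv.2
    have b1 := le_rpow_of_comparable (s := a - 1) (m := 1) (y := 1 - 1 / 2 * v) one_pos
      (by linarith) (by linarith)
    have b2 := le_rpow_of_comparable (s := c - 1) (m := max (1 - ρ) v)
      (y := 1 - ρ * (1 - 1 / 2 * v)) (lt_max_of_lt_left he)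
      (by rcases max_cases (1 - ρ) v with h | h <;> nlinarith [hρ.1, hρ.2])
      (by nlinarith [le_max_left (1 - ρ) v, le_max_right (1 - ρ) v, hρ.1, hρ.2])
    rw [Real.one_rpow, mul_one] at b1
    have hmx : 0 < max (1 - ρ) v := lt_max_of_lt_left he
    have e1 : (1 - (1 - 1 / 2 * v)) ^ (b - 1) = (1 / 2) ^ (b - 1) * v ^ (b - 1) := by
      rw [← Real.mul_rpow (by norm_num) hv0.le]; ring_nf
    have hy : 0 ≤ 1 - 1 / 2 * v := by linarith
    simp only [f, e1]
    calc m * eulerModel b c (1 - ρ) v = min (2 ^ (a - 1)) ((1 / 2) ^ (a - 1)) *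
          ((1 / 2) ^ (b - 1) * v ^ (b - 1)) *
          (min (2 ^ (c - 1)) ((1 / 2) ^ (c - 1)) * max (1 - ρ) v ^ (c - 1)) := by
          simp only [m, eulerModel]; ring
      _ ≤ _ := by gcongr
  rw [eulerIntegral_eq_intervalIntegral]
  calc _ = 2⁻¹ * (m * ∫ w in (0 : ℝ)..1, eulerModel b c (1 - ρ) w) := by ring
    _ ≤ 2⁻¹ * ∫ v in (0 : ℝ)..1, f (1 - 1 / 2 * v) := by gcongr
    _ ≤ _ := by rw [← h2]; exact h1

/-- Two-sided estimate of Euler's integral, uniform in `ρ ∈ (0, 1)`. The additive constant of the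
upper bound is absorbed because `growth` is at least `1`. -/
lemma exists_eulerIntegral_bounds {a b : ℝ} (c : ℝ) (ha : 0 < a) (hb : 0 < b) :
    ∃ k K : ℝ, 0 < k ∧ 0 < K ∧ ∀ ρ ∈ Set.Ioo (0 : ℝ) 1,
      k * growth (b + c - 1) (1 - ρ) ≤ eulerIntegral a b c ρ ∧
      eulerIntegral a b c ρ ≤ K * growth (b + c - 1) (1 - ρ) := by
  obtain ⟨k₀, K₀, hk₀, hK₀, h₀⟩ := exists_integral_eulerModel_bounds c hb
  obtain ⟨K₁, K₂, hK₁, hK₂, hup⟩ := exists_eulerIntegral_le c ha hb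
  obtain ⟨k₁, hk₁, hlo⟩ := exists_le_eulerIntegral c ha hb
  refine ⟨k₁ * k₀, K₁ + K₂ * K₀, by positivity, by positivity, fun ρ hρ => ?_⟩
  have he : 0 < 1 - ρ := by linarith [hρ.2]
  have he1 : 1 - ρ < 1 := by linarith [hρ.1]
  obtain ⟨h1, h2⟩ := h₀ (1 - ρ) he he1
  have hg := one_le_growth (b + c - 1) he he1
  constructor
  · refine le_trans ?_ (hlo ρ hρ)
    rw [mul_assoc]
    gcongr
  · refine (hup ρ hρ).trans ?_
    rw [add_mul, mul_assoc K₂]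
    gcongr
    exact le_mul_of_one_le_right hK₁.le hg

/-! ### The kernel in the original variables -/

/-- The kernel's integrand up to a constant factor, as a continuous function of `y`; the exponent
`2 α + 1` is positive, so there is no singularity at `y = 0`. -/
noncomputable def smoothIntegrand (α β t x z y : ℝ) : ℝ :=
  clifford (α + β) (t ^ 2 * (y ^ 2 / 4)) *
    (clifford α (x ^ 2 * (y ^ 2 / 4)) * clifford α (z ^ 2 * (y ^ 2 / 4))) * y ^ (2 * α + 1)

lemma continuous_smoothIntegrand {α β : ℝ} (hα : -(1 / 2) < α) (hβ : 0 < β) (t x z : ℝ) :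
    Continuous (smoothIntegrand α β t x z) := by
  have h1 := continuous_clifford (show -1 < α + β by linarith)
  have h2 := continuous_clifford (show -1 < α by linarith)
  have h3 : Continuous fun y : ℝ => y ^ (2 * α + 1) :=
    continuous_id.rpow_const fun _ => Or.inr (by linarith)
  unfold smoothIntegrand
  fun_prop

lemma kernelIntegrand_eq (α β : ℝ) {t x z y : ℝ} (ht : 0 < t) (hx : 0 < x) (hz : 0 < z)
    (hy : 0 < y) :
    kernelIntegrand α β t x z y =
      2 ^ (-(α + β)) * 2 ^ (-α) * 2 ^ (-α) * smoothIntegrand α β t x z y := by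
  rw [kernelIntegrand, besselJ_div_rpow _ (by positivity), besselJ_div_rpow _ (by positivity),
    besselJ_div_rpow _ (by positivity), smoothIntegrand]
  have e : ∀ w : ℝ, (w * y) ^ 2 / 4 = w ^ 2 * (y ^ 2 / 4) := fun w => by ring
  simp only [e]
  ring

lemma intervalIntegrable_kernelIntegrand {α β t x z R : ℝ} (hα : -(1 / 2) < α) (hβ : 0 < β)
    (ht : 0 < t) (hx : 0 < x) (hz : 0 < z) (hR : 0 < R) :
    IntervalIntegrable (kernelIntegrand α β t x z) MeasureTheory.volume 0 R := by
  refine (((continuous_smoothIntegrand hα hβ t x z).intervalIntegrable 0 R).const_mul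
    (2 ^ (-(α + β)) * 2 ^ (-α) * 2 ^ (-α))).congr fun y hy => ?_
  rw [Set.uIoc_of_le hR.le] at hy
  exact (kernelIntegrand_eq α β ht hx hz hy.1).symm

/-- Substitution `η = y² / 4`. -/
lemma kernelTruncation_eq {α β t x z R : ℝ} (hα : -(1 / 2) < α) (hβ : 0 < β)
    (ht : 0 < t) (hx : 0 < x) (hz : 0 < z) (hR : 0 < R) :
    kernelTruncation α β t x z R = 2 * Real.Gamma (α + β + 1) * (t ^ 2) ^ (-(α + β)) *
      truncIntegral (α + β) α x z (R ^ 2 / 4) (t ^ 2) := by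
  set g : ℝ → ℝ := fun η => clifford (α + β) (t ^ 2 * η) * besselPair α x z η
  have hR2 : 0 ≤ R ^ 2 / 4 := by positivity
  have himg : (fun y : ℝ => y ^ 2 / 4) '' Set.uIcc 0 R ⊆ Set.Icc 0 (R ^ 2 / 4) := by
    rintro _ ⟨y, hy, rfl⟩
    rw [Set.uIcc_of_le hR.le] at hy
    have := hy.1
    have := pow_le_pow_left₀ hy.1 hy.2 2
    exact ⟨by positivity, by simp only; linarith⟩
  have hpt : ∀ y ∈ Set.Icc 0 R,
      (g ∘ fun y : ℝ => y ^ 2 / 4) y * (y / 2) =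
        2⁻¹ * 4 ^ (-α) * smoothIntegrand α β t x z y := by
    intro y hy
    rcases hy.1.eq_or_lt with h0 | h0
    · rw [← h0, smoothIntegrand, Real.zero_rpow (by linarith)]
      simp
    · have e1 : (y ^ 2 / 4) ^ α * y = 4 ^ (-α) * y ^ (2 * α + 1) := by
        rw [Real.div_rpow (by positivity) (by norm_num), Real.rpow_neg (by norm_num),
          Real.rpow_add_one h0.ne', Real.rpow_mul h0.le, Real.rpow_two]
        ring
      simp only [g, besselPair, Function.comp, smoothIntegrand]
      linear_combination (2⁻¹ * clifford (α + β) (t ^ 2 * (y ^ 2 / 4)) *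
        (clifford α (x ^ 2 * (y ^ 2 / 4)) * clifford α (z ^ 2 * (y ^ 2 / 4)))) * e1
  have hgI : IntervalIntegrable g MeasureTheory.volume 0 (R ^ 2 / 4) :=
    intervalIntegrable_clifford_mul_besselPair (by linarith) (by linarith) _ _ _ _ _
  have hsub := intervalIntegral.integral_comp_mul_deriv''' (a := 0) (b := R)
    (f := fun y : ℝ => y ^ 2 / 4) (f' := fun y => y / 2) (g := g)
    (Continuous.continuousOn (by fun_prop))
    (fun y _ => by
      refine HasDerivAt.hasDerivWithinAt (HasDerivAt.congr_deriv
        (((hasDerivAt_id y).pow 2).div_const 4) ?_)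
      simp
      ring)
    (by
      have h1 := continuous_clifford (show -1 < α + β by linarith)
      have h2 := continuous_clifford (show -1 < α by linarith)
      refine ContinuousOn.mul (by fun_prop) (ContinuousOn.mul (by fun_prop) ?_)
      refine continuousOn_id.rpow_const ?_
      rintro _ ⟨y, hy, rfl⟩
      rw [min_eq_left hR.le] at hy
      have := hy.1
      exact Or.inl (by simp only [id]; positivity))
    (((intervalIntegrable_iff_integrableOn_Icc_of_le hR2).1 hgI).mono_set himg)
    (by
      rw [Set.uIcc_of_le hR.le]
      refine MeasureTheory.IntegrableOn.congr_fun ?_ (fun y hy => (hpt y hy).symm) measurableSet_Icc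
      exact (Continuous.continuousOn
        ((continuous_smoothIntegrand hα hβ t x z).const_mul _)).integrableOn_compact isCompact_Icc)
  have hk : ∫ y in (0 : ℝ)..R, kernelIntegrand α β t x z y =
      2 ^ (-(α + β)) * 2 * ∫ η in (0 : ℝ)..(R ^ 2 / 4), g η := by
    have e0 : ((0 : ℝ) ^ 2 / 4) = 0 := by norm_num
    simp only [e0] at hsub
    rw [← hsub, ← intervalIntegral.integral_const_mul]
    refine intervalIntegral.integral_congr_ae (Filter.Eventually.of_forall fun y hy => ?_)
    rw [Set.uIoc_of_le hR.le] at hy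
    have h4 : (4 : ℝ) ^ (-α) = 2 ^ (-α) * 2 ^ (-α) := by
      rw [← Real.mul_rpow (by norm_num) (by norm_num)]; norm_num
    rw [kernelIntegrand_eq α β ht hx hz hy.1, hpt y ⟨hy.1.le, hy.2⟩, h4]
    ring
  have e2 : (2 : ℝ) ^ (α + β) * 2 ^ (-(α + β)) = 1 := by
    rw [← Real.rpow_add (by norm_num)]; simp
  have e3 : (t ^ 2) ^ (-(α + β)) * (t ^ 2) ^ (α + β) = 1 := by
    rw [← Real.rpow_add (by positivity)]; simp
  rw [kernelTruncation, hk, truncIntegral]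
  generalize (2 : ℝ) ^ (α + β) = p at *
  generalize (2 : ℝ) ^ (-(α + β)) = p' at *
  generalize (t ^ 2) ^ (-(α + β)) = q' at *
  generalize (t ^ 2) ^ (α + β) = q at *
  simp only [g]
  linear_combination (2 * Real.Gamma (α + β + 1) * ∫ η in (0 : ℝ)..(R ^ 2 / 4),
    clifford (α + β) (t ^ 2 * η) * besselPair α x z η) * (e2 - e3)

/-- The constant relating the kernel to the generalised translate. -/
noncomputable def kernelConst (α β : ℝ) : ℝ :=
  2 * Real.Gamma (α + β + 1) / (Real.Gamma β * (betaMass α * Real.Gamma (α + 1)))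

lemma kernelConst_pos {α β : ℝ} (hα : -(1 / 2) < α) (hβ : 0 < β) : 0 < kernelConst α β := by
  have h1 := Real.Gamma_pos_of_pos (show 0 < α + β + 1 by linarith)
  have h2 := Real.Gamma_pos_of_pos hβ
  have h3 := Real.Gamma_pos_of_pos (show 0 < α + 1 by linarith)
  have h4 := betaMass_pos hα
  unfold kernelConst
  positivity

lemma sq_mem_regularSet {t x z : ℝ} (ht : 0 < t) (hx : 0 < x) (hz : 0 < z) (h1 : |x - z| < t)
    (h2 : t ≠ x + z) : t ^ 2 ∈ regularSet x z := by
  refine ⟨?_, fun h => h2 ?_⟩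
  · rw [← sq_abs (x - z)]
    exact pow_lt_pow_left₀ h1 (abs_nonneg _) two_ne_zero
  · exact (pow_left_inj₀ ht.le (by positivity) two_ne_zero).1 h

lemma tendsto_kernelTruncation {α β t x z : ℝ} (hα : -(1 / 2) < α) (hβ : 0 < β)
    (ht : 0 < t) (hx : 0 < x) (hz : 0 < z) (h : t ^ 2 ∈ regularSet x z) :
    Tendsto (kernelTruncation α β t x z) atTop
      (𝓝 (kernelConst α β * (t ^ 2) ^ (-(α + β)) * translate α β x z (t ^ 2))) := by
  have hR : Tendsto (fun R : ℝ => R ^ 2 / 4) atTop atTop :=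
    (tendsto_pow_atTop two_ne_zero).atTop_div_const (by norm_num)
  have h1 := ((tendsto_truncIntegral hα hβ hx hz h).comp hR).const_mul
    (2 * Real.Gamma (α + β + 1) * (t ^ 2) ^ (-(α + β)))
  have e : kernelConst α β * (t ^ 2) ^ (-(α + β)) * translate α β x z (t ^ 2) =
      2 * Real.Gamma (α + β + 1) * (t ^ 2) ^ (-(α + β)) *
        (translate α β x z (t ^ 2) / (Real.Gamma β * (betaMass α * Real.Gamma (α + 1)))) := by
    rw [kernelConst]; ring
  rw [e]
  refine h1.congr' ?_
  filter_upwards [eventually_gt_atTop 0] with R hR0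
  exact (kernelTruncation_eq hα hβ ht hx hz hR0).symm

/-- The kernel in closed form: the content of Sonine's and Gegenbauer's integrals. -/
lemma kernel_eq {α β t x z : ℝ} (hα : -(1 / 2) < α) (hβ : 0 < β)
    (ht : 0 < t) (hx : 0 < x) (hz : 0 < z) (h : t ^ 2 ∈ regularSet x z) :
    kernel α β t x z = kernelConst α β * (t ^ 2) ^ (-(α + β)) * translate α β x z (t ^ 2) :=
  (tendsto_kernelTruncation hα hβ ht hx hz h).limUnder_eq

lemma sq_rpow_neg {t : ℝ} (ht : 0 < t) (α β : ℝ) :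
    (t ^ 2) ^ (-(α + β)) = 1 / t ^ (2 * α + 2 * β) := by
  rw [← Real.rpow_two, ← Real.rpow_mul ht.le, one_div, ← Real.rpow_neg ht.le]
  ring_nf

/-! ### Comparison functions in terms of `growth` -/

lemma outerBound_eq {α β t x z : ℝ} (hx : 0 < x) (hz : 0 < z) (h : x + z < t) :
    outerBound α β t x z = 1 / t ^ (2 * α + 2 * β) * (t ^ 2 - (x - z) ^ 2) ^ (β - 1) *
      growth (α + 1 / 2 + β - 1) (1 - 4 * (x * z) / (t ^ 2 - (x - z) ^ 2)) := by
  have hxz : 0 < x * z := by positivity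
  have hsq : (x + z) ^ 2 < t ^ 2 := pow_lt_pow_left₀ h (by positivity) two_ne_zero
  have hD : 0 < t ^ 2 - (x - z) ^ 2 := by nlinarith
  have e : 1 - 4 * (x * z) / (t ^ 2 - (x - z) ^ 2) =
      (t ^ 2 - (x + z) ^ 2) / (t ^ 2 - (x - z) ^ 2) := by
    field_simp
    ring
  rw [outerBound, growth, e, one_div_div, show α + 1 / 2 + β - 1 = α + β - 1 / 2 by ring]
  simp only [sub_neg, sub_eq_zero]

/-- The factor between `innerBound`, where `(x + z)² - t²` is divided by `x z`, and the same
expression with the denominator `4 x z` that `growth` produces. It matters only for `p < 0`. -/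
noncomputable def innerFactor (p : ℝ) : ℝ := if p < 0 then 4 ^ (-p) else 1

lemma innerFactor_pos (p : ℝ) : 0 < innerFactor p := by
  unfold innerFactor
  split_ifs <;> positivity

lemma innerFactor_mul_innerBound {α β t x z : ℝ} (hx : 0 < x) (hz : 0 < z) (ht : 0 < t)
    (h : t < x + z) :
    innerFactor (α + β - 1 / 2) * innerBound α β t x z =
      (x * z) ^ (-α - 1 / 2) / t ^ (2 * α + 2 * β) * (t ^ 2 - (x - z) ^ 2) ^ (α + β - 1 / 2) *
      growth (β + (α + 1 / 2) - 1) (1 - (t ^ 2 - (x - z) ^ 2) / (4 * (x * z))) := by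
  have hxz : 0 < x * z := by positivity
  have hsq : t ^ 2 < (x + z) ^ 2 := pow_lt_pow_left₀ h ht.le two_ne_zero
  have e : 1 - (t ^ 2 - (x - z) ^ 2) / (4 * (x * z)) =
      ((x + z) ^ 2 - t ^ 2) / (4 * (x * z)) := by
    field_simp
    ring
  rw [innerBound, growth, innerFactor, e, one_div_div,
    show β + (α + 1 / 2) - 1 = α + β - 1 / 2 by ring]
  simp only [sub_neg, sub_eq_zero]
  split_ifs with h1 h2
  · have hq : 0 ≤ ((x + z) ^ 2 - t ^ 2) / (x * z) := div_nonneg (by linarith) hxz.le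
    rw [show ((x + z) ^ 2 - t ^ 2) / (4 * (x * z)) = 4⁻¹ * (((x + z) ^ 2 - t ^ 2) / (x * z)) by
      field_simp, Real.mul_rpow (by norm_num) hq, Real.inv_rpow (by norm_num),
      Real.rpow_neg (by norm_num)]
    ring
  · ring
  · ring

end SphericalMeans

open SphericalMeans in
theorem theorem2p3 (α β : ℝ) (hα : -(1 / 2) < α) (hβ : 0 < β) :
    -- the improper integral defining the kernel converges off the singular surfaces
    (∀ t x z : ℝ, 0 < t → 0 < x → 0 < z → |x - z| < t → t ≠ x + z →
      (∀ R : ℝ, 0 < R → IntervalIntegrable (SphericalMeans.kernelIntegrand α β t x z)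
        MeasureTheory.volume 0 R) ∧
      Tendsto (SphericalMeans.kernelTruncation α β t x z) atTop
        (𝓝 (SphericalMeans.kernel α β t x z))) ∧
    -- two-sided estimate, uniformly in `|x - z| < t < x + z`
    (∃ c C : ℝ, 0 < c ∧ 0 < C ∧
      ∀ t x z : ℝ, 0 < t → 0 < x → 0 < z → |x - z| < t → t < x + z →
        c * SphericalMeans.innerBound α β t x z ≤ SphericalMeans.kernel α β t x z ∧
        SphericalMeans.kernel α β t x z ≤ C * SphericalMeans.innerBound α β t x z) ∧
    -- two-sided estimate, uniformly in `t > x + z`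
    (∃ c C : ℝ, 0 < c ∧ 0 < C ∧
      ∀ t x z : ℝ, 0 < t → 0 < x → 0 < z → x + z < t →
        c * SphericalMeans.outerBound α β t x z ≤ SphericalMeans.kernel α β t x z ∧
        SphericalMeans.kernel α β t x z ≤ C * SphericalMeans.outerBound α β t x z) := by
  have hK := kernelConst_pos hα hβ
  refine ⟨fun t x z ht hx hz h1 h2 => ⟨fun R hR =>
    intervalIntegrable_kernelIntegrand hα hβ ht hx hz hR, ?_⟩, ?_, ?_⟩
  · have hmem := sq_mem_regularSet ht hx hz h1 h2
    rw [kernel_eq hα hβ ht hx hz hmem]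
    exact tendsto_kernelTruncation hα hβ ht hx hz hmem
  · obtain ⟨k, K, hk, hKK, hb⟩ := exists_eulerIntegral_bounds (a := α + 1 / 2) (b := β)
      (α + 1 / 2) (by linarith) hβ
    have hf := innerFactor_pos (α + β - 1 / 2)
    refine ⟨kernelConst α β * 4 ^ (-α - 1 / 2) * k * innerFactor (α + β - 1 / 2),
      kernelConst α β * 4 ^ (-α - 1 / 2) * K * innerFactor (α + β - 1 / 2),
      by positivity, by positivity, fun t x z ht hx hz h1 h2 => ?_⟩
    have hmem := sq_mem_regularSet ht hx hz h1 h2.ne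
    have hsq : t ^ 2 < (x + z) ^ 2 := pow_lt_pow_left₀ h2 ht.le two_ne_zero
    have hxz : 0 < x * z := by positivity
    have hD : 0 < t ^ 2 - (x - z) ^ 2 := sub_pos.2 hmem.1
    have hρ : (t ^ 2 - (x - z) ^ 2) / (4 * (x * z)) ∈ Set.Ioo (0 : ℝ) 1 :=
      ⟨by positivity, by rw [div_lt_one (by positivity)]; nlinarith⟩
    obtain ⟨b1, b2⟩ := hb _ hρ
    set P : ℝ := (x * z) ^ (-α - 1 / 2) / t ^ (2 * α + 2 * β) *
      (t ^ 2 - (x - z) ^ 2) ^ (α + β - 1 / 2) with hP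
    have hP0 : 0 < P := by positivity
    have hker : kernel α β t x z = kernelConst α β * 4 ^ (-α - 1 / 2) * P *
        eulerIntegral (α + 1 / 2) β (α + 1 / 2) ((t ^ 2 - (x - z) ^ 2) / (4 * (x * z))) := by
      have e1 : ((t ^ 2 - (x - z) ^ 2) / (4 * (x * z))) ^ (α + 1 / 2) =
          (t ^ 2 - (x - z) ^ 2) ^ (α + 1 / 2) * (4 ^ (-α - 1 / 2) * (x * z) ^ (-α - 1 / 2)) := by
        rw [← Real.mul_rpow (by norm_num) hxz.le, Real.div_rpow hD.le (by positivity),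
          show -α - 1 / 2 = -(α + 1 / 2) by ring, Real.rpow_neg (by positivity)]
        rfl
      have e2 : (t ^ 2 - (x - z) ^ 2) ^ (β - 1) * (t ^ 2 - (x - z) ^ 2) ^ (α + 1 / 2) =
          (t ^ 2 - (x - z) ^ 2) ^ (α + β - 1 / 2) := by
        rw [← Real.rpow_add hD]; ring_nf
      rw [kernel_eq hα hβ ht hx hz hmem, translate_inner hx hz hmem.1 hsq, e1, sq_rpow_neg ht, hP,
        ← e2]
      ring
    have hB := innerFactor_mul_innerBound (α := α) (β := β) hx hz ht h2
    rw [← hP] at hB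
    rw [hker, mul_assoc _ (innerFactor _), mul_assoc _ (innerFactor _), hB]
    generalize growth (β + (α + 1 / 2) - 1) (1 - (t ^ 2 - (x - z) ^ 2) / (4 * (x * z))) = G at *
    constructor
    · calc _ = kernelConst α β * 4 ^ (-α - 1 / 2) * P * (k * G) := by ring
        _ ≤ _ := by gcongr
    · calc _ ≤ kernelConst α β * 4 ^ (-α - 1 / 2) * P * (K * G) := by gcongr
        _ = _ := by ring
  · obtain ⟨k, K, hk, hKK, hb⟩ := exists_eulerIntegral_bounds (a := α + 1 / 2) (b := α + 1 / 2)
      β (by linarith) (by linarith)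
    refine ⟨kernelConst α β * k, kernelConst α β * K, by positivity, by positivity,
      fun t x z ht hx hz h2 => ?_⟩
    have h1 : |x - z| < t := by rw [abs_lt]; constructor <;> linarith
    have hmem := sq_mem_regularSet ht hx hz h1 h2.ne'
    have hsq : (x + z) ^ 2 < t ^ 2 := pow_lt_pow_left₀ h2 (by positivity) two_ne_zero
    have hxz : 0 < x * z := by positivity
    have hD : 0 < t ^ 2 - (x - z) ^ 2 := sub_pos.2 hmem.1
    have hρ : 4 * (x * z) / (t ^ 2 - (x - z) ^ 2) ∈ Set.Ioo (0 : ℝ) 1 :=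
      ⟨by positivity, by rw [div_lt_one hD]; nlinarith⟩
    obtain ⟨b1, b2⟩ := hb _ hρ
    rw [outerBound_eq hx hz h2, kernel_eq hα hβ ht hx hz hmem, translate_outer hx hz hsq,
      sq_rpow_neg ht]
    generalize growth (α + 1 / 2 + β - 1) (1 - 4 * (x * z) / (t ^ 2 - (x - z) ^ 2)) = G at *
    have hT : 0 < 1 / t ^ (2 * α + 2 * β) * (t ^ 2 - (x - z) ^ 2) ^ (β - 1) := by positivity
    generalize
      eulerIntegral (α + 1 / 2) (α + 1 / 2) β (4 * (x * z) / (t ^ 2 - (x - z) ^ 2)) = E at *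
    constructor
    · calc _ = kernelConst α β * (1 / t ^ (2 * α + 2 * β) * (t ^ 2 - (x - z) ^ 2) ^ (β - 1)) *
            (k * G) := by ring
        _ ≤ kernelConst α β * (1 / t ^ (2 * α + 2 * β) * (t ^ 2 - (x - z) ^ 2) ^ (β - 1)) * E := by
            gcongr
        _ = _ := by ring
    · calc _ = kernelConst α β * (1 / t ^ (2 * α + 2 * β) * (t ^ 2 - (x - z) ^ 2) ^ (β - 1)) *
            E := by ring
        _ ≤ kernelConst α β * (1 / t ^ (2 * α + 2 * β) * (t ^ 2 - (x - z) ^ 2) ^ (β - 1)) *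
            (K * G) := by gcongr
        _ = _ := by ring
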